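/- For real random variables $X,Y$ on a common probability space with continuous distribution functions $F,G$, let $$\tau(X,Y)=\mathbb P\big((X_1-X_2)(Y_1-Y_2)>0\big)-\mathbb P\big((X_1-X_2)(Y_1-Y_2)<0\big),\qquad \rho(X,Y)=12\Big(\mathbb E\big[F(X)G(Y)\big]-\tfrac14\Big)$$ denote Kendall's tau and Spearman's rho, where $(X_1,Y_1),(X_2,Y_2)$ are independent copies of $(X,Y)$. Let $$\Omega=\{(\tau(X,Y),\rho(X,Y)): X,Y \text{ random variables with continuous distribution functions}\}$$ be the exact $\tau$-$\rho$ region. For integers $n\ge 2$ put $$\Phi_n(x)=-1-\frac4{n^2}+\frac3n+\frac{3x}n-\frac{n-2}{\sqrt2\,n^2\sqrt{n-1}}\,(n-2+nx)^{3/2},$$ let $\Phi:[-1,1]\to[-1,1]$ be the (well-defined) function with $\Phi(-1)=-1$ and $\Phi(x)=\Phi_n(x)$ for $x\in\big[\frac{2-n}{n},\frac{2-(n-1)}{n-1}\big]$, $n\ge2$, and let $$\Omega_\Phi=\{(x,y)\in[-1,1]^2:\ \Phi(x)\le y\le-\Phi(-x)\}.$$ Then $\Omega=\Omega_\Phi$.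 The same set is obtained from copulas: $\Omega=\{(\tau(A),\rho(A)): A \text{ a two-dimensional copula}\}$, where $\tau(A)=4\int_{[0,1]^2}A\,d\mu_A-1$, $\rho(A)=12\int_{[0,1]^2}xy\,d\mu_A(x,y)-3$, and $\mu_A$ is the measure on $[0,1]^2$ with $\mu_A([0,x]\times[0,y])=A(x,y)$. Moreover $\Omega$ is not convex, but it is compact and simply connected. Every $(x,y)\in\Omega$ satisfies the Durbin–Stuart inequalities $$\frac{(1+x)^2}{2}-1\le y\le 1-\frac{(1-x)^2}{2}.$$ With $p_n=\big(-1+\frac2n,-1+\frac2{n^2}\big)$ for $n\ge1$ (so $p_1=(1,1)$), the points of $\Omega$ at which the first inequality is an equality are exactly the points $p_n$, $n\ge1$, and their limit $(-1,-1)=-p_1$; the points of $\Omega$ at which the second is an equality are exactly the points $-p_n$, $n\ge1$, and $(1,1)=p_1$. -/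

import Mathlib

open MeasureTheory ProbabilityTheory

/-- Kendall's tau of `(X, Y)`: probability of concordance minus probability of discordance of two
independent copies, realised on the product probability space. -/
noncomputable def kendallTau {S : Type} [MeasurableSpace S] (P : Measure S) (X Y : S → ℝ) : ℝ :=
  (P.prod P).real {w | 0 < (X w.1 - X w.2) * (Y w.1 - Y w.2)} -
    (P.prod P).real {w | (X w.1 - X w.2) * (Y w.1 - Y w.2) < 0}

/-- Spearman's rho of `(X, Y)`: `12 (E[U V] - 1/4)` with `U = F ∘ X`, `V = G ∘ Y`, where `F`, `G`
are the distribution functions of `X`, `Y`. -/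
noncomputable def spearmanRho {S : Type} [MeasurableSpace S] (P : Measure S) (X Y : S → ℝ) : ℝ :=
  12 * ((∫ s, cdf (P.map X) (X s) * cdf (P.map Y) (Y s) ∂P) - 1 / 4)

/-- The exact tau-rho region: all pairs `(τ(X, Y), ρ(X, Y))` for random variables `X`, `Y` with
continuous distribution functions on a common probability space. -/
def exactRegion : Set (ℝ × ℝ) :=
  {p | ∃ (S : Type) (_ : MeasurableSpace S) (P : Measure S) (X Y : S → ℝ),
    IsProbabilityMeasure P ∧ Measurable X ∧ Measurable Y ∧
    Continuous (cdf (P.map X)) ∧ Continuous (cdf (P.map Y)) ∧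
    p = (kendallTau P X Y, spearmanRho P X Y)}

/-- Two-dimensional copulas: grounded, with uniform margins, and 2-increasing. -/
structure IsCopula (A : unitInterval → unitInterval → ℝ) : Prop where
  left_zero : ∀ y, A 0 y = 0
  right_zero : ∀ x, A x 0 = 0
  left_one : ∀ y, A 1 y = y
  right_one : ∀ x, A x 1 = x
  two_increasing : ∀ x₁ x₂ y₁ y₂, x₁ ≤ x₂ → y₁ ≤ y₂ →
    0 ≤ A x₂ y₂ - A x₁ y₂ - A x₂ y₁ + A x₁ y₁

/-- `μ` is the doubly stochastic measure of `A`, i.e. `μ ([0,x] × [0,y]) = A(x,y)`. -/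
def IsMeasureOf (A : unitInterval → unitInterval → ℝ)
    (μ : Measure (unitInterval × unitInterval)) : Prop :=
  ∀ x y, μ (Set.Icc 0 x ×ˢ Set.Icc 0 y) = ENNReal.ofReal (A x y)

/-- The pairs `(τ(A), ρ(A))`, `A` a copula with doubly stochastic measure `μ`, where
`τ(A) = 4 ∫ A dμ - 1` and `ρ(A) = 12 ∫ x y dμ(x,y) - 3`. -/
noncomputable def copulaRegion : Set (ℝ × ℝ) :=
  {p | ∃ (A : unitInterval → unitInterval → ℝ) (μ : Measure (unitInterval × unitInterval)),
    IsCopula A ∧ IsMeasureOf A μ ∧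
    p = (4 * (∫ z, A z.1 z.2 ∂μ) - 1, 12 * (∫ z, (z.1 : ℝ) * (z.2 : ℝ) ∂μ) - 3)}

/-- The function `Φ_n`. -/
noncomputable def PhiN (n : ℕ) (x : ℝ) : ℝ :=
  -1 - 4 / (n : ℝ) ^ 2 + 3 / n + 3 * x / n -
    ((n : ℝ) - 2) / (√2 * (n : ℝ) ^ 2 * √((n : ℝ) - 1)) * ((n : ℝ) - 2 + n * x) ^ (3 / 2 : ℝ)

/-- The interval `[(2-n)/n, (2-(n-1))/(n-1)]` on which `Φ` is given by `Φ_n` (for `n ≥ 2`). -/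
noncomputable def phiInterval (n : ℕ) : Set ℝ :=
  Set.Icc ((2 - (n : ℝ)) / n) ((2 - ((n : ℝ) - 1)) / ((n : ℝ) - 1))

open Classical in
/-- The function `Φ` on `[-1, 1]`: `Φ = Φ_n` on the `n`-th interval, and `Φ(-1) = -1`. The value
does not depend on the chosen `n`, see `Phi_eq_PhiN`. -/
noncomputable def Phi (x : ℝ) : ℝ :=
  if h : ∃ n : ℕ, 2 ≤ n ∧ x ∈ phiInterval n then PhiN h.choose x else -1

/-- The region `Ω_Φ`. -/
def regionPhi : Set (ℝ × ℝ) :=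
  {p | p.1 ∈ Set.Icc (-1 : ℝ) 1 ∧ p.2 ∈ Set.Icc (-1 : ℝ) 1 ∧
    Phi p.1 ≤ p.2 ∧ p.2 ≤ -Phi (-p.1)}

/-- The points `p_n = (-1 + 2/n, -1 + 2/n²)`. -/
noncomputable def dsPoint (n : ℕ) : ℝ × ℝ :=
  (-1 + 2 / (n : ℝ), -1 + 2 / (n : ℝ) ^ 2)

theorem PhiN_overlap {n : ℕ} (hn : 2 ≤ n) :
    PhiN (n + 1) ((2 - (n : ℝ)) / n) = PhiN n ((2 - (n : ℝ)) / n) := by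
  have h0 : (2 : ℝ) ≤ n := by exact_mod_cast hn
  have hpos : (0 : ℝ) < n := by linarith
  have e1 : ((n : ℝ) - 2 + n * ((2 - (n : ℝ)) / n)) = 0 := by field_simp; ring
  have e2 : ((n + 1 : ℝ) - 2 + (n + 1) * ((2 - (n : ℝ)) / n)) = 2 / n := by field_simp; ring
  have e3 : (2 / (n : ℝ)) ^ (3 / 2 : ℝ) = (2 / n) * (√2 / √n) := by
    rw [show (3 / 2 : ℝ) = 1 + 1 / 2 by norm_num, Real.rpow_add (by positivity), Real.rpow_one,
      ← Real.sqrt_eq_rpow, Real.sqrt_div (by norm_num)]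
  have e4 : (√(n : ℝ)) ^ 2 = n := Real.sq_sqrt hpos.le
  have e5 : 0 < √(n : ℝ) := Real.sqrt_pos.2 hpos
  have e6 : 0 < √(2 : ℝ) := Real.sqrt_pos.2 (by norm_num)
  unfold PhiN
  push_cast
  rw [e1, e2, e3, Real.zero_rpow (by norm_num), add_sub_cancel_right]
  have : ((n : ℝ) + 1 - 2) / (√2 * ((n : ℝ) + 1) ^ 2 * √n) * (2 / n * (√2 / √n)) =
      2 * ((n : ℝ) - 1) / (((n : ℝ) + 1) ^ 2 * n * n) := by
    field_simp
    rw [e4]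
    ring
  rw [this]
  field_simp
  ring

/-- `Φ` is well defined by its case distinction. -/
theorem Phi_eq_PhiN {n : ℕ} {x : ℝ} (hn : 2 ≤ n) (hx : x ∈ phiInterval n) :
    Phi x = PhiN n x := by
  have key : ∀ m k : ℕ, 2 ≤ m → m < k → x ∈ phiInterval m → x ∈ phiInterval k →
      PhiN m x = PhiN k x := by
    intro m k hm hmk h1 h2
    have hm' : (2 : ℝ) ≤ m := by exact_mod_cast hm
    have hmk' : (m : ℝ) + 1 ≤ k := by exact_mod_cast hmk
    have a1 := h1.1
    have a2 := h2.2
    rw [div_le_iff₀ (by linarith)] at a1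
    rw [le_div_iff₀ (by linarith)] at a2
    have hx1 : 0 < x + 1 := by nlinarith
    have hk : (k : ℝ) = m + 1 := by nlinarith
    have hk2 : k = m + 1 := by exact_mod_cast hk
    subst hk2
    have hxe : x = (2 - (m : ℝ)) / m := by
      rw [eq_div_iff (by linarith)]
      push_cast at a2
      linarith
    rw [hxe]
    exact (PhiN_overlap hm).symm
  have h : ∃ n : ℕ, 2 ≤ n ∧ x ∈ phiInterval n := ⟨n, hn, hx⟩
  rw [Phi, dif_pos h]
  obtain ⟨c1, c2⟩ := h.choose_spec
  rcases lt_trichotomy h.choose n with hl | he | hg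
  · exact key _ _ c1 hl c2 hx
  · rw [he]
  · exact (key _ _ hn hg hx c2).symm

/-- The value of `Φ` at the left end point. -/
theorem Phi_neg_one : Phi (-1) = -1 := by
  rw [Phi, dif_neg]
  rintro ⟨n, hn, hx⟩
  have h0 : (2 : ℝ) ≤ n := by exact_mod_cast hn
  have h1 := hx.1
  rw [div_le_iff₀ (by linarith)] at h1
  linarith

/-! Put d = (1 + τ)/2 and F = (1 + ρ)/2. Then d is the probability that two independent points are
concordant, and F is the probability that among three independent points at least two of the three
pairs are concordant. Joining concordant points by an edge turns the lower boundary into an extremal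
problem: in a weighted graph of edge density d, how few triples can span at least two edges? The
optimum is a disjoint union of n - 1 cliques of mass a and one of mass b ≤ a, with d = (n-1)a² + b²
and F = (n-1)a³ + b³. In these parameters the optimum is exactly Φ (`cliqueBound_param`).

Lower bound. On a fixed finite vertex set, compactness gives a minimiser of F - `cliqueBound` d. If
the minimum were -η < 0, stationarity in the vertex weights would determine the number of good
triples through each vertex from its degree, and stationarity in the edge weights would control the
effect of closing open cherries. Choose a vertex v of degree D with at most as many open cherries as
induced paths starting at v, and pass to its non-neighbours. After renormalisation they form a
competitor on the same vertex set, so extremality bounds their triple density from below, while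
counting (`IsGraphon.majDens_link_le`) bounds it from above. A comparison of clique partitions
(`clique_replacement`) turns the two bounds into η ≤ (1 - D)³ η, which is absurd. The bound passes
to doubly stochastic measures by discretising on grids, since `cliqueBound` is continuous.

Upper bound. The reflection y ↦ 1 - y exchanges concordance and discordance and sends (d, F) to (1 -
d, 1 - F).

Attainability. In a skew sum, points in different blocks are discordant, so d adds up with squared
masses and F with cubed masses (`Achievable.skewSum`). Increasing blocks act as cliques and
decreasing blocks as empty graphs. Deforming such configurations at fixed d and applying the
intermediate value theorem fills the whole vertical segment.

The remaining claims are read off the curve: d² ≤ `cliqueBound` d ≤ d, where the first inequality is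
Cauchy–Schwarz for the clique sizes and is an equality on (0, 1] exactly at d = 1/k. -/

/-! ### The boundary curve, parametrised by clique sizes. -/

/-- `Φ` in the coordinates `d = (1 + τ) / 2`, `F = (1 + ρ) / 2`. -/
noncomputable def cliqueBound (d : ℝ) : ℝ := (Phi (2 * d - 1) + 1) / 2

/-- Since the masses sum to 1, n d - 1 = (n-1)(a-b)². The base of the power 3/2 in `PhiN` is
therefore 2(n-1)(a-b)², and the surds cancel. -/
theorem cliqueBound_param {n : ℕ} (hn : 2 ≤ n) {a b : ℝ} (hb : 0 ≤ b) (hba : b ≤ a)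
    (h1 : ((n : ℝ) - 1) * a + b = 1) :
    cliqueBound (((n : ℝ) - 1) * a ^ 2 + b ^ 2) = ((n : ℝ) - 1) * a ^ 3 + b ^ 3 := by
  have h0 : (2 : ℝ) ≤ n := by exact_mod_cast hn
  have hn1 : (0 : ℝ) < (n : ℝ) - 1 := by linarith
  have hn0 : (0 : ℝ) < n := by linarith
  have hk : (n : ℝ) * (((n : ℝ) - 1) * a ^ 2 + b ^ 2) - 1 = ((n : ℝ) - 1) * (a - b) ^ 2 := by
    have : (((n : ℝ) - 1) * a + b) ^ 2 = 1 := by rw [h1]; norm_num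
    linear_combination this
  have hk2 : ((n : ℝ) - 1) * (((n : ℝ) - 1) * a ^ 2 + b ^ 2) ≤ 1 := by
    have : (((n : ℝ) - 1) * a + b) ^ 2 = 1 := by rw [h1]; norm_num
    have hba' : 0 ≤ b * (2 * a - b) := mul_nonneg hb (by linarith)
    have : ((n : ℝ) - 1) * (b * b) ≤ ((n : ℝ) - 1) * (b * (2 * a)) - 0 := by
      have := mul_nonneg hn1.le hba'
      linarith
    nlinarith [sq_nonneg b]
  have hx : 2 * (((n : ℝ) - 1) * a ^ 2 + b ^ 2) - 1 ∈ phiInterval n := by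
    constructor
    · rw [div_le_iff₀ hn0]
      nlinarith [mul_nonneg hn1.le (sq_nonneg (a - b))]
    · rw [le_div_iff₀ hn1]
      linarith
  rw [cliqueBound, Phi_eq_PhiN hn hx, PhiN]
  have e1 : (n : ℝ) - 2 + n * (2 * (((n : ℝ) - 1) * a ^ 2 + b ^ 2) - 1) =
      2 * (((n : ℝ) - 1) * (a - b) ^ 2) := by linear_combination 2 * hk
  have hab : 0 ≤ a - b := by linarith
  have e2 : (2 * (((n : ℝ) - 1) * (a - b) ^ 2)) ^ (3 / 2 : ℝ) =
      2 * (((n : ℝ) - 1) * (a - b) ^ 2) * (√2 * √((n : ℝ) - 1) * (a - b)) := by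
    rw [show (3 / 2 : ℝ) = 1 + 1 / 2 by norm_num, Real.rpow_add_of_nonneg (by positivity)
      (by norm_num) (by norm_num), Real.rpow_one, ← Real.sqrt_eq_rpow, Real.sqrt_mul (by norm_num),
      Real.sqrt_mul hn1.le, Real.sqrt_sq hab]
    ring
  rw [e1, e2]
  have e3 : ((n : ℝ) - 2) / (√2 * (n : ℝ) ^ 2 * √((n : ℝ) - 1)) *
      (2 * (((n : ℝ) - 1) * (a - b) ^ 2) * (√2 * √((n : ℝ) - 1) * (a - b))) =
      2 * ((n : ℝ) - 2) * ((n : ℝ) - 1) * (a - b) ^ 3 / (n : ℝ) ^ 2 := by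
    have : √((n : ℝ) - 1) ≠ 0 := (Real.sqrt_pos.2 hn1).ne'
    field_simp
  rw [e3]
  obtain rfl : b = 1 - ((n : ℝ) - 1) * a := by linarith
  field_simp
  ring

/-- With h = a - b, the mass constraint gives a = (1+h)/n and b = (1-(n-1)h)/n, and the density
fixes h². The two bounds on d say that h² ≥ 0 and that b ≥ 0. -/
theorem exists_clique_sizes {n : ℕ} (hn : 2 ≤ n) {d : ℝ} (h1 : 1 ≤ n * d)
    (h2 : ((n : ℝ) - 1) * d ≤ 1) :
    ∃ a b : ℝ, 0 ≤ b ∧ b ≤ a ∧ ((n : ℝ) - 1) * a + b = 1 ∧ ((n : ℝ) - 1) * a ^ 2 + b ^ 2 = d ∧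
      a - b = √((n * d - 1) / ((n : ℝ) - 1)) := by
  have h0 : (2 : ℝ) ≤ n := by exact_mod_cast hn
  have hn1 : (0 : ℝ) < (n : ℝ) - 1 := by linarith
  have hn0 : (0 : ℝ) < n := by linarith
  set h := √((n * d - 1) / ((n : ℝ) - 1)) with hh
  have hsq : h ^ 2 = (n * d - 1) / ((n : ℝ) - 1) := Real.sq_sqrt (div_nonneg (by linarith) hn1.le)
  have hsq' : h ^ 2 * ((n : ℝ) - 1) = n * d - 1 := by rw [hsq]; field_simp
  have hpos : 0 ≤ h := Real.sqrt_nonneg _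
  have hle : ((n : ℝ) - 1) * h ≤ 1 := by
    have : (((n : ℝ) - 1) * h) ^ 2 ≤ 1 ^ 2 := by nlinarith
    exact le_of_sq_le_sq this (by norm_num) |> fun h => h
  refine ⟨(1 + h) / n, (1 - ((n : ℝ) - 1) * h) / n, div_nonneg (by linarith) hn0.le, ?_, ?_, ?_, ?_⟩
  · gcongr; nlinarith
  · field_simp; ring
  · field_simp
    linear_combination (n : ℝ) * hsq'
  · field_simp; ring

theorem exists_piece {d : ℝ} (hd : 0 < d) (hd1 : d ≤ 1) :
    ∃ n : ℕ, 2 ≤ n ∧ 1 ≤ n * d ∧ ((n : ℝ) - 1) * d ≤ 1 := by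
  refine ⟨⌊1 / d⌋₊ + 1, ?_, ?_, ?_⟩
  · have : 1 ≤ ⌊1 / d⌋₊ := by
      rw [Nat.le_floor_iff (by positivity), le_div_iff₀ hd]; push_cast; linarith
    omega
  · have := Nat.lt_floor_add_one (1 / d)
    rw [div_lt_iff₀ hd] at this
    push_cast
    exact this.le
  · have := Nat.floor_le (show 0 ≤ 1 / d by positivity)
    rw [le_div_iff₀ hd] at this
    push_cast
    linarith

/-- Every density in `(0, 1]` is realised by `n - 1` cliques of size `a` and one of size `b`. -/
theorem exists_clique_partition {d : ℝ} (hd : 0 < d) (hd1 : d ≤ 1) :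
    ∃ (n : ℕ) (a b : ℝ), 2 ≤ n ∧ 0 ≤ b ∧ b ≤ a ∧ ((n : ℝ) - 1) * a + b = 1 ∧
      ((n : ℝ) - 1) * a ^ 2 + b ^ 2 = d ∧ cliqueBound d = ((n : ℝ) - 1) * a ^ 3 + b ^ 3 := by
  obtain ⟨n, hn, h1, h2⟩ := exists_piece hd hd1
  obtain ⟨a, b, hb, hba, e1, e2, -⟩ := exists_clique_sizes hn h1 h2
  exact ⟨n, a, b, hn, hb, hba, e1, e2, e2 ▸ cliqueBound_param hn hb hba e1⟩

/-- Closed form of `cliqueBound` on `[1/n, 1/(n-1)]`. -/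
theorem cliqueBound_eq {n : ℕ} (hn : 2 ≤ n) {d : ℝ} (h1 : 1 ≤ n * d)
    (h2 : ((n : ℝ) - 1) * d ≤ 1) :
    cliqueBound d = -2 / (n : ℝ) ^ 2 + 3 * d / n - ((n : ℝ) - 2) * ((n : ℝ) - 1) / (n : ℝ) ^ 2 *
      √((n * d - 1) / ((n : ℝ) - 1)) ^ 3 := by
  have h0 : (2 : ℝ) ≤ n := by exact_mod_cast hn
  obtain ⟨a, b, hb, hba, e1, e2, e3⟩ := exists_clique_sizes hn h1 h2
  rw [← e3, ← e2, cliqueBound_param hn hb hba e1]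
  obtain rfl : b = 1 - ((n : ℝ) - 1) * a := by linarith
  field_simp
  ring

/-- Moving mass between the cliques with (n-1)a' + b' = 0 gives d' = 2(n-1)(a-b)a' and F' =
3(n-1)(a²-b²)a', whose quotient is 3(a+b)/2. The strict inequalities keep d inside one piece. -/
theorem hasDerivAt_cliqueBound {n : ℕ} (hn : 2 ≤ n) {a b : ℝ} (hb : 0 < b) (hba : b < a)
    (e1 : ((n : ℝ) - 1) * a + b = 1) :
    HasDerivAt cliqueBound (3 / 2 * (a + b)) (((n : ℝ) - 1) * a ^ 2 + b ^ 2) := by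
  have h0 : (2 : ℝ) ≤ n := by exact_mod_cast hn
  have hn1 : (0 : ℝ) < (n : ℝ) - 1 := by linarith
  have hn0 : (0 : ℝ) < n := by linarith
  set d := ((n : ℝ) - 1) * a ^ 2 + b ^ 2 with hd
  have hsq : (((n : ℝ) - 1) * a + b) ^ 2 = 1 := by rw [e1]; norm_num
  have hk : (n : ℝ) * d - 1 = ((n : ℝ) - 1) * (a - b) ^ 2 := by
    rw [hd]; linear_combination hsq
  have hk1 : 1 < (n : ℝ) * d := by
    have : 0 < ((n : ℝ) - 1) * (a - b) ^ 2 := by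
      have : 0 < a - b := by linarith
      positivity
    linarith
  have hk2 : ((n : ℝ) - 1) * d < 1 := by
    have h3 : 0 < ((n : ℝ) - 1) * (b * (2 * a - b)) := by
      have : 0 < 2 * a - b := by linarith
      positivity
    nlinarith [sq_pos_of_pos hb]
  have hr : √((n * d - 1) / ((n : ℝ) - 1)) = a - b := by
    rw [hk, mul_div_cancel_left₀ _ hn1.ne', Real.sqrt_sq (by linarith)]
  have hin : HasDerivAt (fun t : ℝ => (n * t - 1) / ((n : ℝ) - 1)) (n * 1 / ((n : ℝ) - 1)) d :=
    (((hasDerivAt_id d).const_mul (n : ℝ)).sub_const 1).div_const _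
  have hs := hin.sqrt (by rw [hk]; have : a - b ≠ 0 := by linarith
                          positivity)
  have hfin := ((((hasDerivAt_id d).const_mul (3 : ℝ)).div_const (n : ℝ)).const_add
    (-2 / (n : ℝ) ^ 2)).sub ((hs.pow 3).const_mul (((n : ℝ) - 2) * ((n : ℝ) - 1) / (n : ℝ) ^ 2))
  have hev : cliqueBound =ᶠ[nhds d] fun t => -2 / (n : ℝ) ^ 2 + 3 * t / n -
      ((n : ℝ) - 2) * ((n : ℝ) - 1) / (n : ℝ) ^ 2 * √((n * t - 1) / ((n : ℝ) - 1)) ^ 3 := by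
    have o1 : ∀ᶠ t in nhds d, 1 < (n : ℝ) * t :=
      (continuous_const.mul continuous_id).tendsto d |>.eventually (lt_mem_nhds hk1)
    have o2 : ∀ᶠ t in nhds d, ((n : ℝ) - 1) * t < 1 :=
      (continuous_const.mul continuous_id).tendsto d |>.eventually (gt_mem_nhds hk2)
    filter_upwards [o1, o2] with t t1 t2
    exact cliqueBound_eq hn t1.le t2.le
  refine HasDerivAt.congr_of_eventuallyEq (hfin.congr_deriv ?_) hev
  rw [hr]
  obtain rfl : b = 1 - ((n : ℝ) - 1) * a := by linarith
  have : a - (1 - ((n : ℝ) - 1) * a) ≠ 0 := by linarith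
  have h4 : (n : ℝ) * a - 1 ≠ 0 := by
    intro h; apply this; linarith
  field_simp
  push_cast
  ring

/-- Cauchy–Schwarz, (Σx²)² ≤ (Σx³)(Σx), with the explicit defect (n-1)ab(a-b)². The same defect
settles the equality case below: it vanishes only for b = 0 or a = b, that is, for equal cliques. -/
theorem sq_le_cliqueBound {d : ℝ} (hd : 0 ≤ d) (hd1 : d ≤ 1) : d ^ 2 ≤ cliqueBound d := by
  rcases hd.eq_or_lt with rfl | hd
  · simp [cliqueBound, Phi_neg_one]
  obtain ⟨n, a, b, hn, hb, hba, e1, e2, e3⟩ := exists_clique_partition hd hd1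
  have h0 : (2 : ℝ) ≤ n := by exact_mod_cast hn
  rw [e3, ← e2]
  have : 0 ≤ ((n : ℝ) - 1) * a * b * (a - b) ^ 2 := by
    have : 0 ≤ (n : ℝ) - 1 := by linarith
    have : 0 ≤ a := hb.trans hba
    positivity
  calc _ = (((n : ℝ) - 1) * a ^ 3 + b ^ 3) * (((n : ℝ) - 1) * a + b) -
        ((n : ℝ) - 1) * a * b * (a - b) ^ 2 := by ring
    _ ≤ _ := by rw [e1]; linarith

theorem cliqueBound_zero : cliqueBound 0 = 0 := by simp [cliqueBound, Phi_neg_one]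

theorem cliqueBound_le_self {d : ℝ} (hd : 0 ≤ d) (hd1 : d ≤ 1) : cliqueBound d ≤ d := by
  rcases hd.eq_or_lt with rfl | hd
  · simp [cliqueBound_zero]
  obtain ⟨n, a, b, hn, hb, hba, e1, e2, e3⟩ := exists_clique_partition hd hd1
  have h0 : (2 : ℝ) ≤ n := by exact_mod_cast hn
  have hn1 : 0 ≤ (n : ℝ) - 2 := by linarith
  have ha : 0 ≤ a := hb.trans hba
  have ha1 : a ≤ 1 := by nlinarith
  rw [e3, ← e2]
  have : a ^ 3 ≤ a ^ 2 := pow_le_pow_of_le_one ha ha1 (by norm_num)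
  have : b ^ 3 ≤ b ^ 2 := pow_le_pow_of_le_one hb (hba.trans ha1) (by norm_num)
  have : 0 ≤ (n : ℝ) - 1 := by linarith
  gcongr

theorem cliqueBound_eq_sq_iff {d : ℝ} (hd : 0 < d) (hd1 : d ≤ 1) :
    cliqueBound d = d ^ 2 ↔ ∃ k : ℕ, 1 ≤ k ∧ d = 1 / k := by
  constructor
  · intro h
    obtain ⟨n, a, b, hn, hb, hba, e1, e2, e3⟩ := exists_clique_partition hd hd1
    have h0 : (2 : ℝ) ≤ n := by exact_mod_cast hn
    have hn1 : 0 < (n : ℝ) - 1 := by linarith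
    rw [e3, ← e2] at h
    have hz : ((n : ℝ) - 1) * a * b * (a - b) ^ 2 = 0 := by
      calc _ = (((n : ℝ) - 1) * a ^ 3 + b ^ 3) * (((n : ℝ) - 1) * a + b) -
        (((n : ℝ) - 1) * a ^ 2 + b ^ 2) ^ 2 := by ring
        _ = 0 := by rw [e1, h]; ring
    have ha : 0 < a := by
      rcases (hb.trans hba).eq_or_lt with h | h
      · subst h; have : b = 0 := le_antisymm hba hb
        subst this; simp at e1
      · exact h
    have hcase : b = 0 ∨ a = b := by
      rcases mul_eq_zero.1 hz with h | h
      · rcases mul_eq_zero.1 h with h | h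
        · exact absurd h (by positivity)
        · exact Or.inl h
      · exact Or.inr (sub_eq_zero.1 (pow_eq_zero_iff (two_ne_zero) |>.1 h))
    rcases hcase with rfl | rfl
    · refine ⟨n - 1, by omega, ?_⟩
      rw [Nat.cast_sub (by omega)]
      rw [← e2]; push_cast
      rw [eq_div_iff hn1.ne']
      have : ((n : ℝ) - 1) * a = 1 := by linarith
      linear_combination (((n : ℝ) - 1) * a + 1) * this
    · refine ⟨n, by omega, ?_⟩
      rw [← e2, eq_div_iff (by linarith)]
      have : (n : ℝ) * a = 1 := by linarith
      linear_combination (((n : ℝ) * a) + 1) * this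
  · rintro ⟨k, hk, rfl⟩
    have hk0 : (1 : ℝ) ≤ k := by exact_mod_cast hk
    -- The point 1/k is taken as the right end of piece k + 1, with k cliques of mass 1/k and an
    -- empty one; this also covers k = 1, where piece k does not exist.
    have := cliqueBound_param (n := k + 1) (by omega) (a := 1 / (k : ℝ)) (b := 0) le_rfl
      (by positivity) (by push_cast; field_simp; ring)
    push_cast at this
    rw [show ((k : ℝ) + 1 - 1) * (1 / (k : ℝ)) ^ 2 + 0 ^ 2 = 1 / k by field_simp; ring] at this
    rw [this]
    field_simp
    ring

theorem cliqueBound_one : cliqueBound 1 = 1 := by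
  have := (cliqueBound_eq_sq_iff one_pos le_rfl).2 ⟨1, le_rfl, by norm_num⟩
  simpa using this

theorem continuousOn_cliqueBound_Icc (m : ℕ) :
    ContinuousOn cliqueBound (Set.Icc (1 / ((m : ℝ) + 1)) 1) := by
  induction m with
  | zero => simp
  | succ m ih =>
    have hm : (0 : ℝ) < (m : ℝ) + 1 := by positivity
    have hm' : (0 : ℝ) < (m : ℝ) + 2 := by positivity
    have e : Set.Icc (1 / (((m + 1 : ℕ) : ℝ) + 1)) 1 =
        Set.Icc (1 / ((m : ℝ) + 2)) (1 / ((m : ℝ) + 1)) ∪ Set.Icc (1 / ((m : ℝ) + 1)) 1 := by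
      rw [Set.Icc_union_Icc_eq_Icc]
      · push_cast; norm_num [add_assoc]
      · gcongr; norm_num
      · rw [div_le_one hm]; linarith [(Nat.cast_nonneg m : (0 : ℝ) ≤ m)]
    rw [e]
    refine ContinuousOn.union_of_isClosed ?_ ih isClosed_Icc isClosed_Icc
    have hc : ContinuousOn (fun d : ℝ => -2 / ((m + 2 : ℕ) : ℝ) ^ 2 + 3 * d / (m + 2 : ℕ) -
      (((m + 2 : ℕ) : ℝ) - 2) * (((m + 2 : ℕ) : ℝ) - 1) / ((m + 2 : ℕ) : ℝ) ^ 2 *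
      √(((m + 2 : ℕ) * d - 1) / (((m + 2 : ℕ) : ℝ) - 1)) ^ 3)
        (Set.Icc (1 / ((m : ℝ) + 2)) (1 / ((m : ℝ) + 1))) := by
      apply Continuous.continuousOn
      fun_prop
    refine hc.congr fun d hd => cliqueBound_eq (by omega) ?_ ?_
    · have := hd.1
      rw [div_le_iff₀ hm'] at this
      push_cast; linarith
    · have := hd.2
      rw [le_div_iff₀ hm] at this
      push_cast; linarith

/-- Away from 0 finitely many pieces are glued. At 0 infinitely many pieces accumulate, and
continuity follows from d² ≤ `cliqueBound` d ≤ d. -/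
theorem continuousOn_cliqueBound : ContinuousOn cliqueBound (Set.Icc 0 1) := by
  intro d hd
  rcases hd.1.eq_or_lt with rfl | h0
  · have h : Filter.Tendsto cliqueBound (nhdsWithin 0 (Set.Icc 0 1)) (nhds 0) := by
      refine tendsto_of_tendsto_of_tendsto_of_le_of_le' (g := fun _ => (0 : ℝ)) (h := id)
        tendsto_const_nhds (Filter.tendsto_id.mono_left nhdsWithin_le_nhds) ?_ ?_
      · filter_upwards [self_mem_nhdsWithin] with t ht
        exact (sq_nonneg t).trans (sq_le_cliqueBound ht.1 ht.2)
      · filter_upwards [self_mem_nhdsWithin] with t ht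
        exact cliqueBound_le_self ht.1 ht.2
    rw [ContinuousWithinAt, cliqueBound_zero]
    exact h
  · obtain ⟨m, hm⟩ := exists_nat_one_div_lt h0
    have := continuousOn_cliqueBound_Icc m d ⟨hm.le, hd.2⟩
    refine this.mono_of_mem_nhdsWithin ?_
    rw [mem_nhdsWithin]
    exact ⟨Set.Ioi (1 / ((m : ℝ) + 1)), isOpen_Ioi, hm, fun x hx => ⟨hx.1.le, hx.2.2⟩⟩

/-! ### Finite weighted graphs: densities and their first variations. -/

/-- Probability that at least two of three independent events occur. -/
def maj3 (x y z : ℝ) : ℝ := x * y + y * z + z * x - 2 * x * y * z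

section FiniteGraphon

variable {V : Type*} [Fintype V]

/-- Weighted triple sum. -/
def tripleSum (w : V → ℝ) (φ : V → V → V → ℝ) : ℝ :=
  ∑ i, ∑ j, ∑ k, w i * w j * w k * φ i j k

/-- Edge density. -/
def edgeDens (w : V → ℝ) (W : V → V → ℝ) : ℝ := ∑ i, ∑ j, w i * w j * W i j

/-- Density of triples spanning at least two edges. -/
def majDens (w : V → ℝ) (W : V → V → ℝ) : ℝ :=
  tripleSum w fun i j k => maj3 (W i j) (W j k) (W i k)

/-- Degree of a vertex. -/
def wdeg (w : V → ℝ) (W : V → V → ℝ) (i : V) : ℝ := ∑ j, w j * W i j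

/-- Density of the triples through a given vertex spanning at least two edges. -/
def rootMaj (w : V → ℝ) (W : V → V → ℝ) (i : V) : ℝ :=
  ∑ j, ∑ k, w j * w k * maj3 (W i j) (W j k) (W i k)

theorem tripleSum_swap_left (w : V → ℝ) (φ : V → V → V → ℝ) :
    tripleSum w (fun i j k => φ j i k) = tripleSum w φ := by
  unfold tripleSum
  rw [Finset.sum_comm]
  refine Finset.sum_congr rfl fun i _ => Finset.sum_congr rfl fun j _ =>
    Finset.sum_congr rfl fun k _ => by ring

theorem tripleSum_swap_right (w : V → ℝ) (φ : V → V → V → ℝ) :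
    tripleSum w (fun i j k => φ i k j) = tripleSum w φ := by
  unfold tripleSum
  refine Finset.sum_congr rfl fun i _ => ?_
  rw [Finset.sum_comm]
  refine Finset.sum_congr rfl fun j _ => Finset.sum_congr rfl fun k _ => by ring

theorem tripleSum_swap_outer (w : V → ℝ) (φ : V → V → V → ℝ) :
    tripleSum w (fun i j k => φ k j i) = tripleSum w φ := by
  rw [← tripleSum_swap_left w φ, ← tripleSum_swap_right w (fun i j k => φ j i k),
    ← tripleSum_swap_left w]

theorem tripleSum_add (w : V → ℝ) (φ ψ : V → V → V → ℝ) :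
    tripleSum w (fun i j k => φ i j k + ψ i j k) = tripleSum w φ + tripleSum w ψ := by
  simp only [tripleSum, mul_add, Finset.sum_add_distrib]

theorem tripleSum_smul (w : V → ℝ) (c : ℝ) (φ : V → V → V → ℝ) :
    tripleSum w (fun i j k => c * φ i j k) = c * tripleSum w φ := by
  simp only [tripleSum, Finset.mul_sum]
  refine Finset.sum_congr rfl fun i _ => Finset.sum_congr rfl fun j _ =>
    Finset.sum_congr rfl fun k _ => by ring

theorem tripleSum_sub (w : V → ℝ) (φ ψ : V → V → V → ℝ) :
    tripleSum w (fun i j k => φ i j k - ψ i j k) = tripleSum w φ - tripleSum w ψ := by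
  simp only [tripleSum, mul_sub, Finset.sum_sub_distrib]

theorem tripleSum_nonneg {w : V → ℝ} (hw : ∀ i, 0 ≤ w i) {φ : V → V → V → ℝ}
    (hφ : ∀ i j k, 0 ≤ φ i j k) : 0 ≤ tripleSum w φ :=
  Finset.sum_nonneg fun i _ => Finset.sum_nonneg fun j _ => Finset.sum_nonneg fun k _ =>
    mul_nonneg (mul_nonneg (mul_nonneg (hw i) (hw j)) (hw k)) (hφ i j k)

theorem tripleSum_eq_root (w : V → ℝ) (φ : V → V → V → ℝ) :
    tripleSum w φ = ∑ i, w i * ∑ j, ∑ k, w j * w k * φ i j k := by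
  simp only [tripleSum, Finset.mul_sum]
  refine Finset.sum_congr rfl fun i _ => Finset.sum_congr rfl fun j _ =>
    Finset.sum_congr rfl fun k _ => by ring

theorem tripleSum_mul_pair (w : V → ℝ) (f : V → ℝ) (g : V → V → ℝ) :
    tripleSum w (fun i j k => f i * g j k) = (∑ i, w i * f i) * ∑ j, ∑ k, w j * w k * g j k := by
  rw [tripleSum_eq_root, Finset.sum_mul]
  refine Finset.sum_congr rfl fun i _ => ?_
  simp only [Finset.mul_sum]
  refine Finset.sum_congr rfl fun j _ => Finset.sum_congr rfl fun k _ => by ring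

theorem majDens_eq_root (w : V → ℝ) (W : V → V → ℝ) :
    majDens w W = ∑ i, w i * rootMaj w W i := tripleSum_eq_root _ _

theorem edgeDens_eq_wdeg (w : V → ℝ) (W : V → V → ℝ) :
    edgeDens w W = ∑ i, w i * wdeg w W i := by
  simp only [edgeDens, wdeg, Finset.mul_sum, mul_assoc]

/-- Vertex weights and edge weights of a finite weighted graph with total mass one. -/
structure IsGraphon (w : V → ℝ) (W : V → V → ℝ) : Prop where
  nonneg : ∀ i, 0 ≤ w i
  sum_one : ∑ i, w i = 1
  symm : ∀ i j, W i j = W j i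
  W_nonneg : ∀ i j, 0 ≤ W i j
  W_le_one : ∀ i j, W i j ≤ 1

theorem tripleSum_of_pair {w : V → ℝ} (hw : ∑ i, w i = 1) (g : V → V → ℝ) :
    tripleSum w (fun _ j k => g j k) = ∑ j, ∑ k, w j * w k * g j k := by
  have := tripleSum_mul_pair w (fun _ => 1) g
  simpa [hw] using this

variable {w : V → ℝ} {W : V → V → ℝ}

theorem IsGraphon.edgeDens_nonneg (h : IsGraphon w W) : 0 ≤ edgeDens w W :=
  Finset.sum_nonneg fun i _ => Finset.sum_nonneg fun j _ =>
    mul_nonneg (mul_nonneg (h.nonneg i) (h.nonneg j)) (h.W_nonneg i j)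

theorem IsGraphon.edgeDens_le_one (h : IsGraphon w W) : edgeDens w W ≤ 1 := by
  calc edgeDens w W ≤ ∑ i, ∑ j, w i * w j := Finset.sum_le_sum fun i _ =>
        Finset.sum_le_sum fun j _ =>
          mul_le_of_le_one_right (mul_nonneg (h.nonneg i) (h.nonneg j)) (h.W_le_one i j)
    _ = 1 := by rw [← Finset.sum_mul_sum, h.sum_one, one_mul]

/-- Two edges at the root already make a triple good, so F is at least the mean squared degree,
which is at least d². This settles the densities 1/k, where two pieces of the curve meet. -/
theorem IsGraphon.sq_edgeDens_le (h : IsGraphon w W) : edgeDens w W ^ 2 ≤ majDens w W := by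
  have h1 : ∑ i, w i * wdeg w W i ^ 2 ≤ majDens w W := by
    have e : ∑ i, w i * wdeg w W i ^ 2 = tripleSum w (fun i j k => W i j * W i k) := by
      rw [tripleSum_eq_root]
      refine Finset.sum_congr rfl fun i _ => ?_
      rw [sq, wdeg, Finset.sum_mul_sum]
      congr 1
      refine Finset.sum_congr rfl fun j _ => Finset.sum_congr rfl fun k _ => by ring
    rw [e, ← sub_nonneg, majDens, ← tripleSum_sub]
    refine tripleSum_nonneg h.nonneg fun i j k => ?_
    have e : maj3 (W i j) (W j k) (W i k) - W i j * W i k =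
      W j k * (W i j * (1 - W i k) + W i k * (1 - W i j)) := by unfold maj3; ring
    rw [e]
    have := h.W_nonneg i j
    have := h.W_nonneg j k
    have := h.W_nonneg i k
    have := sub_nonneg.2 (h.W_le_one i j)
    have := sub_nonneg.2 (h.W_le_one i k)
    positivity
  have h2 : 0 ≤ ∑ i, w i * (wdeg w W i - edgeDens w W) ^ 2 :=
    Finset.sum_nonneg fun i _ => mul_nonneg (h.nonneg i) (sq_nonneg _)
  have e2 : ∑ i, w i * (wdeg w W i - edgeDens w W) ^ 2 =
      ∑ i, w i * wdeg w W i ^ 2 - 2 * edgeDens w W * ∑ i, w i * wdeg w W i +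
        edgeDens w W ^ 2 * ∑ i, w i := by
    simp only [Finset.mul_sum, ← Finset.sum_sub_distrib, ← Finset.sum_add_distrib]
    refine Finset.sum_congr rfl fun i _ => by ring
  rw [e2, h.sum_one, ← edgeDens_eq_wdeg] at h2
  nlinarith

/-- For a triple with e = 0, 1, 2, 3 edges the integrand 2·maj - e + 1 equals 1, 0, 1, 0; fractional
weights average over these cases. The line (3d-1)/2 is the piece n = 2 of the curve. -/
theorem IsGraphon.linear_le (h : IsGraphon w W) : (3 * edgeDens w W - 1) / 2 ≤ majDens w W := by
  have e1 : tripleSum w (fun _ j k => W j k) = edgeDens w W := tripleSum_of_pair h.sum_one W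
  have e2 : tripleSum w (fun i _ k => W i k) = edgeDens w W := by
    rw [← e1, ← tripleSum_swap_left]
  have e3 : tripleSum w (fun i j _ => W i j) = edgeDens w W := by
    rw [← e2, ← tripleSum_swap_right]
  have e0 : tripleSum w (fun _ _ _ => (1 : ℝ)) = 1 := by
    have := tripleSum_of_pair h.sum_one (fun _ _ => 1)
    simp only [mul_one] at this
    rw [← Finset.sum_mul_sum, h.sum_one, one_mul] at this
    exact this
  have key : 0 ≤ tripleSum w (fun i j k => 2 * maj3 (W i j) (W j k) (W i k) -
      (W i j + W j k + W i k) + 1) := by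
    refine tripleSum_nonneg h.nonneg fun i j k => ?_
    have e : 2 * maj3 (W i j) (W j k) (W i k) - (W i j + W j k + W i k) + 1 =
      (1 - W i j) * (1 - W j k) * (1 - W i k) + W i j * W j k * (1 - W i k) +
        W j k * W i k * (1 - W i j) + W i k * W i j * (1 - W j k) := by unfold maj3; ring
    rw [e]
    have := h.W_nonneg i j
    have := h.W_nonneg j k
    have := h.W_nonneg i k
    have := sub_nonneg.2 (h.W_le_one i j)
    have := sub_nonneg.2 (h.W_le_one j k)
    have := sub_nonneg.2 (h.W_le_one i k)
    positivity
  rw [tripleSum_add, tripleSum_sub, tripleSum_add, tripleSum_add, tripleSum_smul, e0, e1, e2,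
    e3] at key
  unfold majDens
  linarith

theorem edgeDens_smul (c : ℝ) (w : V → ℝ) (W : V → V → ℝ) :
    edgeDens (fun i => c * w i) W = c ^ 2 * edgeDens w W := by
  simp only [edgeDens, Finset.mul_sum]
  refine Finset.sum_congr rfl fun i _ => Finset.sum_congr rfl fun j _ => by ring

theorem majDens_smul (c : ℝ) (w : V → ℝ) (W : V → V → ℝ) :
    majDens (fun i => c * w i) W = c ^ 3 * majDens w W := by
  simp only [majDens, tripleSum, Finset.mul_sum]
  refine Finset.sum_congr rfl fun i _ => Finset.sum_congr rfl fun j _ =>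
    Finset.sum_congr rfl fun k _ => by ring

theorem hasDerivAt_edgeDens_weight (hW : ∀ i j, W i j = W j i) (p : V → ℝ) :
    HasDerivAt (fun t : ℝ => edgeDens (fun i => w i + t * p i) W)
      (2 * ∑ i, p i * wdeg w W i) 0 := by
  have hl : ∀ i, HasDerivAt (fun t : ℝ => w i + t * p i) (p i) 0 := fun i => by
    simpa using ((hasDerivAt_id (0 : ℝ)).mul_const (p i)).const_add (w i)
  have := HasDerivAt.fun_sum (u := Finset.univ) fun i (_ : i ∈ Finset.univ) =>
    HasDerivAt.fun_sum (u := Finset.univ) fun j (_ : j ∈ Finset.univ) =>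
      (((hl i).mul (hl j)).mul_const (W i j))
  refine this.congr_deriv ?_
  simp only [zero_mul, add_zero]
  have e : ∑ i, ∑ j, w i * p j * W i j = ∑ i, ∑ j, p i * w j * W i j := by
    rw [Finset.sum_comm]
    refine Finset.sum_congr rfl fun i _ => Finset.sum_congr rfl fun j _ => ?_
    rw [hW]; ring
  simp only [add_mul, Finset.sum_add_distrib, e, wdeg, Finset.mul_sum, ← mul_assoc]
  simp only [mul_assoc, ← Finset.mul_sum]
  ring

theorem maj3_swap_left (x y z : ℝ) : maj3 x y z = maj3 x z y := by unfold maj3; ring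
theorem maj3_swap_right (x y z : ℝ) : maj3 x y z = maj3 z y x := by unfold maj3; ring

theorem hasDerivAt_majDens_weight (hW : ∀ i j, W i j = W j i) (p : V → ℝ) :
    HasDerivAt (fun t : ℝ => majDens (fun i => w i + t * p i) W)
      (3 * ∑ i, p i * rootMaj w W i) 0 := by
  have hl : ∀ i, HasDerivAt (fun t : ℝ => w i + t * p i) (p i) 0 := fun i => by
    simpa using ((hasDerivAt_id (0 : ℝ)).mul_const (p i)).const_add (w i)
  have := HasDerivAt.fun_sum (u := Finset.univ) fun i (_ : i ∈ Finset.univ) =>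
    HasDerivAt.fun_sum (u := Finset.univ) fun j (_ : j ∈ Finset.univ) =>
    HasDerivAt.fun_sum (u := Finset.univ) fun k (_ : k ∈ Finset.univ) =>
      ((((hl i).mul (hl j)).mul (hl k)).mul_const (maj3 (W i j) (W j k) (W i k)))
  refine this.congr_deriv ?_
  simp only [zero_mul, add_zero, Pi.mul_apply]
  have e0 : ∑ i, p i * rootMaj w W i =
      ∑ i, ∑ j, ∑ k, p i * w j * w k * maj3 (W i j) (W j k) (W i k) := by
    simp only [rootMaj, Finset.mul_sum, ← mul_assoc]
  have e1 : ∑ i, ∑ j, ∑ k, w i * p j * w k * maj3 (W i j) (W j k) (W i k) =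
      ∑ i, p i * rootMaj w W i := by
    rw [e0, Finset.sum_comm]
    refine Finset.sum_congr rfl fun i _ => Finset.sum_congr rfl fun j _ =>
      Finset.sum_congr rfl fun k _ => ?_
    rw [hW j i, maj3_swap_left]; ring
  have e2 : ∑ i, ∑ j, ∑ k, w i * w j * p k * maj3 (W i j) (W j k) (W i k) =
      ∑ i, p i * rootMaj w W i := by
    rw [← e1]
    refine Finset.sum_congr rfl fun i _ => ?_
    rw [Finset.sum_comm]
    refine Finset.sum_congr rfl fun j _ => Finset.sum_congr rfl fun k _ => ?_
    rw [hW k j, maj3_swap_right]; ring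
  simp only [add_mul, Finset.sum_add_distrib, e1, e2, ← e0]
  ring

theorem hasDerivAt_edgeDens_edge (H : V → V → ℝ) :
    HasDerivAt (fun t : ℝ => edgeDens w (fun i j => W i j + t * H i j)) (edgeDens w H) 0 := by
  have hl : ∀ i j, HasDerivAt (fun t : ℝ => W i j + t * H i j) (H i j) 0 := fun i j => by
    simpa using ((hasDerivAt_id (0 : ℝ)).mul_const (H i j)).const_add (W i j)
  exact HasDerivAt.fun_sum fun i _ => HasDerivAt.fun_sum fun j _ => (hl i j).const_mul (w i * w j)

/-- The factor W i k + W j k - 2 W i k W j k is the probability that exactly one of the other two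
pairs is an edge, that is, that the pair ij decides the majority. The three pairs contribute
equally, whence the 3. -/
theorem hasDerivAt_majDens_edge (hW : ∀ i j, W i j = W j i) (H : V → V → ℝ) :
    HasDerivAt (fun t : ℝ => majDens w (fun i j => W i j + t * H i j))
      (3 * tripleSum w fun i j k => H i j * (W i k + W j k - 2 * (W i k * W j k))) 0 := by
  have hl : ∀ i j, HasDerivAt (fun t : ℝ => W i j + t * H i j) (H i j) 0 := fun i j => by
    simpa using ((hasDerivAt_id (0 : ℝ)).mul_const (H i j)).const_add (W i j)
  have hm : ∀ i j k, HasDerivAt (fun t : ℝ => maj3 (W i j + t * H i j) (W j k + t * H j k)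
      (W i k + t * H i k)) (H i j * (W i k + W j k - 2 * (W i k * W j k)) +
        H j k * (W i k + W i j - 2 * (W i k * W i j)) +
        H i k * (W i j + W j k - 2 * (W i j * W j k))) 0 := by
    intro i j k
    have := ((((hl i j).mul (hl j k)).add ((hl j k).mul (hl i k))).add
      ((hl i k).mul (hl i j))).sub ((((hl i j).const_mul 2).mul (hl j k)).mul (hl i k))
    refine this.congr_deriv ?_
    simp only [zero_mul, add_zero, Pi.mul_apply]
    ring
  have := HasDerivAt.fun_sum (u := Finset.univ) fun i (_ : i ∈ Finset.univ) =>
    HasDerivAt.fun_sum (u := Finset.univ) fun j (_ : j ∈ Finset.univ) =>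
    HasDerivAt.fun_sum (u := Finset.univ) fun k (_ : k ∈ Finset.univ) =>
      (hm i j k).const_mul (w i * w j * w k)
  refine this.congr_deriv ?_
  change tripleSum w _ = _
  rw [tripleSum_add, tripleSum_add]
  have e1 : tripleSum w (fun i j k => H i k * (W i j + W j k - 2 * (W i j * W j k))) =
      tripleSum w fun i j k => H i j * (W i k + W j k - 2 * (W i k * W j k)) := by
    rw [← tripleSum_swap_right]
    simp only [hW]
  have e2 : tripleSum w (fun i j k => H j k * (W i k + W i j - 2 * (W i k * W i j))) =
      tripleSum w fun i j k => H i j * (W i k + W j k - 2 * (W i k * W j k)) := by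
    rw [← e1, ← tripleSum_swap_left]
    congr! 4 with i j k
    rw [hW j i]; ring
  rw [e1, e2]
  ring

end FiniteGraphon

/-! ### Clique comparison and deletion of a neighbourhood. -/

theorem nonneg_of_hasDerivAt_of_le {ψ : ℝ → ℝ} {c : ℝ} (h : HasDerivAt ψ c 0)
    (hmin : ∀ t ∈ Set.Icc (0 : ℝ) 1, ψ 0 ≤ ψ t) : 0 ≤ c := by
  rw [hasDerivAt_iff_tendsto_slope_zero] at h
  have h' := h.mono_left (nhdsWithin_mono (s := Set.Ioi 0) (t := {0}ᶜ) 0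
    fun x hx => ne_of_gt hx)
  refine ge_of_tendsto h' ?_
  filter_upwards [Ioo_mem_nhdsGT (zero_lt_one (α := ℝ))] with t ht
  have := hmin t ⟨ht.1.le, ht.2.le⟩
  simp only [zero_add, smul_eq_mul]
  exact mul_nonneg (inv_nonneg.2 ht.1.le) (by linarith)

/-- Replacing one of the `k + 1` cliques of size `a` by a part of size `D`, and the others by `k`
parts of size `α` and one of size `β`, stays above the tangent of `cliqueBound`. -/
theorem clique_replacement {k a b α β D E C η d R : ℝ} (hk : 1 ≤ k) (hba : b < a)
    (hd : d = (k + 1) * a ^ 2 + b ^ 2) (h1 : (k + 1) * a + b = 1)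
    (hE : 2 * E = (a + b) * D - a * b - η - D ^ 2) (hC : 0 ≤ C) (hCE : C ≤ E) (hη : 0 < η)
    (hm : k * α + β = 1 - D) (hR : k * α ^ 2 + β ^ 2 = R) (hRd : R = d - D ^ 2 + C - 2 * E)
    (hβα : β ≤ α) :
    (k + 1) * a ^ 3 + b ^ 3 - 3 / 2 * (a + b) * d ≤
      k * α ^ 3 + β ^ 3 + D ^ 3 - 3 / 2 * (a + b) * (R + D ^ 2) := by
  -- In terms of the displacements x, y, e of the clique sizes and the gap h = a - b, mass
  -- conservation becomes k x + y = e, and the relation for E becomes e(h - e) = 2E + η. Hence 0 < e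
  -- < h.
  obtain ⟨x, rfl⟩ : ∃ x, α = a + x := ⟨α - a, by ring⟩
  obtain ⟨y, rfl⟩ : ∃ y, β = b + y := ⟨β - b, by ring⟩
  obtain ⟨e, rfl⟩ : ∃ e, D = a - e := ⟨a - D, by ring⟩
  obtain ⟨h, rfl⟩ : ∃ h, a = b + h := ⟨a - b, by ring⟩
  have hh : 0 < h := by linarith
  have hxy : k * x + y = e := by linarith
  have hee : e * (h - e) = 2 * E + η := by linear_combination -hE
  have hpos : 0 < e * (h - e) := by linarith
  have he0 : 0 < e := by
    by_contra hc
    have hc' : e ≤ 0 := not_lt.1 hc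
    nlinarith
  have heh : e < h := by
    by_contra hc
    have hc' : h ≤ e := not_lt.1 hc
    nlinarith
  -- The density constraint in displacements. As C ≤ E, its right side is nonnegative, so y ≥ 0.
  have hq : 2 * h * y = e ^ 2 + k * x ^ 2 + y ^ 2 + (2 * E - C) := by
    rw [hd] at hRd
    rw [← hR] at hRd
    linear_combination -hRd + 2 * (b + h) * hxy
  have hy0 : 0 ≤ y := by
    have : 0 ≤ 2 * h * y := by
      rw [hq]
      have : 0 ≤ k * x ^ 2 := by positivity
      nlinarith [sq_nonneg e, sq_nonneg y]
    by_contra hc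
    nlinarith
  -- If y > e then x < 0, while β ≤ α gives y - x ≤ h; inserted in the density constraint this
  -- forces h < e.
  have hye : y ≤ e := by
    by_contra hc
    have hc : e < y := not_le.1 hc
    have hx : k * x = -(y - e) := by linarith
    have hx0 : x < 0 := by
      by_contra h0
      have : 0 ≤ k * x := mul_nonneg (by linarith) (not_lt.1 h0)
      linarith
    have hkx : k * x ^ 2 = -(x * (y - e)) := by linear_combination x * hx
    have hb : y - e - x ≤ h - e := by linarith
    have h2 : (y - e) * (y - e - x) ≤ (y - e) * (h - e) :=
      mul_le_mul_of_nonneg_left hb (by linarith)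
    have h3 : 0 < (y - e) * (h - e) := mul_pos (by linarith) (by linarith)
    nlinarith
  have hx0 : 0 ≤ x := by
    have : 0 ≤ k * x := by linarith
    by_contra h0
    nlinarith
  -- The function t²(3h - 2t) has derivative 6t(h - t), hence increases on [0, h], which contains y
  -- ≤ e.
  have hmono : y ^ 2 * (3 * h - 2 * y) ≤ e ^ 2 * (3 * h - 2 * e) := by
    have i1 : 0 ≤ e * (h - e) := hpos.le
    have i2 : 0 ≤ y * (h - y) := mul_nonneg hy0 (by linarith)
    have i3 : 0 ≤ e * (h - y) := mul_nonneg he0.le (by linarith)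
    have i4 : 0 ≤ y * (h - e) := mul_nonneg hy0 (by linarith)
    have : 0 ≤ (e - y) * (3 * h * (e + y) - 2 * (e ^ 2 + e * y + y ^ 2)) :=
      mul_nonneg (by linarith) (by nlinarith)
    linarith
  have hx3 : 0 ≤ k * x ^ 2 * (3 * h + 2 * x) := by positivity
  -- The deviation from the tangent is half the sum of this function at e and a nonnegative term in
  -- x, minus its value at y.
  have key : k * (b + h + x) ^ 3 + (b + y) ^ 3 + (b + h - e) ^ 3 -
        3 / 2 * (b + h + b) * (R + (b + h - e) ^ 2) -
      ((k + 1) * (b + h) ^ 3 + b ^ 3 - 3 / 2 * (b + h + b) * d) =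
      1 / 2 * (e ^ 2 * (3 * h - 2 * e) + k * x ^ 2 * (3 * h + 2 * x) - y ^ 2 * (3 * h - 2 * y)) := by
    rw [hd, ← hR]
    linear_combination (-3) * (b + h) * b * hxy
  linarith

section FiniteGraphon

variable {V : Type*} [Fintype V] {w : V → ℝ} {W : V → V → ℝ}

/-- Density of non-adjacent pairs of neighbours of `v`. -/
def openCherry (w : V → ℝ) (W : V → V → ℝ) (v : V) : ℝ :=
  ∑ i, ∑ j, w i * w j * (W v i * W v j * (1 - W i j))

/-- Density of induced paths of length two starting at `v`. -/
def openPath (w : V → ℝ) (W : V → V → ℝ) (v : V) : ℝ :=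
  ∑ i, ∑ j, w i * w j * (W v i * (1 - W v j) * W i j)

theorem wdeg_sq (w : V → ℝ) (W : V → V → ℝ) (v : V) :
    wdeg w W v ^ 2 = ∑ i, ∑ j, w i * w j * (W v i * W v j) := by
  rw [sq, wdeg, Finset.sum_mul_sum]
  refine Finset.sum_congr rfl fun j _ => Finset.sum_congr rfl fun k _ => by ring

theorem openPath_symm (hW : ∀ i j, W i j = W j i) (v : V) :
    ∑ i, ∑ j, w i * w j * (W v j * (1 - W v i) * W i j) = openPath w W v := by
  rw [openPath, Finset.sum_comm]
  refine Finset.sum_congr rfl fun j _ => Finset.sum_congr rfl fun k _ => ?_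
  rw [hW k j]; ring

/-- A triple through v is good when both edges at v are present, or when exactly one of them is
present together with the opposite edge. -/
theorem rootMaj_eq (hW : ∀ i j, W i j = W j i) (v : V) :
    rootMaj w W v = wdeg w W v ^ 2 + 2 * openPath w W v := by
  rw [two_mul]
  nth_rw 2 [← openPath_symm hW]
  rw [wdeg_sq, openPath, rootMaj]
  simp only [← Finset.sum_add_distrib]
  refine Finset.sum_congr rfl fun j _ => Finset.sum_congr rfl fun k _ => ?_
  unfold maj3; ring

theorem sum_nbhd_wdeg (w : V → ℝ) (W : V → V → ℝ) (v : V) :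
    ∑ i, w i * W v i * wdeg w W i = wdeg w W v ^ 2 - openCherry w W v + openPath w W v := by
  rw [wdeg_sq, openPath, openCherry]
  simp only [wdeg, Finset.mul_sum, ← Finset.sum_add_distrib, ← Finset.sum_sub_distrib]
  refine Finset.sum_congr rfl fun j _ => Finset.sum_congr rfl fun k _ => by ring

/-- Edge density of the non-neighbours of `v`. -/
theorem edgeDens_link (hW : ∀ i j, W i j = W j i) (v : V) :
    edgeDens (fun i => w i * (1 - W v i)) W =
      edgeDens w W - wdeg w W v ^ 2 + openCherry w W v - 2 * openPath w W v := by
  rw [two_mul]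
  nth_rw 2 [← openPath_symm hW]
  rw [wdeg_sq, openPath, openCherry, edgeDens, edgeDens]
  simp only [← Finset.sum_add_distrib, ← Finset.sum_sub_distrib]
  refine Finset.sum_congr rfl fun j _ => Finset.sum_congr rfl fun k _ => by ring

/-- Both sides count induced paths of length two, rooted at the midpoint on the left and at an
endpoint on the right. -/
theorem sum_openCherry_eq (hW : ∀ i j, W i j = W j i) :
    ∑ v, w v * openCherry w W v = ∑ v, w v * openPath w W v := by
  unfold openCherry openPath
  rw [← tripleSum_eq_root w (fun v i j => W v i * W v j * (1 - W i j)),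
    ← tripleSum_eq_root w (fun v i j => W v i * (1 - W v j) * W i j), ← tripleSum_swap_left]
  congr! 4 with i j k
  rw [hW j i]; ring

/-- Upper bound for the number of triples with at least two edges among the non-neighbours. -/
theorem IsGraphon.majDens_link_le (h : IsGraphon w W) (v : V) :
    majDens (fun i => w i * (1 - W v i)) W ≤ majDens w W -
      3 * ∑ i, w i * W v i * rootMaj w W i + 2 * wdeg w W v ^ 3 +
      6 * (wdeg w W v * openPath w W v) - 3 * tripleSum w (fun i j k =>
        W v i * W v j * (1 - W i j) * (W i k + W j k - 2 * (W i k * W j k))) := by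
  have hW := h.symm
  set N := W v with hN
  set P : V → V → V → ℝ := fun i j k => maj3 (W i j) (W j k) (W i k) with hP
  have eL : majDens (fun i => w i * (1 - N i)) W =
      tripleSum w (fun i j k => (1 - N i) * (1 - N j) * (1 - N k) * P i j k) := by
    unfold majDens tripleSum
    refine Finset.sum_congr rfl fun i _ => Finset.sum_congr rfl fun j _ =>
      Finset.sum_congr rfl fun k _ => by ring
  have eQ1 : ∑ i, w i * N i * rootMaj w W i = tripleSum w (fun i j k => N i * P i j k) := by
    rw [tripleSum_eq_root]
    refine Finset.sum_congr rfl fun i _ => ?_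
    simp only [rootMaj, hP, Finset.mul_sum]
    refine Finset.sum_congr rfl fun j _ => Finset.sum_congr rfl fun k _ => by ring
  have eQ2 : tripleSum w (fun i j k => N j * P i j k) = tripleSum w (fun i j k => N i * P i j k) := by
    rw [← tripleSum_swap_left]
    congr! 4 with i j k
    simp only [hP]; rw [hW j i, maj3_swap_left]
  have eQ3 : tripleSum w (fun i j k => N k * P i j k) = tripleSum w (fun i j k => N i * P i j k) := by
    rw [← tripleSum_swap_outer]
    congr! 4 with i j k
    simp only [hP]; rw [hW k j, hW j i, hW k i]; unfold maj3; ring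
  have eD : wdeg w W v ^ 3 = tripleSum w (fun i j k => N i * N j * N k) := by
    have := tripleSum_mul_pair w N (fun j k => N j * N k)
    rw [← wdeg_sq w W v] at this
    simp only [← mul_assoc] at this
    rw [this]
    unfold wdeg
    ring
  have eE1 : wdeg w W v * openPath w W v =
      tripleSum w (fun i j k => N i * (N j * (1 - N k) * W j k)) :=
    (tripleSum_mul_pair w N (fun j k => N j * (1 - N k) * W j k)).symm
  have eE2 : tripleSum w (fun i j k => N j * (N i * (1 - N k) * W i k)) =
      tripleSum w (fun i j k => N i * (N j * (1 - N k) * W j k)) := by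
    rw [← tripleSum_swap_left]
  have eE3 : tripleSum w (fun i j k => N i * (N k * (1 - N j) * W j k)) =
      tripleSum w (fun i j k => N i * (N j * (1 - N k) * W j k)) := by
    rw [← tripleSum_swap_right]
    congr! 4 with i j k
    rw [hW k j]
  have eE4 : tripleSum w (fun i j k => N j * (N k * (1 - N i) * W i k)) =
      tripleSum w (fun i j k => N i * (N j * (1 - N k) * W j k)) := by
    rw [← eE3, ← tripleSum_swap_left]
  have eE5 : tripleSum w (fun i j k => N k * (N i * (1 - N j) * W i j)) =
      tripleSum w (fun i j k => N i * (N j * (1 - N k) * W j k)) := by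
    rw [← eE2, ← tripleSum_swap_right]
  have eE6 : tripleSum w (fun i j k => N k * (N j * (1 - N i) * W i j)) =
      tripleSum w (fun i j k => N i * (N j * (1 - N k) * W j k)) := by
    rw [← eE4, ← tripleSum_swap_right]
  have eG2 : tripleSum w (fun i j k => N i * N k * (1 - W i k) *
        (W i j + W j k - 2 * (W i j * W j k))) = tripleSum w (fun i j k =>
        N i * N j * (1 - W i j) * (W i k + W j k - 2 * (W i k * W j k))) := by
    rw [← tripleSum_swap_right]
    congr! 4 with i j k
    rw [hW k j]
  have eG3 : tripleSum w (fun i j k => N j * N k * (1 - W j k) *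
        (W i j + W i k - 2 * (W i j * W i k))) = tripleSum w (fun i j k =>
        N i * N j * (1 - W i j) * (W i k + W j k - 2 * (W i k * W j k))) := by
    rw [← eG2, ← tripleSum_swap_left]
    congr! 4 with i j k
    rw [hW j i]
  -- These are the terms lost by the bound, sorted by the number of neighbours of v in the triple:
  -- with two neighbours, the case where the third vertex is adjacent to both; with three, twice the
  -- edgeless triples. None or one neighbour loses nothing.
  have key : 0 ≤ tripleSum w (fun i j k => N i * N j * (1 - N k) * (W i k * W j k) +
      N i * N k * (1 - N j) * (W i j * W j k) + N j * N k * (1 - N i) * (W i j * W i k) +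
      2 * (N i * N j * N k * ((1 - W i j) * (1 - W j k) * (1 - W i k)))) := by
    refine tripleSum_nonneg h.nonneg fun i j k => ?_
    have := h.W_nonneg i j
    have := h.W_nonneg j k
    have := h.W_nonneg i k
    have := sub_nonneg.2 (h.W_le_one i j)
    have := sub_nonneg.2 (h.W_le_one j k)
    have := sub_nonneg.2 (h.W_le_one i k)
    have := h.W_nonneg v i
    have := h.W_nonneg v j
    have := h.W_nonneg v k
    have := sub_nonneg.2 (h.W_le_one v i)
    have := sub_nonneg.2 (h.W_le_one v j)
    have := sub_nonneg.2 (h.W_le_one v k)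
    positivity
  have e : (fun i j k => N i * N j * (1 - N k) * (W i k * W j k) +
      N i * N k * (1 - N j) * (W i j * W j k) + N j * N k * (1 - N i) * (W i j * W i k) +
      2 * (N i * N j * N k * ((1 - W i j) * (1 - W j k) * (1 - W i k)))) =
      fun i j k => P i j k - (N i * P i j k + N j * P i j k + N k * P i j k) +
        2 * (N i * N j * N k) +
        (N i * (N j * (1 - N k) * W j k) + N j * (N i * (1 - N k) * W i k) +
          N i * (N k * (1 - N j) * W j k) + N j * (N k * (1 - N i) * W i k) +
          N k * (N i * (1 - N j) * W i j) + N k * (N j * (1 - N i) * W i j)) -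
        (N i * N j * (1 - W i j) * (W i k + W j k - 2 * (W i k * W j k)) +
          N i * N k * (1 - W i k) * (W i j + W j k - 2 * (W i j * W j k)) +
          N j * N k * (1 - W j k) * (W i j + W i k - 2 * (W i j * W i k))) -
        (1 - N i) * (1 - N j) * (1 - N k) * P i j k := by
    funext i j k
    simp only [hP, maj3]
    ring
  rw [e] at key
  simp only [tripleSum_add, tripleSum_sub, tripleSum_smul] at key
  rw [eQ2, eQ3, eE2, eE3, eE4, eE5, eE6, eG2, eG3, ← eD, ← eE1, ← eQ1, ← eL] at key
  have : tripleSum w P = majDens w W := rfl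
  rw [this] at key
  linarith

end FiniteGraphon

/-- The stationarity relation rewrites as (a - D)(D - b) = 2E + η > 0, so D lies strictly between b
and a. The last two inequalities place the normalised density R/(1-D)² of the non-neighbours in the
piece with one clique fewer. -/
theorem link_density_bounds {k a b D E C η d R : ℝ} (hk : 1 ≤ k) (hb : 0 < b) (hba : b < a)
    (hd : (k + 1) * a ^ 2 + b ^ 2 = d) (h1 : (k + 1) * a + b = 1)
    (hE : 2 * E = (a + b) * D - a * b - η - D ^ 2) (hC : 0 ≤ C) (hCE : C ≤ E) (hη : 0 < η)
    (hRd : R = d - D ^ 2 + C - 2 * E) :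
    b < D ∧ D < 1 ∧ (1 - D) ^ 2 ≤ (k + 1) * R ∧ k * R ≤ (1 - D) ^ 2 := by
  have hprod : 0 < (a - D) * (D - b) := by
    have : (a - D) * (D - b) = 2 * E + η := by linear_combination -hE
    linarith
  have hD : 0 < a - D ∧ 0 < D - b := by
    rcases pos_and_pos_or_neg_and_neg_of_mul_pos hprod with h | h
    · exact h
    · linarith [h.1, h.2]
  have ha1 : a < 1 := by
    have : 0 < k * a := mul_pos (by linarith) (hb.trans hba)
    linarith
  refine ⟨by linarith [hD.2], by linarith [hD.1], ?_, ?_⟩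
  · have hR0 : d - (a + b) * D + a * b ≤ R := by linarith
    have e : (k + 1) * (d - (a + b) * D + a * b) - (1 - D) ^ 2 =
        k * ((a - b) * (D - b)) + (a - D) * (D - b) := by
      rw [show 1 - D = (k + 1) * a + b - D by rw [h1], ← hd]; ring
    have h2 : 0 ≤ k * ((a - b) * (D - b)) :=
      mul_nonneg (by linarith) (mul_nonneg (by linarith) hD.2.le)
    have h3 := mul_le_mul_of_nonneg_left hR0 (show 0 ≤ k + 1 by linarith)
    linarith
  · have hR1 : R ≤ d - D ^ 2 := by linarith
    have hkd1 : (k + 1) * d ≤ 1 := by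
      have e : ((k + 1) * a + b) ^ 2 - (k + 1) * ((k + 1) * a ^ 2 + b ^ 2) =
        (k + 1) * (b * (a - b)) + (k + 1) * (a * b) + b ^ 2 := by ring
      rw [h1, hd] at e
      have h2 : 0 ≤ (k + 1) * (b * (a - b)) :=
        mul_nonneg (by linarith) (mul_nonneg hb.le (by linarith))
      have h3 : 0 ≤ (k + 1) * (a * b) :=
        mul_nonneg (by linarith) (mul_nonneg (by linarith) hb.le)
      linarith [sq_nonneg b]
    have h3 : k * R ≤ k * (d - D ^ 2) := mul_le_mul_of_nonneg_left hR1 (by linarith)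
    have h4 : k * ((k + 1) * d) ≤ k * 1 := mul_le_mul_of_nonneg_left hkd1 (by linarith)
    have h5 : 0 ≤ ((k + 1) * D - 1) ^ 2 := sq_nonneg _
    have : (k + 1) * (k * (d - D ^ 2)) ≤ (k + 1) * (1 - D) ^ 2 := by linarith
    exact h3.trans (le_of_mul_le_mul_left this (by linarith))

/-- The upper bound `hL` simplifies, through the relation for E and the bound on G, to FL ≤ (a+b)d -
ab - η + (3/2)(a+b)C - 3(a+b)E - D³. Extremality and `clique_replacement` bound FL below by the same
expression with (1-D)³η in place of η, and (1-D)³ < 1. -/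
theorem link_contradiction {k a b α β D E C η d R FL G : ℝ} (hk : 1 ≤ k) (hb : 0 < b)
    (hba : b < a) (hd : (k + 1) * a ^ 2 + b ^ 2 = d) (h1 : (k + 1) * a + b = 1)
    (hE : 2 * E = (a + b) * D - a * b - η - D ^ 2) (hC : 0 ≤ C) (hCE : C ≤ E) (hη : 0 < η)
    (hRd : R = d - D ^ 2 + C - 2 * E) (hm : k * α + β = 1)
    (hR : k * α ^ 2 + β ^ 2 = (1 - D)⁻¹ ^ 2 * R) (hβα : β ≤ α)
    (hG : 3 / 2 * (a + b) * C ≤ 3 * G)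
    (hL : FL ≤ (a + b) * d - a * b - η - 3 * ((a + b) * (D ^ 2 - C + E) - (a * b + η) * D) +
      2 * D ^ 3 + 6 * (D * E) - 3 * G)
    (hFL : k * α ^ 3 + β ^ 3 - η ≤ (1 - D)⁻¹ ^ 3 * FL) : False := by
  obtain ⟨hbD, hD1, -, -⟩ := link_density_bounds hk hb hba hd h1 hE hC hCE hη hRd
  have hm0 : 0 < 1 - D := by linarith
  have hrep := clique_replacement (α := (1 - D) * α) (β := (1 - D) * β) hk hba hd.symm h1 hE hC
    hCE hη (by linear_combination (1 - D) * hm)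
    (by
      have : R = (1 - D) ^ 2 * ((1 - D)⁻¹ ^ 2 * R) := by field_simp
      rw [this, ← hR]; ring) hRd (mul_le_mul_of_nonneg_left hβα hm0.le)
  have hFLlow : (1 - D) ^ 3 * (k * α ^ 3 + β ^ 3 - η) ≤ FL := by
    have : FL = (1 - D) ^ 3 * ((1 - D)⁻¹ ^ 3 * FL) := by field_simp
    rw [this]
    exact mul_le_mul_of_nonneg_left hFL (by positivity)
  have hcube : (k + 1) * a ^ 3 + b ^ 3 = (a + b) * d - a * b := by
    rw [← hd]; linear_combination -(a * b) * h1
  have hP : k * ((1 - D) * α) ^ 3 + ((1 - D) * β) ^ 3 =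
      (1 - D) ^ 3 * (k * α ^ 3 + β ^ 3 - η) + (1 - D) ^ 3 * η := by ring
  rw [hcube, hP] at hrep
  have hED : 6 * (D * E) = 3 * D * ((a + b) * D - a * b - η - D ^ 2) := by rw [← hE]; ring
  have hsE : 3 * (a + b) * E = 3 / 2 * (a + b) * ((a + b) * D - a * b - η - D ^ 2) := by
    rw [← hE]; ring
  have hRs : (a + b) * R = (a + b) * (d - D ^ 2 + C - ((a + b) * D - a * b - η - D ^ 2)) := by
    rw [hRd, hE]
  have hlt1 : (1 - D) ^ 3 * η < 1 * η :=
    mul_lt_mul_of_pos_right (pow_lt_one₀ hm0.le (by linarith) (by norm_num)) hη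
  linarith

/-! ### Extremal weighted graphs. -/

section FiniteGraphon

variable {V : Type*} [Fintype V] {w : V → ℝ} {W : V → V → ℝ}

theorem IsGraphon.wdeg_nonneg (h : IsGraphon w W) (v : V) : 0 ≤ wdeg w W v :=
  Finset.sum_nonneg fun i _ => mul_nonneg (h.nonneg i) (h.W_nonneg v i)

theorem IsGraphon.openCherry_nonneg (h : IsGraphon w W) (v : V) : 0 ≤ openCherry w W v :=
  Finset.sum_nonneg fun i _ => Finset.sum_nonneg fun j _ => mul_nonneg
    (mul_nonneg (h.nonneg i) (h.nonneg j)) (mul_nonneg (mul_nonneg (h.W_nonneg v i)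
      (h.W_nonneg v j)) (sub_nonneg.2 (h.W_le_one i j)))

/-- The weighted averages of the two quantities agree by `sum_openCherry_eq`. -/
theorem IsGraphon.exists_openCherry_le (h : IsGraphon w W) :
    ∃ v, 0 < w v ∧ openCherry w W v ≤ openPath w W v := by
  by_contra hc
  push Not at hc
  obtain ⟨v, -, hv⟩ : ∃ v ∈ Finset.univ, 0 < w v := by
    apply Finset.exists_lt_of_sum_lt (f := fun _ => (0 : ℝ))
    simp [h.sum_one]
  have : ∑ v, w v * openPath w W v < ∑ v, w v * openCherry w W v := by
    refine Finset.sum_lt_sum (fun u _ => ?_) ⟨v, Finset.mem_univ _,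
      mul_lt_mul_of_pos_left (hc v hv) hv⟩
    rcases (h.nonneg u).eq_or_lt with h0 | h0
    · simp [← h0]
    · exact (mul_lt_mul_of_pos_left (hc u h0) h0).le
  rw [sum_openCherry_eq h.symm] at this
  exact lt_irrefl _ this

/-- `(w, W)` minimises `majDens - cliqueBound edgeDens`. -/
def IsExtremal (w : V → ℝ) (W : V → V → ℝ) : Prop :=
  ∀ (w' : V → ℝ) (W' : V → V → ℝ), IsGraphon w' W' →
    majDens w W - cliqueBound (edgeDens w W) ≤ majDens w' W' - cliqueBound (edgeDens w' W')

theorem IsExtremal.rootMaj_eq (h : IsGraphon w W) (hx : IsExtremal w W) {c : ℝ}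
    (hc : HasDerivAt cliqueBound c (edgeDens w W)) {v : V} (hv : 0 < w v) :
    3 * (rootMaj w W v - majDens w W) = 2 * c * (wdeg w W v - edgeDens w W) := by
  classical
  -- The direction moves mass proportionally from all vertices to v. As w v > 0, small negative
  -- times are also admissible, so the derivative vanishes.
  set p : V → ℝ := fun i => (if i = v then 1 else 0) - w i with hp
  have hp1 : ∑ i, p i = 0 := by simp [hp, h.sum_one]
  have hpr : ∑ i, p i * rootMaj w W i = rootMaj w W v - majDens w W := by
    simp [hp, sub_mul, majDens_eq_root]
  have hpd : ∑ i, p i * wdeg w W i = wdeg w W v - edgeDens w W := by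
    simp [hp, sub_mul, edgeDens_eq_wdeg]
  have h1 := hasDerivAt_majDens_weight (w := w) h.symm p
  have h2 := hasDerivAt_edgeDens_weight (w := w) h.symm p
  rw [hpr] at h1
  rw [hpd] at h2
  have h3 : HasDerivAt cliqueBound c (edgeDens (fun i => w i + 0 * p i) W) := by simpa using hc
  have h4 := h1.sub (h3.comp (0 : ℝ) h2)
  have hmin : IsLocalMin ((fun t : ℝ => majDens (fun i => w i + t * p i) W) -
      cliqueBound ∘ fun t => edgeDens (fun i => w i + t * p i) W) 0 := by
    have hv1 : w v ≤ 1 := h.sum_one ▸ Finset.single_le_sum (fun i _ => h.nonneg i)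
      (Finset.mem_univ v)
    filter_upwards [Ioo_mem_nhds (neg_lt_zero.2 hv) hv] with t ht
    have hg : IsGraphon (fun i => w i + t * p i) W := by
      refine ⟨fun i => ?_, ?_, h.symm, h.W_nonneg, h.W_le_one⟩
      · by_cases hi : i = v
        · subst hi
          simp only [hp, if_true]
          nlinarith [ht.1, ht.2]
        · simp only [hp, hi, if_false]
          have := mul_nonneg (h.nonneg i) (show 0 ≤ 1 - t by linarith [ht.2])
          linarith
      · rw [Finset.sum_add_distrib, ← Finset.mul_sum, hp1, h.sum_one]; ring
    simpa using hx _ _ hg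
  have := hmin.hasDerivAt_eq_zero h4
  linarith

/-- The perturbation adds edge weight on pairs of neighbours of v in proportion to the missing
weight, closing the open cherries at v. It is admissible only for t ≥ 0, so only an inequality
results. -/
theorem IsExtremal.openCherry_le (h : IsGraphon w W) (hx : IsExtremal w W) {c : ℝ}
    (hc : HasDerivAt cliqueBound c (edgeDens w W)) (v : V) :
    c * openCherry w W v ≤ 3 * tripleSum w (fun i j k =>
        W v i * W v j * (1 - W i j) * (W i k + W j k - 2 * (W i k * W j k))) := by
  set H : V → V → ℝ := fun i j => W v i * W v j * (1 - W i j) with hH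
  have hH0 : ∀ i j, 0 ≤ H i j := fun i j => mul_nonneg (mul_nonneg (h.W_nonneg v i)
      (h.W_nonneg v j)) (sub_nonneg.2 (h.W_le_one i j))
  have hH1 : ∀ i j, H i j ≤ 1 - W i j := fun i j => mul_le_of_le_one_left
    (sub_nonneg.2 (h.W_le_one i j)) (mul_le_one₀ (h.W_le_one v i) (h.W_nonneg v j)
      (h.W_le_one v j))
  have h1 := hasDerivAt_majDens_edge (w := w) h.symm H
  have h2 := hasDerivAt_edgeDens_edge (w := w) (W := W) H
  have h3 : HasDerivAt cliqueBound c (edgeDens w (fun i j => W i j + 0 * H i j)) := by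
    simpa using hc
  have h4 := h1.sub (h3.comp (0 : ℝ) h2)
  have := nonneg_of_hasDerivAt_of_le h4 fun t ht => by
    have hg : IsGraphon w (fun i j => W i j + t * H i j) := by
      refine ⟨h.nonneg, h.sum_one, fun i j => ?_, fun i j => ?_, fun i j => ?_⟩
      · simp only [hH]; rw [h.symm i j]; ring
      · exact add_nonneg (h.W_nonneg i j) (mul_nonneg ht.1 (hH0 i j))
      · have := mul_le_of_le_one_left (hH0 i j) ht.2
        linarith [hH1 i j]
    simpa using hx _ _ hg
  have e : edgeDens w H = openCherry w W v := rfl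
  rw [e] at this
  linarith

theorem IsExtremal.cliqueBound_le (h : IsGraphon w W) (hx : IsExtremal w W) :
    cliqueBound (edgeDens w W) ≤ majDens w W := by
  by_contra hlt
  have hlt : majDens w W < cliqueBound (edgeDens w W) := not_le.1 hlt
  have hsq := h.sq_edgeDens_le
  have hd1 := h.edgeDens_le_one
  rcases h.edgeDens_nonneg.eq_or_lt with h0 | h0
  · rw [← h0, cliqueBound_zero] at hlt
    rw [← h0] at hsq
    linarith
  obtain ⟨n, a, b, hn, hb, hba, e1, e2, e3⟩ := exists_clique_partition h0 hd1
  set d := edgeDens w W with hd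
  have hn2 : (2 : ℝ) ≤ n := by exact_mod_cast hn
  -- At a vanishing Cauchy–Schwarz defect `cliqueBound` d equals d², and the quadratic bound already
  -- contradicts `hlt`. Otherwise 0 < b < a, and the curve is differentiable at d.
  have hne : ((n : ℝ) - 1) * a * b * (a - b) ^ 2 ≠ 0 := by
    intro hz
    have : (((n : ℝ) - 1) * a ^ 3 + b ^ 3) * (((n : ℝ) - 1) * a + b) -
        (((n : ℝ) - 1) * a ^ 2 + b ^ 2) ^ 2 = 0 := by rw [← hz]; ring
    rw [e1, e2, ← e3] at this
    linarith
  have hb0 : 0 < b := hb.lt_of_ne fun h => hne (by rw [← h]; ring)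
  have hba' : b < a := hba.lt_of_ne fun h => hne (by rw [h]; ring)
  have ha0 : 0 < a := hb0.trans hba'
  have hn3 : 3 ≤ n := by
    by_contra hc
    obtain rfl : n = 2 := by omega
    have := h.linear_le
    rw [← hd, ← e2] at this
    rw [e3] at hlt
    push_cast at *
    obtain rfl : b = 1 - a := by linarith
    nlinarith
  have hn3' : (3 : ℝ) ≤ n := by exact_mod_cast hn3
  obtain ⟨k, hk⟩ : ∃ k : ℝ, (n : ℝ) = k + 2 := ⟨n - 2, by ring⟩
  have hk1 : 1 ≤ k := by linarith
  have hc := hasDerivAt_cliqueBound hn hb0 hba' e1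
  rw [e2] at hc
  obtain ⟨η, hη⟩ : ∃ η, η = cliqueBound d - majDens w W := ⟨_, rfl⟩
  have hη0 : 0 < η := by linarith
  have hcb : cliqueBound d = (a + b) * d - a * b := by
    rw [e3]
    have : ((n : ℝ) - 1) * a ^ 3 + b ^ 3 = (a + b) * (((n : ℝ) - 1) * a ^ 2 + b ^ 2) -
      a * b * (((n : ℝ) - 1) * a + b) := by ring
    rw [this, e1, e2]; ring
  -- Stationarity with slope 3(a+b)/2 fixes `rootMaj` on vertices of positive mass; multiplying by w
  -- v makes the relation hold at every vertex, so that it can be summed.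
  have hroot : ∀ v, w v * rootMaj w W v = w v * ((a + b) * wdeg w W v - a * b - η) := by
    intro v
    rcases (h.nonneg v).eq_or_lt with hv | hv
    · rw [← hv]; ring
    · have := hx.rootMaj_eq h hc hv
      congr 1
      linarith
  obtain ⟨v, hv, hCE⟩ := h.exists_openCherry_le
  have hG := hx.openCherry_le h hc v
  have hL := h.majDens_link_le v
  have hC0 := h.openCherry_nonneg v
  have hrv := mul_left_cancel₀ hv.ne' (hroot v)
  rw [_root_.rootMaj_eq h.symm] at hrv
  have hQ : ∑ i, w i * W v i * rootMaj w W i =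
      (a + b) * (wdeg w W v ^ 2 - openCherry w W v + openPath w W v) -
        (a * b + η) * wdeg w W v := by
    rw [← sum_nbhd_wdeg]
    simp only [wdeg, Finset.mul_sum (a := a * b + η)]
    rw [Finset.mul_sum, ← Finset.sum_sub_distrib]
    refine Finset.sum_congr rfl fun i _ => ?_
    have := hroot i
    simp only [wdeg] at this
    linear_combination W v i * this
  have hRd := edgeDens_link (w := w) h.symm v
  have hD0 := h.wdeg_nonneg v
  set C := openCherry w W v
  set E := openPath w W v
  set D := wdeg w W v with hD
  set R := edgeDens (fun i => w i * (1 - W v i)) W with hR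
  set FL := majDens (fun i => w i * (1 - W v i)) W with hFL
  rw [hQ] at hL
  have hE : 2 * E = (a + b) * D - a * b - η - D ^ 2 := by linarith
  have hka : (k + 1) * a + b = 1 := by rw [hk] at e1; linarith
  have hkd : (k + 1) * a ^ 2 + b ^ 2 = d := by rw [hk] at e2; linarith
  obtain ⟨hbD, hD1, hRlow, hRup⟩ := link_density_bounds hk1 hb0 hba' hkd hka hE hC0 hCE hη0 hRd
  have hm0 : 0 < 1 - D := by linarith
  have hsumL : ∑ i, w i * (1 - W v i) = 1 - D := by
    simp only [mul_sub, mul_one, Finset.sum_sub_distrib, h.sum_one, hD, wdeg]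
  have hgL : IsGraphon (fun i => (1 - D)⁻¹ * (w i * (1 - W v i))) W := by
    refine ⟨fun i => ?_, ?_, h.symm, h.W_nonneg, h.W_le_one⟩
    · exact mul_nonneg (inv_nonneg.2 hm0.le) (mul_nonneg (h.nonneg i)
        (sub_nonneg.2 (h.W_le_one v i)))
    · rw [← Finset.mul_sum, hsumL, inv_mul_cancel₀ hm0.ne']
  -- The renormalised non-neighbours of v live on the same vertex set, so extremality applies to
  -- them directly and no induction is needed.
  have hxL := hx _ _ hgL
  rw [edgeDens_smul, majDens_smul, ← hR, ← hFL] at hxL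
  have hn' : ((n - 1 : ℕ) : ℝ) = k + 1 := by
    rw [Nat.cast_sub (by omega), hk]; push_cast; ring
  obtain ⟨α, β, hβ, hβα, f1, f2, -⟩ := exists_clique_sizes (n := n - 1) (by omega)
    (d := (1 - D)⁻¹ ^ 2 * R)
    (by
      rw [hn', inv_pow, ← mul_assoc, mul_comm (k + 1), mul_assoc, ← div_eq_inv_mul,
        le_div_iff₀ (by positivity)]
      linarith)
    (by
      rw [hn', inv_pow, ← mul_assoc, mul_comm (k + 1 - 1), mul_assoc, ← div_eq_inv_mul,
        div_le_iff₀ (by positivity), add_sub_cancel_right]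
      linarith)
  have f3 := cliqueBound_param (n := n - 1) (by omega) hβ hβα f1
  rw [f2] at f3
  rw [f3] at hxL
  rw [hn', add_sub_cancel_right] at f1 f2 hxL
  rw [show majDens w W = (a + b) * d - a * b - η by linarith] at hL
  exact link_contradiction hk1 hb0 hba' hkd hka hE hC0 hCE hη0 hRd f1 f2 hβα hG hL
    (by linarith)

theorem isCompact_isGraphon :
    IsCompact {p : (V → ℝ) × (V → V → ℝ) | IsGraphon p.1 p.2} := by
  refine IsCompact.of_isClosed_subset (isCompact_Icc.prod isCompact_Icc :
    IsCompact (Set.Icc (0 : V → ℝ) 1 ×ˢ Set.Icc (0 : V → V → ℝ) 1)) ?_ ?_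
  · have hw : ∀ i, Continuous fun p : (V → ℝ) × (V → V → ℝ) => p.1 i :=
      fun i => (continuous_apply i).comp continuous_fst
    have hW : ∀ i j, Continuous fun p : (V → ℝ) × (V → V → ℝ) => p.2 i j :=
      fun i j => (continuous_apply j).comp ((continuous_apply i).comp continuous_snd)
    have e : {p : (V → ℝ) × (V → V → ℝ) | IsGraphon p.1 p.2} =
        (⋂ i, {p | 0 ≤ p.1 i}) ∩ {p | ∑ i, p.1 i = 1} ∩
        (⋂ i, ⋂ j, {p | p.2 i j = p.2 j i}) ∩ (⋂ i, ⋂ j, {p | 0 ≤ p.2 i j}) ∩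
        (⋂ i, ⋂ j, {p | p.2 i j ≤ 1}) := by
      ext p
      simp only [Set.mem_inter_iff, Set.mem_iInter]
      exact ⟨fun h => ⟨⟨⟨⟨h.1, h.2⟩, h.3⟩, h.4⟩, h.5⟩, fun h => ⟨h.1.1.1.1, h.1.1.1.2, h.1.1.2,
        h.1.2, h.2⟩⟩
    rw [e]
    exact ((((isClosed_iInter fun i => isClosed_le continuous_const (hw i)).inter
      (isClosed_eq (continuous_finsetSum _ fun i _ => hw i) continuous_const)).inter
      (isClosed_iInter fun i => isClosed_iInter fun j => isClosed_eq (hW i j) (hW j i))).inter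
      (isClosed_iInter fun i => isClosed_iInter fun j => isClosed_le continuous_const
        (hW i j))).inter
      (isClosed_iInter fun i => isClosed_iInter fun j => isClosed_le (hW i j) continuous_const)
  · rintro p (hp : IsGraphon p.1 p.2)
    refine ⟨⟨hp.nonneg, fun i => ?_⟩, ⟨fun i j => hp.W_nonneg i j, fun i j => hp.W_le_one i j⟩⟩
    have := Finset.single_le_sum (fun i _ => hp.nonneg i) (Finset.mem_univ i)
    rwa [hp.sum_one] at this

theorem exists_isExtremal (h : IsGraphon w W) :
    ∃ (w₀ : V → ℝ) (W₀ : V → V → ℝ), IsGraphon w₀ W₀ ∧ IsExtremal w₀ W₀ := by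
  have hdc : Continuous fun p : (V → ℝ) × (V → V → ℝ) => edgeDens p.1 p.2 := by
    unfold edgeDens; fun_prop
  have hFc : Continuous fun p : (V → ℝ) × (V → V → ℝ) => majDens p.1 p.2 := by
    unfold majDens tripleSum maj3; fun_prop
  have hcont : ContinuousOn (fun p : (V → ℝ) × (V → V → ℝ) =>
      majDens p.1 p.2 - cliqueBound (edgeDens p.1 p.2)) {p | IsGraphon p.1 p.2} :=
    hFc.continuousOn.sub (continuousOn_cliqueBound.comp hdc.continuousOn
      fun p (hp : IsGraphon p.1 p.2) => ⟨hp.edgeDens_nonneg, hp.edgeDens_le_one⟩)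
  obtain ⟨p, hp, hmin⟩ := isCompact_isGraphon.exists_isMinOn ⟨(w, W), h⟩ hcont
  exact ⟨p.1, p.2, hp, fun v V hV => hmin (a := (v, V)) hV⟩

/-- A finite weighted graph of edge density `d` has at least as many triples spanning two edges as
the disjoint union of equal cliques and one smaller clique with that density. -/
theorem IsGraphon.cliqueBound_le (h : IsGraphon w W) :
    cliqueBound (edgeDens w W) ≤ majDens w W := by
  obtain ⟨w₀, W₀, h₀, hx⟩ := exists_isExtremal h
  have h1 := hx.cliqueBound_le h₀
  have h2 := hx w W h
  linarith

end FiniteGraphon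

/-! ### Doubly stochastic measures and concordance. -/

/-- Doubly stochastic measures on the unit square, as measures on the plane. -/
structure IsDoublyStochastic (μ : Measure (ℝ × ℝ)) : Prop where
  fst : μ.map Prod.fst = volume.restrict (Set.Icc 0 1)
  snd : μ.map Prod.snd = volume.restrict (Set.Icc 0 1)

/-- Probability of concordance of two independent points. -/
noncomputable def concordance (μ : Measure (ℝ × ℝ)) : ℝ :=
  (μ.prod μ).real {w | 0 < (w.1.1 - w.2.1) * (w.1.2 - w.2.2)}

/-- Probability of discordance of two independent points. -/
noncomputable def discordance (μ : Measure (ℝ × ℝ)) : ℝ :=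
  (μ.prod μ).real {w | (w.1.1 - w.2.1) * (w.1.2 - w.2.2) < 0}

/-- The tau-rho region of doubly stochastic measures. -/
def dsRegion : Set (ℝ × ℝ) :=
  {p | ∃ μ : Measure (ℝ × ℝ), IsDoublyStochastic μ ∧
    p = (2 * concordance μ - 1, 12 * (∫ z, z.1 * z.2 ∂μ) - 3)}

theorem measurableSet_concordant :
    MeasurableSet {w : (ℝ × ℝ) × (ℝ × ℝ) | 0 < (w.1.1 - w.2.1) * (w.1.2 - w.2.2)} :=
  measurableSet_lt (by fun_prop) (by fun_prop)

theorem measurableSet_discordant :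
    MeasurableSet {w : (ℝ × ℝ) × (ℝ × ℝ) | (w.1.1 - w.2.1) * (w.1.2 - w.2.2) < 0} :=
  measurableSet_lt (by fun_prop) (by fun_prop)

namespace IsDoublyStochastic

variable {μ : Measure (ℝ × ℝ)}

theorem isProbabilityMeasure (h : IsDoublyStochastic μ) : IsProbabilityMeasure μ := by
  constructor
  have := congrArg (fun ν => ν Set.univ) h.fst
  simpa [Measure.map_apply measurable_fst] using this

theorem fst_preimage (h : IsDoublyStochastic μ) {s : Set ℝ} (hs : MeasurableSet s) :
    μ (Prod.fst ⁻¹' s) = volume (s ∩ Set.Icc 0 1) := by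
  rw [← Measure.map_apply measurable_fst hs, h.fst, Measure.restrict_apply hs]

theorem snd_preimage (h : IsDoublyStochastic μ) {s : Set ℝ} (hs : MeasurableSet s) :
    μ (Prod.snd ⁻¹' s) = volume (s ∩ Set.Icc 0 1) := by
  rw [← Measure.map_apply measurable_snd hs, h.snd, Measure.restrict_apply hs]

theorem ae_mem (h : IsDoublyStochastic μ) :
    ∀ᵐ z ∂μ, z.1 ∈ Set.Icc (0 : ℝ) 1 ∧ z.2 ∈ Set.Icc (0 : ℝ) 1 := by
  refine Filter.Eventually.and ?_ ?_
  · have := h.fst_preimage (measurableSet_Icc (a := (0 : ℝ)) (b := 1)).compl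
    rw [Set.compl_inter_self, measure_empty] at this
    exact this
  · have := h.snd_preimage (measurableSet_Icc (a := (0 : ℝ)) (b := 1)).compl
    rw [Set.compl_inter_self, measure_empty] at this
    exact this

theorem prod_fst_eq (h : IsDoublyStochastic μ) :
    (μ.prod μ) {w | w.1.1 = w.2.1} = 0 := by
  have := h.isProbabilityMeasure
  rw [Measure.measure_prod_null (measurableSet_eq_fun (by fun_prop) (by fun_prop))]
  refine Filter.Eventually.of_forall fun z => ?_
  have := h.fst_preimage (measurableSet_singleton z.1)
  rw [measure_mono_null Set.inter_subset_left Real.volume_singleton] at this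
  refine measure_mono_null ?_ this
  intro y hy
  exact (Eq.symm hy : y.1 = z.1)

theorem prod_snd_eq (h : IsDoublyStochastic μ) :
    (μ.prod μ) {w | w.1.2 = w.2.2} = 0 := by
  have := h.isProbabilityMeasure
  rw [Measure.measure_prod_null (measurableSet_eq_fun (by fun_prop) (by fun_prop))]
  refine Filter.Eventually.of_forall fun z => ?_
  have := h.snd_preimage (measurableSet_singleton z.2)
  rw [measure_mono_null Set.inter_subset_left Real.volume_singleton] at this
  refine measure_mono_null ?_ this
  intro y hy
  exact (Eq.symm hy : y.2 = z.2)

theorem ae_ne (h : IsDoublyStochastic μ) :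
    ∀ᵐ w ∂(μ.prod μ), w.1.1 ≠ w.2.1 ∧ w.1.2 ≠ w.2.2 := by
  refine Filter.Eventually.and ?_ ?_
  · exact measure_eq_zero_iff_ae_notMem.1 h.prod_fst_eq
  · exact measure_eq_zero_iff_ae_notMem.1 h.prod_snd_eq

theorem concordance_add_discordance (h : IsDoublyStochastic μ) :
    concordance μ + discordance μ = 1 := by
  have := h.isProbabilityMeasure
  rw [concordance, discordance, ← measureReal_union _ measurableSet_discordant]
  · have e : ({w | 0 < (w.1.1 - w.2.1) * (w.1.2 - w.2.2)} ∪
        {w | (w.1.1 - w.2.1) * (w.1.2 - w.2.2) < 0} : Set ((ℝ × ℝ) × (ℝ × ℝ)))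
        =ᵐ[μ.prod μ] Set.univ := by
      rw [Filter.eventuallyEq_univ]
      filter_upwards [h.ae_ne] with w hw
      have : (w.1.1 - w.2.1) * (w.1.2 - w.2.2) ≠ 0 :=
        mul_ne_zero (sub_ne_zero.2 hw.1) (sub_ne_zero.2 hw.2)
      exact (lt_or_gt_of_ne this).symm
    rw [measureReal_congr e, probReal_univ]
  · rw [Set.disjoint_left]
    intro w h1 h2
    exact lt_asymm (Set.mem_ofPred.1 h1) (Set.mem_ofPred.1 h2)

/-- A concordant pair is ordered in one of two ways, equally likely by exchanging the points; ties
are null. -/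
theorem two_mul_lower_quadrant (h : IsDoublyStochastic μ) :
    concordance μ = 2 * (μ.prod μ).real {w | w.2.1 ≤ w.1.1 ∧ w.2.2 ≤ w.1.2} := by
  have := h.isProbabilityMeasure
  set S : Set ((ℝ × ℝ) × (ℝ × ℝ)) := {w | w.2.1 ≤ w.1.1 ∧ w.2.2 ≤ w.1.2} with hS
  set S' : Set ((ℝ × ℝ) × (ℝ × ℝ)) := {w | w.1.1 < w.2.1 ∧ w.1.2 < w.2.2} with hS'
  have hSm : MeasurableSet S :=
    MeasurableSet.inter (s₁ := {w : (ℝ × ℝ) × (ℝ × ℝ) | w.2.1 ≤ w.1.1})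
      (s₂ := {w : (ℝ × ℝ) × (ℝ × ℝ) | w.2.2 ≤ w.1.2})
      (measurableSet_le (by fun_prop) (by fun_prop)) (measurableSet_le (by fun_prop) (by fun_prop))
  have hSm' : MeasurableSet S' :=
    MeasurableSet.inter (s₁ := {w : (ℝ × ℝ) × (ℝ × ℝ) | w.1.1 < w.2.1})
      (s₂ := {w : (ℝ × ℝ) × (ℝ × ℝ) | w.1.2 < w.2.2})
      (measurableSet_lt (by fun_prop) (by fun_prop)) (measurableSet_lt (by fun_prop) (by fun_prop))
  have e1 : (μ.prod μ).real S' = (μ.prod μ).real S := by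
    have hsw : (μ.prod μ).real (Prod.swap ⁻¹' S) = (μ.prod μ).real S := by
      rw [measureReal_def, measureReal_def, ← Measure.map_apply measurable_swap hSm,
        Measure.prod_swap]
    rw [← hsw]
    refine measureReal_congr (Filter.eventuallyEq_set.2 ?_)
    filter_upwards [h.ae_ne] with w hw
    refine ⟨fun hh => ⟨hh.1.le, hh.2.le⟩, fun hh => ⟨hh.1.lt_of_ne ?_, hh.2.lt_of_ne ?_⟩⟩
    · exact hw.1
    · exact hw.2
  have hdis : Disjoint S S' := by
    rw [Set.disjoint_left]
    intro w h1 h2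
    exact absurd h1.1 (not_le.2 h2.1)
  have e2 : ({w | 0 < (w.1.1 - w.2.1) * (w.1.2 - w.2.2)} : Set ((ℝ × ℝ) × (ℝ × ℝ)))
      =ᵐ[μ.prod μ] (S ∪ S' : Set _) := by
    refine Filter.eventuallyEq_set.2 ?_
    filter_upwards [h.ae_ne] with w hw
    refine ⟨fun hh => ?_, fun hh => ?_⟩
    · rcases pos_and_pos_or_neg_and_neg_of_mul_pos hh with hh | hh
      · exact Or.inl ⟨by linarith [hh.1], by linarith [hh.2]⟩
      · exact Or.inr ⟨by linarith [hh.1], by linarith [hh.2]⟩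
    · rcases hh with hh | hh
      · exact mul_pos (sub_pos.2 (hh.1.lt_of_ne hw.1.symm)) (sub_pos.2 (hh.2.lt_of_ne hw.2.symm))
      · exact mul_pos_of_neg_of_neg (sub_neg.2 hh.1) (sub_neg.2 hh.2)
  rw [concordance, measureReal_congr e2, measureReal_union hdis hSm', e1]
  ring

end IsDoublyStochastic

/-! ### Random variables and the probability integral transform. -/

theorem eq_uniform_of_Iic {ν : Measure ℝ} [IsProbabilityMeasure ν]
    (h : ∀ t ∈ Set.Icc (0 : ℝ) 1, ν (Set.Iic t) = ENNReal.ofReal t) :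
    ν = volume.restrict (Set.Icc 0 1) := by
  refine Measure.ext_of_Iic _ _ fun t => ?_
  rw [Measure.restrict_apply measurableSet_Iic]
  rcases lt_or_ge t 0 with ht | ht
  · have h0 := h 0 ⟨le_rfl, zero_le_one⟩
    rw [ENNReal.ofReal_zero] at h0
    rw [measure_mono_null (Set.Iic_subset_Iic.2 ht.le) h0]
    have : Set.Iic t ∩ Set.Icc 0 1 = ∅ := by
      ext x; simp only [Set.mem_inter_iff, Set.mem_Iic, Set.mem_Icc, Set.mem_empty_iff_false]
      constructor
      · rintro ⟨h1, h2, -⟩; linarith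
      · simp
    rw [this, measure_empty]
  · rcases le_or_gt t 1 with ht1 | ht1
    · have : Set.Iic t ∩ Set.Icc 0 1 = Set.Icc 0 t := by
        ext x; simp only [Set.mem_inter_iff, Set.mem_Iic, Set.mem_Icc]
        constructor
        · rintro ⟨h1, h2, -⟩; exact ⟨h2, h1⟩
        · rintro ⟨h1, h2⟩; exact ⟨h2, h1, h2.trans ht1⟩
      rw [this, h t ⟨ht, ht1⟩, Real.volume_Icc, sub_zero]
    · have : Set.Iic t ∩ Set.Icc 0 1 = Set.Icc (0 : ℝ) 1 :=
        Set.inter_eq_right.2 fun x hx => hx.2.trans ht1.le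
      rw [this, Real.volume_Icc]
      have h1 := h 1 ⟨zero_le_one, le_rfl⟩
      have : ν (Set.Iic t) = 1 := le_antisymm prob_le_one (by
        calc (1 : ENNReal) = ν (Set.Iic 1) := by rw [h1]; simp
          _ ≤ _ := measure_mono (Set.Iic_subset_Iic.2 ht1.le))
      rw [this]; simp

theorem uniform_Iic {t : ℝ} (ht : t ∈ Set.Icc (0 : ℝ) 1) :
    (volume.restrict (Set.Icc (0 : ℝ) 1)) (Set.Iic t) = ENNReal.ofReal t := by
  rw [Measure.restrict_apply measurableSet_Iic]
  have : Set.Iic t ∩ Set.Icc 0 1 = Set.Icc 0 t := by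
    ext x; simp only [Set.mem_inter_iff, Set.mem_Iic, Set.mem_Icc]
    constructor
    · rintro ⟨h1, h2, -⟩; exact ⟨h2, h1⟩
    · rintro ⟨h1, h2⟩; exact ⟨h2, h1, h2.trans ht.2⟩
  rw [this, Real.volume_Icc, sub_zero]

/-- The probability integral transform. -/
theorem map_cdf_eq_uniform (ν : Measure ℝ) [IsProbabilityMeasure ν] (hc : Continuous (cdf ν)) :
    ν.map (cdf ν) = volume.restrict (Set.Icc 0 1) := by
  have : IsProbabilityMeasure (ν.map (cdf ν)) :=
    Measure.isProbabilityMeasure_map hc.measurable.aemeasurable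
  have hlt : ∀ t ∈ Set.Ioo (0 : ℝ) 1, ν.map (cdf ν) (Set.Iic t) = ENNReal.ofReal t := by
    intro t ht
    rw [Measure.map_apply hc.measurable measurableSet_Iic]
    set S := cdf ν ⁻¹' Set.Iic t with hS
    have hcl : IsClosed S := isClosed_Iic.preimage hc
    have hne : S.Nonempty := by
      obtain ⟨x, hx⟩ := ((tendsto_cdf_atBot ν).eventually (gt_mem_nhds ht.1)).exists
      exact ⟨x, le_of_lt hx⟩
    have hbd : BddAbove S := by
      obtain ⟨x, hx⟩ := ((tendsto_cdf_atTop ν).eventually (lt_mem_nhds ht.2)).exists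
      refine ⟨x, fun y hy => ?_⟩
      by_contra hxy
      exact absurd ((monotone_cdf ν (not_le.1 hxy).le).trans hy) (not_le.2 hx)
    set s := sSup S
    have hs : s ∈ S := hcl.csSup_mem hne hbd
    have hSe : S = Set.Iic s := by
      ext x
      exact ⟨fun hx => le_csSup hbd hx, fun hx => (monotone_cdf ν hx).trans hs⟩
    -- To the right of the supremum s of {F ≤ t} the values exceed t, so continuity gives F(s) ≥ t.
    have hFs : cdf ν s = t := by
      refine le_antisymm hs ?_
      have htend : Filter.Tendsto (cdf ν) (nhdsWithin s (Set.Ioi s)) (nhds (cdf ν s)) :=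
        (hc.tendsto s).mono_left nhdsWithin_le_nhds
      refine ge_of_tendsto htend ?_
      filter_upwards [self_mem_nhdsWithin] with x hx
      by_contra hxt
      have : x ∈ S := (not_le.1 hxt).le
      rw [hSe] at this
      exact absurd (Set.mem_Iic.1 this) (not_le.2 hx)
    rw [hSe, ← hFs, ofReal_cdf]
  refine eq_uniform_of_Iic fun t ht => ?_
  rcases ht.1.eq_or_lt with h0 | h0
  · subst h0
    -- The set {F ≤ 0} may be empty, so t = 0 is treated as a limit of small positive t.
    rw [ENNReal.ofReal_zero, ← nonpos_iff_eq_zero]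
    refine ENNReal.le_of_forall_pos_le_add fun ε hε _ => ?_
    have hm : min (ε : ℝ) (1 / 2) ∈ Set.Ioo (0 : ℝ) 1 :=
      ⟨lt_min (by exact_mod_cast hε) (by norm_num), (min_le_right _ _).trans_lt (by norm_num)⟩
    calc _ ≤ ν.map (cdf ν) (Set.Iic (min (ε : ℝ) (1 / 2))) :=
          measure_mono (Set.Iic_subset_Iic.2 hm.1.le)
      _ = ENNReal.ofReal (min (ε : ℝ) (1 / 2)) := hlt _ hm
      _ ≤ ENNReal.ofReal (ε : ℝ) := ENNReal.ofReal_le_ofReal (min_le_left _ _)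
      _ = 0 + ε := by rw [ENNReal.ofReal_coe_nnreal, zero_add]
  rcases ht.2.eq_or_lt with h1 | h1
  · subst h1
    rw [ENNReal.ofReal_one, Measure.map_apply hc.measurable measurableSet_Iic]
    have : cdf ν ⁻¹' Set.Iic 1 = Set.univ := Set.eq_univ_of_forall fun x => cdf_le_one ν x
    rw [this, measure_univ]
  · exact hlt t ⟨h0, h1⟩

/-- A strict inequality between values of F or G comes from one between values of X or Y. The
transform therefore cannot increase the probability of concordance or of discordance; afterwards
they sum to 1 and before to at most 1, so neither changes. -/
theorem exactRegion_subset_dsRegion : exactRegion ⊆ dsRegion := by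
  rintro p ⟨S, _, P, X, Y, _, hX, hY, hF, hG, rfl⟩
  have := Measure.isProbabilityMeasure_map (μ := P) hX.aemeasurable
  have := Measure.isProbabilityMeasure_map (μ := P) hY.aemeasurable
  set F := cdf (P.map X) with hFd
  set G := cdf (P.map Y) with hGd
  set T : S → ℝ × ℝ := fun s => (F (X s), G (Y s)) with hT
  have hTm : Measurable T := (hF.measurable.comp hX).prodMk (hG.measurable.comp hY)
  have hμ : IsDoublyStochastic (P.map T) := by
    constructor
    · rw [Measure.map_map measurable_fst hTm, ← map_cdf_eq_uniform (P.map X) hF,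
        Measure.map_map hF.measurable hX]
      rfl
    · rw [Measure.map_map measurable_snd hTm, ← map_cdf_eq_uniform (P.map Y) hG,
        Measure.map_map hG.measurable hY]
      rfl
  refine ⟨P.map T, hμ, ?_⟩
  have hprod : (P.map T).prod (P.map T) = (P.prod P).map (Prod.map T T) :=
    Measure.map_prod_map P P hTm hTm
  have hTT : Measurable (Prod.map T T) := hTm.prodMap hTm
  have hc : concordance (P.map T) ≤
      (P.prod P).real {w | 0 < (X w.1 - X w.2) * (Y w.1 - Y w.2)} := by
    rw [concordance, hprod, map_measureReal_apply hTT measurableSet_concordant]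
    refine measureReal_mono fun w hw => ?_
    simp only [Set.mem_preimage, Set.mem_ofPred, Prod.map_fst, Prod.map_snd, hT] at hw ⊢
    rcases pos_and_pos_or_neg_and_neg_of_mul_pos hw with h | h
    · exact mul_pos (sub_pos.2 ((monotone_cdf _).reflect_lt (sub_pos.1 h.1)))
        (sub_pos.2 ((monotone_cdf _).reflect_lt (sub_pos.1 h.2)))
    · exact mul_pos_of_neg_of_neg (sub_neg.2 ((monotone_cdf _).reflect_lt (sub_neg.1 h.1)))
        (sub_neg.2 ((monotone_cdf _).reflect_lt (sub_neg.1 h.2)))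
  have hd : discordance (P.map T) ≤
      (P.prod P).real {w | (X w.1 - X w.2) * (Y w.1 - Y w.2) < 0} := by
    rw [discordance, hprod, map_measureReal_apply hTT measurableSet_discordant]
    refine measureReal_mono fun w hw => ?_
    simp only [Set.mem_preimage, Set.mem_ofPred, Prod.map_fst, Prod.map_snd, hT] at hw ⊢
    rcases mul_neg_iff.1 hw with h | h
    · exact mul_neg_of_pos_of_neg (sub_pos.2 ((monotone_cdf _).reflect_lt (sub_pos.1 h.1)))
        (sub_neg.2 ((monotone_cdf _).reflect_lt (sub_neg.1 h.2)))
    · exact mul_neg_of_neg_of_pos (sub_neg.2 ((monotone_cdf _).reflect_lt (sub_neg.1 h.1)))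
        (sub_pos.2 ((monotone_cdf _).reflect_lt (sub_pos.1 h.2)))
  have hsum : (P.prod P).real {w | 0 < (X w.1 - X w.2) * (Y w.1 - Y w.2)} +
      (P.prod P).real {w | (X w.1 - X w.2) * (Y w.1 - Y w.2) < 0} ≤ 1 := by
    rw [← measureReal_union _ (measurableSet_lt (by fun_prop) (by fun_prop))]
    · exact measureReal_le_one
    · rw [Set.disjoint_left]
      intro w h1 h2
      exact lt_asymm (Set.mem_ofPred.1 h1) (Set.mem_ofPred.1 h2)
  have h1 := hμ.concordance_add_discordance
  have e : ∫ z, z.1 * z.2 ∂(P.map T) = ∫ s, F (X s) * G (Y s) ∂P := by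
    rw [integral_map hTm.aemeasurable (by fun_prop)]
  refine Prod.ext ?_ ?_
  · simp only [kendallTau]; linarith
  · simp only [spearmanRho, e]; ring

theorem cdf_uniform_eq (x : ℝ) :
    cdf (volume.restrict (Set.Icc (0 : ℝ) 1)) x = max 0 (min 1 x) := by
  have : IsProbabilityMeasure (volume.restrict (Set.Icc (0 : ℝ) 1)) := ⟨by simp⟩
  rcases lt_or_ge x 0 with hx | hx
  · rw [min_eq_right (by linarith), max_eq_left hx.le]
    refine le_antisymm ?_ (cdf_nonneg _ _)
    refine (monotone_cdf _ hx.le).trans ?_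
    rw [cdf_eq_real, measureReal_def, uniform_Iic (by simp)]
    simp
  rcases le_or_gt x 1 with hx1 | hx1
  · rw [min_eq_right hx1, max_eq_right hx, cdf_eq_real, measureReal_def, uniform_Iic ⟨hx, hx1⟩,
      ENNReal.toReal_ofReal hx]
  · rw [min_eq_left hx1.le, max_eq_right zero_le_one]
    refine le_antisymm (cdf_le_one _ _) (le_trans ?_ (monotone_cdf _ hx1.le))
    rw [cdf_eq_real, measureReal_def, uniform_Iic (by simp)]
    simp

theorem dsRegion_subset_exactRegion : dsRegion ⊆ exactRegion := by
  rintro p ⟨μ, hμ, rfl⟩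
  have hP := hμ.isProbabilityMeasure
  have hc : Continuous (cdf (volume.restrict (Set.Icc (0 : ℝ) 1))) := by
    rw [show ⇑(cdf (volume.restrict (Set.Icc (0 : ℝ) 1))) = fun x => max 0 (min 1 x) from
      funext cdf_uniform_eq]
    fun_prop
  refine ⟨ℝ × ℝ, inferInstance, μ, Prod.fst, Prod.snd, hP, measurable_fst, measurable_snd, ?_, ?_,
    ?_⟩
  · rw [hμ.fst]; exact hc
  · rw [hμ.snd]; exact hc
  · have h1 := hμ.concordance_add_discordance
    refine Prod.ext ?_ ?_
    · change 2 * concordance μ - 1 = concordance μ - discordance μ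
      linarith
    · simp only [spearmanRho, hμ.fst, hμ.snd]
      have : ∫ z, z.1 * z.2 ∂μ = ∫ z, cdf (volume.restrict (Set.Icc (0 : ℝ) 1)) z.1 *
          cdf (volume.restrict (Set.Icc (0 : ℝ) 1)) z.2 ∂μ := by
        refine integral_congr_ae ?_
        filter_upwards [hμ.ae_mem] with z hz
        rw [cdf_uniform_eq, cdf_uniform_eq, min_eq_right hz.1.2, max_eq_right hz.1.1,
          min_eq_right hz.2.2, max_eq_right hz.2.1]
      rw [this]; ring

theorem exactRegion_eq_dsRegion : exactRegion = dsRegion :=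
  exactRegion_subset_dsRegion.antisymm dsRegion_subset_exactRegion

/-! ### Copulas. -/

/-- The inclusion of the unit square into the plane. -/
def squareCoe (z : unitInterval × unitInterval) : ℝ × ℝ := (z.1, z.2)

theorem measurable_squareCoe : Measurable squareCoe := by
  unfold squareCoe; fun_prop

section Copula

variable {A : unitInterval → unitInterval → ℝ} {ν : Measure (unitInterval × unitInterval)}

theorem IsMeasureOf.isProbabilityMeasure (hA : IsCopula A) (hν : IsMeasureOf A ν) :
    IsProbabilityMeasure ν := by
  constructor
  have := hν 1 1
  have e : (Set.Icc 0 1 : Set unitInterval) = Set.univ :=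
    Set.eq_univ_of_forall fun x => ⟨x.2.1, x.2.2⟩
  rw [e, Set.univ_prod_univ, hA.left_one] at this
  simpa using this

theorem IsMeasureOf.isDoublyStochastic (hA : IsCopula A) (hν : IsMeasureOf A ν) :
    IsDoublyStochastic (ν.map squareCoe) := by
  have := hν.isProbabilityMeasure hA
  have e : (Set.Icc 0 1 : Set unitInterval) = Set.univ :=
    Set.eq_univ_of_forall fun x => ⟨x.2.1, x.2.2⟩
  have hm1 : Measurable (Prod.fst ∘ squareCoe) := measurable_fst.comp measurable_squareCoe
  have hm2 : Measurable (Prod.snd ∘ squareCoe) := measurable_snd.comp measurable_squareCoe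
  constructor
  · rw [Measure.map_map measurable_fst measurable_squareCoe]
    have := Measure.isProbabilityMeasure_map (μ := ν) hm1.aemeasurable
    refine eq_uniform_of_Iic fun t ht => ?_
    rw [Measure.map_apply hm1 measurableSet_Iic]
    have h := hν ⟨t, ht⟩ 1
    rw [hA.right_one, e] at h
    rw [← h]
    congr 1
    ext z
    exact ⟨fun hz => ⟨⟨z.1.2.1, hz⟩, Set.mem_univ _⟩, fun hz => hz.1.2⟩
  · rw [Measure.map_map measurable_snd measurable_squareCoe]
    have := Measure.isProbabilityMeasure_map (μ := ν) hm2.aemeasurable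
    refine eq_uniform_of_Iic fun t ht => ?_
    rw [Measure.map_apply hm2 measurableSet_Iic]
    have h := hν 1 ⟨t, ht⟩
    rw [hA.left_one, e] at h
    rw [← h]
    congr 1
    ext z
    exact ⟨fun hz => ⟨Set.mem_univ _, ⟨z.2.2.1, hz⟩⟩, fun hz => hz.2.2⟩

theorem IsCopula.nonneg (hA : IsCopula A) (x y : unitInterval) : 0 ≤ A x y := by
  have := hA.two_increasing 0 x 0 y x.2.1 y.2.1
  simpa [hA.left_zero, hA.right_zero] using this

/-- By Fubini the integral of A is the probability that an independent second point lies weakly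
below and to the left of the first. -/
theorem IsMeasureOf.integral_eq (hA : IsCopula A) (hν : IsMeasureOf A ν) :
    2 * ∫ z, A z.1 z.2 ∂ν = concordance (ν.map squareCoe) := by
  have := hν.isProbabilityMeasure hA
  have hd := hν.isDoublyStochastic hA
  set S : Set ((ℝ × ℝ) × (ℝ × ℝ)) := {w | w.2.1 ≤ w.1.1 ∧ w.2.2 ≤ w.1.2} with hS
  have hSm : MeasurableSet S :=
    MeasurableSet.inter (s₁ := {w : (ℝ × ℝ) × (ℝ × ℝ) | w.2.1 ≤ w.1.1})
      (s₂ := {w : (ℝ × ℝ) × (ℝ × ℝ) | w.2.2 ≤ w.1.2})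
      (measurableSet_le (by fun_prop) (by fun_prop)) (measurableSet_le (by fun_prop) (by fun_prop))
  have hpm : Measurable (Prod.map squareCoe squareCoe) :=
    measurable_squareCoe.prodMap measurable_squareCoe
  have hfib : ∀ z : unitInterval × unitInterval,
      ν (Prod.mk z ⁻¹' (Prod.map squareCoe squareCoe ⁻¹' S)) = ENNReal.ofReal (A z.1 z.2) := by
    intro z
    rw [← hν]
    congr 1
    ext y
    exact ⟨fun hy => ⟨⟨y.1.2.1, hy.1⟩, ⟨y.2.2.1, hy.2⟩⟩, fun hy => ⟨hy.1.2, hy.2.2⟩⟩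
  -- Measurability of A is inherited from the measures of the fibres that it represents.
  have hmeas : Measurable fun z : unitInterval × unitInterval => A z.1 z.2 := by
    have h1 : Measurable fun z => (ν (Prod.mk z ⁻¹' (Prod.map squareCoe squareCoe ⁻¹' S))).toReal :=
      (measurable_measure_prodMk_left (hpm hSm)).ennreal_toReal
    have e : (fun z : unitInterval × unitInterval => A z.1 z.2) =
        fun z => (ν (Prod.mk z ⁻¹' (Prod.map squareCoe squareCoe ⁻¹' S))).toReal := by
      funext z
      rw [hfib, ENNReal.toReal_ofReal (hA.nonneg _ _)]
    rw [e]; exact h1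
  rw [hd.two_mul_lower_quadrant, ← hS,
    Measure.map_prod_map ν ν measurable_squareCoe measurable_squareCoe,
    map_measureReal_apply hpm hSm, measureReal_def, Measure.prod_apply (hpm hSm)]
  simp only [hfib]
  rw [integral_eq_lintegral_of_nonneg_ae (Filter.Eventually.of_forall fun z => hA.nonneg _ _)
    hmeas.aestronglyMeasurable]

end Copula

theorem copulaRegion_subset_dsRegion : copulaRegion ⊆ dsRegion := by
  rintro p ⟨A, ν, hA, hν, rfl⟩
  refine ⟨ν.map squareCoe, hν.isDoublyStochastic hA, ?_⟩
  have h := hν.integral_eq hA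
  rw [integral_map measurable_squareCoe.aemeasurable (by fun_prop)]
  refine Prod.ext ?_ rfl
  simp only
  linarith

theorem IsDoublyStochastic.map_square {μ : Measure (ℝ × ℝ)} (hμ : IsDoublyStochastic μ) :
    (μ.map fun z => (Set.projIcc 0 1 zero_le_one z.1, Set.projIcc 0 1 zero_le_one z.2)).map
      squareCoe = μ := by
  have hm : Measurable fun z : ℝ × ℝ =>
      ((Set.projIcc 0 1 zero_le_one z.1 : unitInterval),
        (Set.projIcc 0 1 zero_le_one z.2 : unitInterval)) := by
    have := (continuous_projIcc (h := zero_le_one' ℝ)).measurable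
    fun_prop
  rw [Measure.map_map measurable_squareCoe hm]
  have : squareCoe ∘ (fun z : ℝ × ℝ => ((Set.projIcc 0 1 zero_le_one z.1 : unitInterval),
        (Set.projIcc 0 1 zero_le_one z.2 : unitInterval))) =ᵐ[μ] id := by
    filter_upwards [hμ.ae_mem] with z hz
    simp only [squareCoe, Function.comp, Set.projIcc_of_mem _ hz.1, Set.projIcc_of_mem _ hz.2, id]
  rw [Measure.map_congr this, Measure.map_id]

theorem dsRegion_subset_copulaRegion : dsRegion ⊆ copulaRegion := by
  rintro p ⟨μ, hμ, rfl⟩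
  have := hμ.isProbabilityMeasure
  set ν : Measure (unitInterval × unitInterval) :=
    μ.map fun z => (Set.projIcc 0 1 zero_le_one z.1, Set.projIcc 0 1 zero_le_one z.2)
  have hνμ : ν.map squareCoe = μ := hμ.map_square
  have hνp : IsProbabilityMeasure ν := by
    constructor
    have : μ Set.univ = 1 := measure_univ
    rw [← hνμ, Measure.map_apply measurable_squareCoe MeasurableSet.univ] at this
    exact this
  have hrect : ∀ x y : unitInterval, ν.real (Set.Icc 0 x ×ˢ Set.Icc 0 y) =
      μ.real (Set.Iic (x : ℝ) ×ˢ Set.Iic (y : ℝ)) := by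
    intro x y
    rw [← hνμ, map_measureReal_apply measurable_squareCoe
      (measurableSet_Iic.prod measurableSet_Iic)]
    congr 1
    ext z
    exact ⟨fun h => ⟨h.1.2, h.2.2⟩, fun h => ⟨⟨z.1.2.1, h.1⟩, ⟨z.2.2.1, h.2⟩⟩⟩
  have hf : ∀ t : unitInterval, μ.real (Prod.fst ⁻¹' Set.Iic (t : ℝ)) = t := fun t => by
    rw [measureReal_def, ← Measure.map_apply measurable_fst measurableSet_Iic, hμ.fst,
      uniform_Iic t.2, ENNReal.toReal_ofReal t.2.1]
  have hs : ∀ t : unitInterval, μ.real (Prod.snd ⁻¹' Set.Iic (t : ℝ)) = t := fun t => by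
    rw [measureReal_def, ← Measure.map_apply measurable_snd measurableSet_Iic, hμ.snd,
      uniform_Iic t.2, ENNReal.toReal_ofReal t.2.1]
  have hA : IsCopula fun x y => ν.real (Set.Icc 0 x ×ˢ Set.Icc 0 y) := by
    refine ⟨fun y => ?_, fun x => ?_, fun y => ?_, fun x => ?_, fun x₁ x₂ y₁ y₂ hx hy => ?_⟩
    · rw [hrect]
      refine le_antisymm ?_ measureReal_nonneg
      refine (measureReal_mono fun z hz => hz.1).trans (hf 0).le
    · rw [hrect]
      refine le_antisymm ?_ measureReal_nonneg
      refine (measureReal_mono fun z hz => hz.2).trans (hs 0).le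
    · rw [hrect]
      refine (measureReal_congr (Filter.eventuallyEq_set.2 ?_)).trans (hs y)
      filter_upwards [hμ.ae_mem] with z hz
      exact ⟨fun h => h.2, fun h => ⟨hz.1.2, h⟩⟩
    · rw [hrect]
      refine (measureReal_congr (Filter.eventuallyEq_set.2 ?_)).trans (hf x)
      filter_upwards [hμ.ae_mem] with z hz
      exact ⟨fun h => h.1, fun h => ⟨h, hz.2.2⟩⟩
    -- Two overlapping lower-left rectangles lie in the large one and meet in the small one.
    · have h1 := measureReal_union_add_inter (μ := ν) (s := Set.Icc 0 x₁ ×ˢ Set.Icc 0 y₂)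
        ((measurableSet_Icc (a := 0) (b := x₂)).prod (measurableSet_Icc (a := 0) (b := y₁)))
      have h2 : (Set.Icc 0 x₁ ×ˢ Set.Icc 0 y₂) ∩ (Set.Icc 0 x₂ ×ˢ Set.Icc 0 y₁) =
          (Set.Icc 0 x₁ ×ˢ Set.Icc 0 y₁ : Set (unitInterval × unitInterval)) := by
        rw [Set.prod_inter_prod]
        congr 1
        · exact Set.inter_eq_left.2 (Set.Icc_subset_Icc_right hx)
        · exact Set.inter_eq_right.2 (Set.Icc_subset_Icc_right hy)
      have h3 : ν.real ((Set.Icc 0 x₁ ×ˢ Set.Icc 0 y₂) ∪ (Set.Icc 0 x₂ ×ˢ Set.Icc 0 y₁)) ≤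
          ν.real (Set.Icc 0 x₂ ×ˢ Set.Icc 0 y₂) :=
        measureReal_mono (Set.union_subset
          (Set.prod_mono (Set.Icc_subset_Icc_right hx) subset_rfl)
          (Set.prod_mono subset_rfl (Set.Icc_subset_Icc_right hy)))
      rw [h2] at h1
      linarith
  have hν : IsMeasureOf (fun x y => ν.real (Set.Icc 0 x ×ˢ Set.Icc 0 y)) ν := fun x y => by
    rw [ofReal_measureReal]
  refine ⟨_, ν, hA, hν, ?_⟩
  have h := hν.integral_eq hA
  have h2 : ∫ z, z.1 * z.2 ∂μ = ∫ z : unitInterval × unitInterval, (z.1 : ℝ) * (z.2 : ℝ) ∂ν := by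
    rw [← hνμ, integral_map measurable_squareCoe.aemeasurable (by fun_prop)]
    rfl
  rw [hνμ] at h
  refine Prod.ext ?_ (by rw [h2])
  simp only
  linarith

theorem copulaRegion_eq_exactRegion : copulaRegion = exactRegion := by
  rw [exactRegion_eq_dsRegion]
  exact copulaRegion_subset_dsRegion.antisymm dsRegion_subset_copulaRegion

/-! ### Spearman's rho as a density of triples. -/

theorem measurable_realSign : Measurable Real.sign := by
  have : Real.sign = fun r => if r < 0 then -1 else if 0 < r then 1 else 0 := by
    funext r; rfl
  rw [this]
  exact Measurable.ite measurableSet_Iio measurable_const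
    (Measurable.ite measurableSet_Ioi measurable_const measurable_const)

theorem abs_realSign_le (x : ℝ) : |Real.sign x| ≤ 1 := by
  rcases Real.sign_apply_eq x with h | h | h <;> simp [h]

theorem realSign_sub_comm (x y : ℝ) : Real.sign (x - y) = -Real.sign (y - x) := by
  rw [← Real.sign_neg, neg_sub]

/-- For three distinct reals the cyclic signs are never all equal, so their sum and product are
opposite; with a tie both vanish. This is how transitivity of the order enters. -/
theorem realSign_triple (x y z : ℝ) :
    Real.sign (x - y) * Real.sign (y - z) * Real.sign (z - x) =
      -(Real.sign (x - y) + Real.sign (y - z) + Real.sign (z - x)) := by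
  rcases lt_trichotomy x y with h1 | h1 | h1
  · rcases lt_trichotomy y z with h2 | h2 | h2
    · rw [Real.sign_of_neg (sub_neg.2 h1), Real.sign_of_neg (sub_neg.2 h2),
        Real.sign_of_pos (sub_pos.2 (h1.trans h2))]; ring
    · subst h2
      rw [sub_self, Real.sign_zero, realSign_sub_comm y x]; ring
    · rw [Real.sign_of_neg (sub_neg.2 h1), Real.sign_of_pos (sub_pos.2 h2)]; ring
  · subst h1
    rw [sub_self, Real.sign_zero, realSign_sub_comm z x]; ring
  · rcases lt_trichotomy y z with h2 | h2 | h2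
    · rw [Real.sign_of_pos (sub_pos.2 h1), Real.sign_of_neg (sub_neg.2 h2)]; ring
    · subst h2
      rw [sub_self, Real.sign_zero, realSign_sub_comm y x]; ring
    · rw [Real.sign_of_pos (sub_pos.2 h1), Real.sign_of_pos (sub_pos.2 h2),
        Real.sign_of_neg (sub_neg.2 (h2.trans h1))]; ring

section Concordance

variable {V : Type*} [Fintype V]

/-- Concordance weight of two points, ties counting one half. -/
noncomputable def concWeight (x y : V → ℝ) (i j : V) : ℝ :=
  (1 + Real.sign (x i - x j) * Real.sign (y i - y j)) / 2

theorem isGraphon_concWeight {w : V → ℝ} (hw : ∀ i, 0 ≤ w i) (h1 : ∑ i, w i = 1) (x y : V → ℝ) :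
    IsGraphon w (concWeight x y) := by
  have habs : ∀ i j, |Real.sign (x i - x j) * Real.sign (y i - y j)| ≤ 1 := fun i j => by
    rw [abs_mul]
    exact mul_le_one₀ (abs_realSign_le _) (abs_nonneg _) (abs_realSign_le _)
  refine ⟨hw, h1, fun i j => ?_, fun i j => ?_, fun i j => ?_⟩
  · unfold concWeight
    rw [realSign_sub_comm (x i), realSign_sub_comm (y i)]; ring
  · have := (abs_le.1 (habs i j)).1
    unfold concWeight; linarith
  · have := (abs_le.1 (habs i j)).2
    unfold concWeight; linarith

/-- Spearman's rho as the density of triples with at least two concordant pairs. -/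
theorem majDens_concWeight {w : V → ℝ} (h1 : ∑ i, w i = 1) (x y : V → ℝ) :
    majDens w (concWeight x y) = 1 / 2 + 3 / 2 * ∑ i, w i *
      ((∑ j, w j * Real.sign (x i - x j)) * ∑ k, w k * Real.sign (y i - y k)) := by
  set s : V → V → ℝ := fun i j => Real.sign (x i - x j) with hs
  set t : V → V → ℝ := fun i j => Real.sign (y i - y j) with ht
  have hsa : ∀ i j, s i j = -s j i := fun i j => realSign_sub_comm _ _
  have hta : ∀ i j, t i j = -t j i := fun i j => realSign_sub_comm _ _
  have e0 : tripleSum w (fun _ _ _ => (1 : ℝ)) = 1 := by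
    have := tripleSum_of_pair h1 (fun _ _ => 1)
    simp only [mul_one] at this
    rw [← Finset.sum_mul_sum, h1, one_mul] at this
    exact this
  have eκ : ∑ i, w i * ((∑ j, w j * s i j) * ∑ k, w k * t i k) =
      tripleSum w (fun i j k => s i j * t i k) := by
    rw [tripleSum_eq_root]
    refine Finset.sum_congr rfl fun i _ => ?_
    rw [Finset.sum_mul_sum]
    congr 1
    refine Finset.sum_congr rfl fun j _ => Finset.sum_congr rfl fun k _ => by ring
  set κ := tripleSum w (fun i j k => s i j * t i k) with hκ
  have k1 : tripleSum w (fun i j k => s i k * t i j) = κ := by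
    rw [hκ, ← tripleSum_swap_right]
  have k2 : tripleSum w (fun i j k => s j i * t j k) = κ := by
    rw [hκ, ← tripleSum_swap_left]
  have k3 : tripleSum w (fun i j k => s j k * t j i) = κ := by
    rw [← k1, ← tripleSum_swap_left]
  have k4 : tripleSum w (fun i j k => s k j * t k i) = κ := by
    rw [hκ, ← tripleSum_swap_outer]
  have k5 : tripleSum w (fun i j k => s k i * t k j) = κ := by
    rw [← k1, ← tripleSum_swap_outer]
  have e : majDens w (concWeight x y) = tripleSum w (fun i j k =>
      1 / 2 * 1 + 1 / 4 * (s i j * t i k + s i k * t i j + s j i * t j k + s j k * t j i +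
        s k j * t k i + s k i * t k j)) := by
    unfold majDens
    congr 1
    funext i j k
    have hst : s i j * s j k * s k i = -(s i j + s j k + s k i) := realSign_triple _ _ _
    have htt : t i j * t j k * t k i = -(t i j + t j k + t k i) := realSign_triple _ _ _
    change maj3 ((1 + s i j * t i j) / 2) ((1 + s j k * t j k) / 2) ((1 + s i k * t i k) / 2) = _
    rw [hsa i k, hta i k, hsa j i, hta j i, hsa k j, hta k j]
    -- The cubic term of `maj3` factors into two cyclic sign products. Expanding the resulting
    -- product of sums, the diagonal terms cancel the linear terms of `maj3`, and only the mixed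
    -- terms s i j * t i k remain.
    have hp : (s i j * t i j) * (s j k * t j k) * (s k i * t k i) =
        (s i j + s j k + s k i) * (t i j + t j k + t k i) := by
      calc _ = (s i j * s j k * s k i) * (t i j * t j k * t k i) := by ring
        _ = _ := by rw [hst, htt]; ring
    unfold maj3
    linear_combination (-1 / 4) * hp
  rw [e]
  simp only [tripleSum_add, tripleSum_smul]
  rw [e0, k1, k2, k3, k4, k5, eκ]
  ring

end Concordance

/-! ### Grid discretisation. -/

/-- Index of the cell of the partition of `[0, 1]` into `m + 1` intervals. -/
noncomputable def cellIndex (m : ℕ) (u : ℝ) : Fin (m + 1) :=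
  -- The minimum puts u = 1 into the last cell.
  ⟨min ⌊((m : ℝ) + 1) * u⌋₊ m, Nat.lt_succ_of_le (min_le_right _ _)⟩

theorem measurable_cellIndex (m : ℕ) : Measurable (cellIndex m) := by
  have h1 : Measurable fun u : ℝ => ⌊((m : ℝ) + 1) * u⌋₊ :=
    Nat.measurable_floor.comp (measurable_const.mul measurable_id)
  have h2 : Measurable fun n : ℕ => (⟨min n m, Nat.lt_succ_of_le (min_le_right _ _)⟩ : Fin (m + 1)) :=
    Measurable.of_discrete
  exact h2.comp h1

theorem cellIndex_mono (m : ℕ) : Monotone (cellIndex m) := fun u v huv => by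
  rw [Fin.le_def]
  exact min_le_min_right _ (Nat.floor_mono (mul_le_mul_of_nonneg_left huv (by positivity)))

theorem cellIndex_bounds (m : ℕ) {u : ℝ} (hu : u ∈ Set.Icc (0 : ℝ) 1) :
    ((cellIndex m u : ℕ) : ℝ) ≤ ((m : ℝ) + 1) * u ∧
      ((m : ℝ) + 1) * u ≤ ((cellIndex m u : ℕ) : ℝ) + 1 := by
  have h0 : 0 ≤ ((m : ℝ) + 1) * u := mul_nonneg (by positivity) hu.1
  have h1 := Nat.floor_le h0
  have h2 := Nat.lt_floor_add_one (((m : ℝ) + 1) * u)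
  simp only [cellIndex]
  constructor
  · refine le_trans ?_ h1
    exact_mod_cast min_le_left _ _
  · rcases le_total ⌊((m : ℝ) + 1) * u⌋₊ m with h | h
    · rw [min_eq_left h]; exact h2.le
    · rw [min_eq_right h]
      exact mul_le_of_le_one_right (by positivity) hu.2

theorem integral_comp_finite {Ω V : Type*} [MeasurableSpace Ω] [Fintype V] [MeasurableSpace V]
    [MeasurableSingletonClass V] (μ : Measure Ω) [IsFiniteMeasure μ] {c : Ω → V}
    (hc : Measurable c) (g : V → ℝ) :
    ∫ z, g (c z) ∂μ = ∑ v, μ.real (c ⁻¹' {v}) * g v := by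
  have hg : Measurable g := measurable_of_finite g
  rw [← integral_map hc.aemeasurable hg.aestronglyMeasurable, integral_fintype Integrable.of_finite]
  refine Finset.sum_congr rfl fun v _ => ?_
  rw [map_measureReal_apply hc (measurableSet_singleton v), smul_eq_mul]

theorem realSign_cell_eq (m : ℕ) {u v : ℝ} (h : cellIndex m u ≠ cellIndex m v) :
    Real.sign (((cellIndex m u : ℕ) : ℝ) - ((cellIndex m v : ℕ) : ℝ)) = Real.sign (u - v) := by
  rcases lt_trichotomy u v with huv | huv | huv
  · have : cellIndex m u < cellIndex m v := (cellIndex_mono m huv.le).lt_of_ne h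
    rw [Real.sign_of_neg (sub_neg.2 huv), Real.sign_of_neg (sub_neg.2 (by exact_mod_cast this))]
  · exact absurd (by rw [huv]) h
  · have : cellIndex m v < cellIndex m u := (cellIndex_mono m huv.le).lt_of_ne h.symm
    rw [Real.sign_of_pos (sub_pos.2 huv), Real.sign_of_pos (sub_pos.2 (by exact_mod_cast this))]

/-- Discretisation preserves the order across cells, so only pairs in one cell contribute an error;
each cell has marginal mass at most 1/(m+1). -/
theorem abs_realSign_cell_sub_le (m : ℕ) (u v : ℝ) :
    |Real.sign (((cellIndex m u : ℕ) : ℝ) - ((cellIndex m v : ℕ) : ℝ)) - Real.sign (u - v)| ≤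
      (if cellIndex m v = cellIndex m u then 1 else 0) := by
  split_ifs with h
  · rw [h, sub_self, Real.sign_zero, zero_sub, abs_neg]
    exact abs_realSign_le _
  · rw [realSign_cell_eq m (Ne.symm h), sub_self, abs_zero]

namespace IsDoublyStochastic

variable {μ : Measure (ℝ × ℝ)}

theorem fst_cell_le (h : IsDoublyStochastic μ) (m : ℕ) (i : Fin (m + 1)) :
    μ.real {z | cellIndex m z.1 = i} ≤ 1 / ((m : ℝ) + 1) := by
  have := h.isProbabilityMeasure
  have hm : (0 : ℝ) < (m : ℝ) + 1 := by positivity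
  have hsub : μ.real {z | cellIndex m z.1 = i} ≤ μ.real (Prod.fst ⁻¹'
      Set.Icc (((i : ℕ) : ℝ) / ((m : ℝ) + 1)) ((((i : ℕ) : ℝ) + 1) / ((m : ℝ) + 1))) := by
    refine ENNReal.toReal_mono (measure_ne_top _ _) (measure_mono_ae ?_)
    filter_upwards [h.ae_mem] with z hz
    intro (hc : cellIndex m z.1 = i)
    have := cellIndex_bounds m hz.1
    rw [hc] at this
    exact ⟨by rw [div_le_iff₀ hm]; linarith, by rw [le_div_iff₀ hm]; linarith⟩
  refine hsub.trans ?_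
  rw [measureReal_def, h.fst_preimage measurableSet_Icc]
  refine (ENNReal.toReal_mono (by simp) (measure_mono Set.inter_subset_left)).trans ?_
  rw [Real.volume_Icc, ENNReal.toReal_ofReal]
  · rw [← sub_div, add_sub_cancel_left]
  · rw [← sub_div, add_sub_cancel_left]; positivity

theorem swap (h : IsDoublyStochastic μ) : IsDoublyStochastic (μ.map Prod.swap) := by
  constructor
  · rw [Measure.map_map measurable_fst measurable_swap]; exact h.snd
  · rw [Measure.map_map measurable_snd measurable_swap]; exact h.fst

theorem snd_cell_le (h : IsDoublyStochastic μ) (m : ℕ) (i : Fin (m + 1)) :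
    μ.real {z | cellIndex m z.2 = i} ≤ 1 / ((m : ℝ) + 1) := by
  have := h.swap.fst_cell_le m i
  rw [map_measureReal_apply measurable_swap] at this
  · exact this
  · exact (measurable_cellIndex m).comp measurable_fst (measurableSet_singleton i)

theorem integral_sign_fst (h : IsDoublyStochastic μ) {u : ℝ} (hu : u ∈ Set.Icc (0 : ℝ) 1) :
    ∫ z, Real.sign (u - z.1) ∂μ = 2 * u - 1 := by
  have := h.isProbabilityMeasure
  have hm : MeasurableSet (Prod.fst ⁻¹' Set.Iic u : Set (ℝ × ℝ)) := measurable_fst measurableSet_Iic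
  have e : (fun z : ℝ × ℝ => Real.sign (u - z.1)) =ᵐ[μ]
      fun z => 2 * (Prod.fst ⁻¹' Set.Iic u : Set (ℝ × ℝ)).indicator 1 z - 1 := by
    have h0 := h.fst_preimage (measurableSet_singleton u)
    rw [measure_mono_null Set.inter_subset_left Real.volume_singleton] at h0
    filter_upwards [measure_eq_zero_iff_ae_notMem.1 h0] with z hz
    have hz' : z.1 ≠ u := hz
    rcases lt_or_gt_of_ne hz' with hz | hz
    · rw [Real.sign_of_pos (sub_pos.2 hz), Set.indicator_of_mem (show z ∈ _ from hz.le)]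
      norm_num
    · rw [Real.sign_of_neg (sub_neg.2 hz), Set.indicator_of_notMem
        (show z ∉ Prod.fst ⁻¹' Set.Iic u from fun hh => not_le.2 hz hh)]
      norm_num
  rw [integral_congr_ae e, integral_sub, integral_const_mul, integral_indicator_one hm,
    measureReal_def, ← Measure.map_apply measurable_fst measurableSet_Iic, h.fst, uniform_Iic hu,
    ENNReal.toReal_ofReal hu.1]
  · simp
  · exact ((integrable_indicator_iff hm).2 (integrable_const (1 : ℝ)).integrableOn).const_mul 2
  · exact integrable_const _

theorem integral_sign_snd (h : IsDoublyStochastic μ) {u : ℝ} (hu : u ∈ Set.Icc (0 : ℝ) 1) :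
    ∫ z, Real.sign (u - z.2) ∂μ = 2 * u - 1 := by
  rw [← h.swap.integral_sign_fst hu, integral_map measurable_swap.aemeasurable
    (Measurable.aestronglyMeasurable (f := fun z : ℝ × ℝ => Real.sign (u - z.1))
      (measurable_realSign.comp (by fun_prop)))]
  rfl

end IsDoublyStochastic

theorem abs_mul_sub_mul_le {a b a' b' α β : ℝ} (hb : |b| ≤ 1) (ha' : |a'| ≤ 1) (h1 : |a - a'| ≤ α)
    (h2 : |b - b'| ≤ β) : |a * b - a' * b'| ≤ α + β := by
  calc |a * b - a' * b'| = |(a - a') * b + a' * (b - b')| := by ring_nf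
    _ ≤ |(a - a') * b| + |a' * (b - b')| := abs_add_le _ _
    _ ≤ α + β := by
      rw [abs_mul, abs_mul]
      have := mul_le_of_le_one_right (abs_nonneg (a - a')) hb
      have := mul_le_of_le_one_left (abs_nonneg (b - b')) ha'
      linarith

theorem abs_integral_sub_le {Ω : Type*} [MeasurableSpace Ω] {μ : Measure Ω}
    [IsProbabilityMeasure μ] {f g : Ω → ℝ} (hf : Integrable f μ) (hg : Integrable g μ) {c : ℝ}
    (h : ∀ᵐ z ∂μ, |f z - g z| ≤ c) : |∫ z, f z ∂μ - ∫ z, g z ∂μ| ≤ c := by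
  rw [← integral_sub hf hg]
  simpa using norm_integral_le_of_norm_le_const (μ := μ) (f := fun z => f z - g z) h

theorem integrable_of_abs_le {Ω : Type*} [MeasurableSpace Ω] {μ : Measure Ω}
    [IsFiniteMeasure μ] {f : Ω → ℝ} (hf : Measurable f) {c : ℝ} (h : ∀ z, |f z| ≤ c) :
    Integrable f μ :=
  Integrable.of_bound hf.aestronglyMeasurable c (Filter.Eventually.of_forall h)

/-- Product of the signs of the coordinate differences. -/
noncomputable def signKernel (z z' : ℝ × ℝ) : ℝ :=
  Real.sign (z.1 - z'.1) * Real.sign (z.2 - z'.2)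

theorem abs_signKernel_le (z z' : ℝ × ℝ) : |signKernel z z'| ≤ 1 := by
  rw [signKernel, abs_mul]
  exact mul_le_one₀ (abs_realSign_le _) (abs_nonneg _) (abs_realSign_le _)

theorem measurable_signKernel : Measurable fun w : (ℝ × ℝ) × (ℝ × ℝ) => signKernel w.1 w.2 :=
  (measurable_realSign.comp (by fun_prop)).mul (measurable_realSign.comp (by fun_prop))

theorem measurable_signKernel_right (z : ℝ × ℝ) : Measurable (signKernel z) :=
  measurable_signKernel.comp measurable_prodMk_left

/-- Representative of the grid cell of a point. -/
noncomputable def gridPoint (m : ℕ) (z : ℝ × ℝ) : ℝ × ℝ :=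
  (((cellIndex m z.1 : ℕ) : ℝ), ((cellIndex m z.2 : ℕ) : ℝ))

theorem measurable_gridPoint (m : ℕ) : Measurable (gridPoint m) := by
  have h : Measurable fun i : Fin (m + 1) => ((i : ℕ) : ℝ) := measurable_of_finite _
  exact (h.comp ((measurable_cellIndex m).comp measurable_fst)).prodMk
    (h.comp ((measurable_cellIndex m).comp measurable_snd))

namespace IsDoublyStochastic

variable {μ : Measure (ℝ × ℝ)}

theorem integral_signKernel (h : IsDoublyStochastic μ) :
    ∫ z, ∫ z', signKernel z z' ∂μ ∂μ = 2 * concordance μ - 1 := by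
  have := h.isProbabilityMeasure
  have hsum_int : Integrable (fun w : (ℝ × ℝ) × (ℝ × ℝ) => signKernel w.1 w.2) (μ.prod μ) :=
    integrable_of_abs_le measurable_signKernel fun w => abs_signKernel_le _ _
  have e0 := integral_prod (fun w : (ℝ × ℝ) × (ℝ × ℝ) => signKernel w.1 w.2) hsum_int
  simp only at e0
  rw [← e0]
  have e : (fun w : (ℝ × ℝ) × (ℝ × ℝ) => signKernel w.1 w.2) = fun w =>
      ({w | 0 < (w.1.1 - w.2.1) * (w.1.2 - w.2.2)} : Set ((ℝ × ℝ) × (ℝ × ℝ))).indicator 1 w -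
      ({w | (w.1.1 - w.2.1) * (w.1.2 - w.2.2) < 0} : Set ((ℝ × ℝ) × (ℝ × ℝ))).indicator 1 w := by
    funext w
    simp only [signKernel, Set.indicator_apply, Set.mem_ofPred]
    rcases lt_trichotomy (w.1.1 - w.2.1) 0 with h1 | h1 | h1 <;>
    rcases lt_trichotomy (w.1.2 - w.2.2) 0 with h2 | h2 | h2
    · have := mul_pos_of_neg_of_neg h1 h2
      simp [Real.sign_of_neg h1, Real.sign_of_neg h2, this, not_lt.2 this.le]
    · simp [h2]
    · have := mul_neg_of_neg_of_pos h1 h2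
      simp [Real.sign_of_neg h1, Real.sign_of_pos h2, this, not_lt.2 this.le]
    · simp [h1]
    · simp [h1]
    · simp [h1]
    · have := mul_neg_of_pos_of_neg h1 h2
      simp [Real.sign_of_pos h1, Real.sign_of_neg h2, this, not_lt.2 this.le]
    · simp [h2]
    · have := mul_pos h1 h2
      simp [Real.sign_of_pos h1, Real.sign_of_pos h2, this, not_lt.2 this.le]
  have i1 : Integrable (({w | 0 < (w.1.1 - w.2.1) * (w.1.2 - w.2.2)} :
      Set ((ℝ × ℝ) × (ℝ × ℝ))).indicator (1 : (ℝ × ℝ) × (ℝ × ℝ) → ℝ)) (μ.prod μ) :=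
    (integrable_indicator_iff measurableSet_concordant).2 (integrable_const (1 : ℝ)).integrableOn
  have i2 : Integrable (({w | (w.1.1 - w.2.1) * (w.1.2 - w.2.2) < 0} :
      Set ((ℝ × ℝ) × (ℝ × ℝ))).indicator (1 : (ℝ × ℝ) × (ℝ × ℝ) → ℝ)) (μ.prod μ) :=
    (integrable_indicator_iff measurableSet_discordant).2 (integrable_const (1 : ℝ)).integrableOn
  rw [e, integral_sub i1 i2, integral_indicator_one measurableSet_concordant,
    integral_indicator_one measurableSet_discordant]
  have := h.concordance_add_discordance
  unfold concordance discordance at *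
  linarith

theorem integral_fst (h : IsDoublyStochastic μ) : ∫ z, z.1 ∂μ = 1 / 2 := by
  have e : ∫ z, z.1 ∂μ = ∫ x, x ∂(μ.map Prod.fst) := by
    rw [integral_map measurable_fst.aemeasurable (by fun_prop)]
  rw [e, h.fst, integral_Icc_eq_integral_Ioc, ← intervalIntegral.integral_of_le zero_le_one,
    integral_id]
  norm_num

theorem integral_snd (h : IsDoublyStochastic μ) : ∫ z, z.2 ∂μ = 1 / 2 := by
  rw [← h.swap.integral_fst, integral_map measurable_swap.aemeasurable (by fun_prop)]
  rfl

theorem integrable_of_continuous (h : IsDoublyStochastic μ) {f : ℝ × ℝ → ℝ} (hf : Continuous f) :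
    Integrable f μ := by
  have := h.isProbabilityMeasure
  obtain ⟨c, hc⟩ := (isCompact_Icc (a := (0 : ℝ)) (b := 1)).prod (isCompact_Icc (a := (0 : ℝ))
    (b := 1)) |>.exists_bound_of_continuousOn hf.continuousOn
  refine Integrable.of_bound hf.aestronglyMeasurable c ?_
  filter_upwards [h.ae_mem] with z hz
  exact hc z hz

theorem integral_centered (h : IsDoublyStochastic μ) :
    ∫ z, (2 * z.1 - 1) * (2 * z.2 - 1) ∂μ = 4 * (∫ z, z.1 * z.2 ∂μ) - 1 := by
  have := h.isProbabilityMeasure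
  have e : (fun z : ℝ × ℝ => (2 * z.1 - 1) * (2 * z.2 - 1)) =
      fun z => 4 * (z.1 * z.2) - (2 * z.1 + 2 * z.2 - 1) := by funext z; ring
  rw [e, integral_sub, integral_sub, integral_add, integral_const_mul, integral_const_mul,
    integral_const_mul, h.integral_fst, h.integral_snd]
  · simp
  all_goals exact h.integrable_of_continuous (by fun_prop)

theorem integrable_sameCell (h : IsDoublyStochastic μ) (m : ℕ) (i : Fin (m + 1)) :
    Integrable (fun z : ℝ × ℝ => if cellIndex m z.1 = i then (1 : ℝ) else 0) μ ∧
    Integrable (fun z : ℝ × ℝ => if cellIndex m z.2 = i then (1 : ℝ) else 0) μ := by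
  have := h.isProbabilityMeasure
  have hg : Measurable fun j : Fin (m + 1) => if j = i then (1 : ℝ) else 0 := measurable_of_finite _
  constructor
  · refine integrable_of_abs_le (c := 1) (hg.comp ((measurable_cellIndex m).comp measurable_fst))
      fun z => ?_
    split_ifs <;> simp
  · refine integrable_of_abs_le (c := 1) (hg.comp ((measurable_cellIndex m).comp measurable_snd))
      fun z => ?_
    split_ifs <;> simp

theorem integral_sameCell_le (h : IsDoublyStochastic μ) (m : ℕ) (i : Fin (m + 1)) :
    ∫ z, (if cellIndex m z.1 = i then (1 : ℝ) else 0) ∂μ ≤ 1 / ((m : ℝ) + 1) ∧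
    ∫ z, (if cellIndex m z.2 = i then (1 : ℝ) else 0) ∂μ ≤ 1 / ((m : ℝ) + 1) := by
  have := h.isProbabilityMeasure
  constructor
  · refine le_of_eq_of_le ?_ (h.fst_cell_le m i)
    have hm : MeasurableSet {z : ℝ × ℝ | cellIndex m z.1 = i} :=
      (measurable_cellIndex m).comp measurable_fst (measurableSet_singleton i)
    rw [← integral_indicator_one hm]
    refine integral_congr_ae (Filter.Eventually.of_forall fun z => ?_)
    simp [Set.indicator_apply]
  · refine le_of_eq_of_le ?_ (h.snd_cell_le m i)
    have hm : MeasurableSet {z : ℝ × ℝ | cellIndex m z.2 = i} :=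
      (measurable_cellIndex m).comp measurable_snd (measurableSet_singleton i)
    rw [← integral_indicator_one hm]
    refine integral_congr_ae (Filter.Eventually.of_forall fun z => ?_)
    simp [Set.indicator_apply]

theorem integrable_sign (h : IsDoublyStochastic μ) {c : ℝ × ℝ → ℝ × ℝ} (hc : Measurable c)
    (u : ℝ) : Integrable (fun z => Real.sign (u - (c z).1)) μ ∧
      Integrable (fun z => Real.sign (u - (c z).2)) μ := by
  have := h.isProbabilityMeasure
  exact ⟨integrable_of_abs_le (measurable_realSign.comp (by fun_prop)) fun z => abs_realSign_le _,
    integrable_of_abs_le (measurable_realSign.comp (by fun_prop)) fun z => abs_realSign_le _⟩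

theorem abs_integral_sign_grid_sub_le (h : IsDoublyStochastic μ) (m : ℕ) (z : ℝ × ℝ) :
    |∫ z', Real.sign ((gridPoint m z).1 - (gridPoint m z').1) ∂μ -
      ∫ z', Real.sign (z.1 - z'.1) ∂μ| ≤ 1 / ((m : ℝ) + 1) ∧
    |∫ z', Real.sign ((gridPoint m z).2 - (gridPoint m z').2) ∂μ -
      ∫ z', Real.sign (z.2 - z'.2) ∂μ| ≤ 1 / ((m : ℝ) + 1) := by
  have := h.isProbabilityMeasure
  have hg := measurable_gridPoint m
  constructor
  · have i2 : Integrable (fun z' : ℝ × ℝ => Real.sign (z.1 - z'.1)) μ :=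
      (h.integrable_sign measurable_id _).1
    rw [← integral_sub (h.integrable_sign hg _).1 i2]
    refine (abs_integral_le_integral_abs).trans (le_trans ?_
      (h.integral_sameCell_le m (cellIndex m z.1)).1)
    refine integral_mono_of_nonneg (Filter.Eventually.of_forall fun _ => abs_nonneg _)
      (h.integrable_sameCell m _).1 (Filter.Eventually.of_forall fun z' => ?_)
    exact abs_realSign_cell_sub_le m z.1 z'.1
  · have i2 : Integrable (fun z' : ℝ × ℝ => Real.sign (z.2 - z'.2)) μ :=
      (h.integrable_sign measurable_id _).2
    rw [← integral_sub (h.integrable_sign hg _).2 i2]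
    refine (abs_integral_le_integral_abs).trans (le_trans ?_
      (h.integral_sameCell_le m (cellIndex m z.2)).2)
    refine integral_mono_of_nonneg (Filter.Eventually.of_forall fun _ => abs_nonneg _)
      (h.integrable_sameCell m _).2 (Filter.Eventually.of_forall fun z' => ?_)
    exact abs_realSign_cell_sub_le m z.2 z'.2

theorem abs_integral_signKernel_grid_sub_le (h : IsDoublyStochastic μ) (m : ℕ) (z : ℝ × ℝ) :
    |∫ z', signKernel (gridPoint m z) (gridPoint m z') ∂μ - ∫ z', signKernel z z' ∂μ| ≤
      2 / ((m : ℝ) + 1) := by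
  have := h.isProbabilityMeasure
  have hg := measurable_gridPoint m
  have i1 : Integrable (fun z' => signKernel (gridPoint m z) (gridPoint m z')) μ :=
    integrable_of_abs_le ((measurable_signKernel_right _).comp hg) fun _ => abs_signKernel_le _ _
  have i2 : Integrable (fun z' => signKernel z z') μ :=
    integrable_of_abs_le (measurable_signKernel_right _) fun _ => abs_signKernel_le _ _
  rw [← integral_sub i1 i2]
  have hsum := (h.integrable_sameCell m (cellIndex m z.1)).1.add
    (h.integrable_sameCell m (cellIndex m z.2)).2
  refine (abs_integral_le_integral_abs).trans ((integral_mono_of_nonneg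
    (Filter.Eventually.of_forall fun _ => abs_nonneg _) hsum
    (Filter.Eventually.of_forall fun z' => ?_)).trans ?_)
  · exact abs_mul_sub_mul_le (abs_realSign_le _) (abs_realSign_le _)
      (abs_realSign_cell_sub_le m z.1 z'.1) (abs_realSign_cell_sub_le m z.2 z'.2)
  · have e := integral_add (h.integrable_sameCell m (cellIndex m z.1)).1
      (h.integrable_sameCell m (cellIndex m z.2)).2
    have h1 := (h.integral_sameCell_le m (cellIndex m z.1)).1
    have h2 := (h.integral_sameCell_le m (cellIndex m z.2)).2
    simp only [Pi.add_apply]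
    rw [e]
    have e2 : 2 / ((m : ℝ) + 1) = 1 / ((m : ℝ) + 1) + 1 / ((m : ℝ) + 1) := by ring
    linarith

/-- The grid approximation of a doubly stochastic measure. -/
theorem exists_graphon_approx (h : IsDoublyStochastic μ) (m : ℕ) :
    ∃ d F : ℝ, d ∈ Set.Icc (0 : ℝ) 1 ∧ cliqueBound d ≤ F ∧
      |d - concordance μ| ≤ 1 / ((m : ℝ) + 1) ∧
      |F - (6 * (∫ z, z.1 * z.2 ∂μ) - 1)| ≤ 3 / ((m : ℝ) + 1) := by
  have := h.isProbabilityMeasure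
  set c : ℝ × ℝ → Fin (m + 1) × Fin (m + 1) := fun z => (cellIndex m z.1, cellIndex m z.2) with hc
  have hcm : Measurable c := ((measurable_cellIndex m).comp measurable_fst).prodMk
    ((measurable_cellIndex m).comp measurable_snd)
  set w : Fin (m + 1) × Fin (m + 1) → ℝ := fun v => μ.real (c ⁻¹' {v}) with hw
  set x : Fin (m + 1) × Fin (m + 1) → ℝ := fun v => ((v.1 : ℕ) : ℝ) with hx
  set y : Fin (m + 1) × Fin (m + 1) → ℝ := fun v => ((v.2 : ℕ) : ℝ) with hy
  have hsum_int : ∀ g : Fin (m + 1) × Fin (m + 1) → ℝ, ∑ v, w v * g v = ∫ z, g (c z) ∂μ :=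
    fun g => (integral_comp_finite μ hcm g).symm
  have hw1 : ∑ v, w v = 1 := by
    have := hsum_int (fun _ => 1)
    simpa using this
  have hg := isGraphon_concWeight (fun v => measureReal_nonneg) hw1 x y
  have hgrid := measurable_gridPoint m
  refine ⟨edgeDens w (concWeight x y), majDens w (concWeight x y),
    ⟨hg.edgeDens_nonneg, hg.edgeDens_le_one⟩, hg.cliqueBound_le, ?_, ?_⟩
  · have e : edgeDens w (concWeight x y) =
        1 / 2 + 1 / 2 * ∫ z, ∫ z', signKernel (gridPoint m z) (gridPoint m z') ∂μ ∂μ := by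
      have e1 : ∀ i, wdeg w (concWeight x y) i = 1 / 2 + 1 / 2 *
          ∫ z', Real.sign (x i - x (c z')) * Real.sign (y i - y (c z')) ∂μ := by
        intro i
        rw [← hsum_int (fun v => Real.sign (x i - x v) * Real.sign (y i - y v)), wdeg]
        trans 1 / 2 * ∑ v, w v + 1 / 2 * ∑ v, w v * (Real.sign (x i - x v) * Real.sign (y i - y v))
        swap
        · rw [hw1, mul_one]
        rw [Finset.mul_sum, Finset.mul_sum, ← Finset.sum_add_distrib]
        refine Finset.sum_congr rfl fun v _ => ?_
        unfold concWeight; ring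
      rw [edgeDens_eq_wdeg]
      simp only [e1, mul_add, Finset.sum_add_distrib, ← Finset.sum_mul, hw1, one_mul]
      congr 1
      have := hsum_int (fun i => ∫ z', Real.sign (x i - x (c z')) * Real.sign (y i - y (c z')) ∂μ)
      have e2 : ∫ z, ∫ z', signKernel (gridPoint m z) (gridPoint m z') ∂μ ∂μ =
        ∫ z, ∫ z', Real.sign (x (c z) - x (c z')) * Real.sign (y (c z) - y (c z')) ∂μ ∂μ := rfl
      rw [e2, ← this, Finset.mul_sum]
      refine Finset.sum_congr rfl fun v _ => by ring
    have hk := h.integral_signKernel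
    have hK : Measurable fun w : (ℝ × ℝ) × (ℝ × ℝ) =>
        signKernel (gridPoint m w.1) (gridPoint m w.2) :=
      measurable_signKernel.comp (hgrid.prodMap hgrid)
    have hb := abs_integral_sub_le
      ((integrable_of_abs_le (μ := μ.prod μ) hK fun _ => abs_signKernel_le _ _).integral_prod_left)
      ((integrable_of_abs_le (μ := μ.prod μ) measurable_signKernel fun _ =>
        abs_signKernel_le _ _).integral_prod_left)
      (Filter.Eventually.of_forall fun z => h.abs_integral_signKernel_grid_sub_le m z)
    rw [hk] at hb
    rw [e]
    -- The kernel error is 2/(m+1), one cell for each coordinate; the edge density carries half of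
    -- it.
    have e2 : 2 / ((m : ℝ) + 1) = 2 * (1 / ((m : ℝ) + 1)) := by ring
    rw [e2] at hb
    rw [abs_le] at hb ⊢
    constructor <;> linarith [hb.1, hb.2]
  · rw [majDens_concWeight hw1]
    set S : Fin (m + 1) × Fin (m + 1) → ℝ := fun i => ∑ j, w j * Real.sign (x i - x j) with hS
    set T : Fin (m + 1) × Fin (m + 1) → ℝ := fun i => ∑ j, w j * Real.sign (y i - y j) with hT
    have eS : ∀ z, S (c z) = ∫ z', Real.sign ((gridPoint m z).1 - (gridPoint m z').1) ∂μ :=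
      fun z => hsum_int (fun v => Real.sign (x (c z) - x v))
    have eT : ∀ z, T (c z) = ∫ z', Real.sign ((gridPoint m z).2 - (gridPoint m z').2) ∂μ :=
      fun z => hsum_int (fun v => Real.sign (y (c z) - y v))
    have hT1 : ∀ v, |T v| ≤ 1 := fun v => by
      calc |T v| ≤ ∑ j, |w j * Real.sign (y v - y j)| := Finset.abs_sum_le_sum_abs _ _
        _ ≤ ∑ j, w j := Finset.sum_le_sum fun j _ => by
            rw [abs_mul, abs_of_nonneg (measureReal_nonneg : 0 ≤ w j)]
            exact mul_le_of_le_one_right measureReal_nonneg (abs_realSign_le _)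
        _ = 1 := hw1
    have e : ∑ i, w i * (S i * T i) = ∫ z, S (c z) * T (c z) ∂μ := hsum_int (fun v => S v * T v)
    rw [e]
    -- For the limiting measure the sign averages are 2x - 1 and 2y - 1. Each factor errs by at most
    -- 1/(m+1), and the coefficient 3/2 turns the total 2/(m+1) into 3/(m+1).
    have hb : |∫ z, S (c z) * T (c z) ∂μ - ∫ z, (2 * z.1 - 1) * (2 * z.2 - 1) ∂μ| ≤
        1 / ((m : ℝ) + 1) + 1 / ((m : ℝ) + 1) := by
      refine abs_integral_sub_le ?_ (h.integrable_of_continuous (by fun_prop)) ?_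
      · have hST : Measurable fun v => S v * T v := measurable_of_finite _
        obtain ⟨b, hb⟩ := Finite.exists_le (fun v => |S v * T v|)
        exact integrable_of_abs_le (hST.comp hcm) fun z => hb (c z)
      · filter_upwards [h.ae_mem] with z hz
        have b := h.abs_integral_sign_grid_sub_le m z
        rw [← eS, ← eT, h.integral_sign_fst hz.1, h.integral_sign_snd hz.2] at b
        refine abs_mul_sub_mul_le (hT1 _) ?_ b.1 b.2
        rw [abs_le]
        constructor <;> linarith [hz.1.1, hz.1.2]
    rw [h.integral_centered] at hb
    have e3 : 3 / ((m : ℝ) + 1) = 3 * (1 / ((m : ℝ) + 1)) := by ring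
    rw [e3]
    rw [abs_le] at hb ⊢
    constructor <;> linarith [hb.1, hb.2]

/-- The sharp lower bound of Spearman's rho in terms of Kendall's tau. -/
theorem cliqueBound_le (h : IsDoublyStochastic μ) :
    cliqueBound (concordance μ) ≤ 6 * (∫ z, z.1 * z.2 ∂μ) - 1 := by
  have := h.isProbabilityMeasure
  choose d F hd hle h1 h2 using h.exists_graphon_approx
  have h0 : Filter.Tendsto (fun m : ℕ => 1 / ((m : ℝ) + 1)) Filter.atTop (nhds 0) :=
    tendsto_one_div_add_atTop_nhds_zero_nat
  have h3 : Filter.Tendsto (fun m : ℕ => 3 / ((m : ℝ) + 1)) Filter.atTop (nhds 0) := by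
    have := h0.const_mul 3
    simp only [mul_zero] at this
    refine this.congr fun m => by ring
  have td : Filter.Tendsto d Filter.atTop (nhds (concordance μ)) :=
    tendsto_iff_dist_tendsto_zero.2 (squeeze_zero (fun _ => dist_nonneg) h1 h0)
  have tF : Filter.Tendsto F Filter.atTop (nhds (6 * (∫ z, z.1 * z.2 ∂μ) - 1)) :=
    tendsto_iff_dist_tendsto_zero.2 (squeeze_zero (fun _ => dist_nonneg) h2 h3)
  have hc : concordance μ ∈ Set.Icc (0 : ℝ) 1 := ⟨measureReal_nonneg, measureReal_le_one⟩
  have tc : Filter.Tendsto (fun m => cliqueBound (d m)) Filter.atTop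
      (nhds (cliqueBound (concordance μ))) :=
    (continuousOn_cliqueBound _ hc).tendsto.comp
      (tendsto_nhdsWithin_iff.2 ⟨td, Filter.Eventually.of_forall hd⟩)
  exact le_of_tendsto_of_tendsto' tc tF hle

end IsDoublyStochastic

/-! ### Constructions: reflection and skew sums. -/

theorem isProbabilityMeasure_uniform :
    IsProbabilityMeasure (volume.restrict (Set.Icc (0 : ℝ) 1)) := ⟨by simp⟩

theorem uniform_Iic_eq (x : ℝ) :
    (volume.restrict (Set.Icc (0 : ℝ) 1)) (Set.Iic x) = ENNReal.ofReal (max 0 (min 1 x)) := by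
  have := isProbabilityMeasure_uniform
  rw [← cdf_uniform_eq, ofReal_cdf]

theorem map_one_sub_uniform :
    (volume.restrict (Set.Icc (0 : ℝ) 1)).map (fun x => 1 - x) =
      volume.restrict (Set.Icc (0 : ℝ) 1) := by
  have := isProbabilityMeasure_uniform
  have hm : Measurable fun x : ℝ => 1 - x := by fun_prop
  have := Measure.isProbabilityMeasure_map (μ := volume.restrict (Set.Icc (0 : ℝ) 1)) hm.aemeasurable
  refine eq_uniform_of_Iic fun t ht => ?_
  rw [Measure.map_apply hm measurableSet_Iic, Measure.restrict_apply (hm measurableSet_Iic)]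
  have : (fun x : ℝ => 1 - x) ⁻¹' Set.Iic t ∩ Set.Icc 0 1 = Set.Icc (1 - t) 1 := by
    ext x
    simp only [Set.mem_inter_iff, Set.mem_preimage, Set.mem_Iic, Set.mem_Icc]
    constructor
    · rintro ⟨h1, h2, h3⟩; exact ⟨by linarith, h3⟩
    · rintro ⟨h1, h2⟩; exact ⟨by linarith, by linarith [ht.2], h2⟩
  rw [this, Real.volume_Icc, sub_sub_cancel]

theorem uniform_mixture {m : ℝ} (h0 : 0 < m) (h1 : m < 1) :
    ENNReal.ofReal m • (volume.restrict (Set.Icc (0 : ℝ) 1)).map (fun x => m * x) +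
      ENNReal.ofReal (1 - m) • (volume.restrict (Set.Icc (0 : ℝ) 1)).map
        (fun x => m + (1 - m) * x) = volume.restrict (Set.Icc (0 : ℝ) 1) := by
  have := isProbabilityMeasure_uniform
  have hm1 : Measurable fun x : ℝ => m * x := by fun_prop
  have hm2 : Measurable fun x : ℝ => m + (1 - m) * x := by fun_prop
  have p1 := Measure.isProbabilityMeasure_map (μ := volume.restrict (Set.Icc (0 : ℝ) 1))
    hm1.aemeasurable
  have p2 := Measure.isProbabilityMeasure_map (μ := volume.restrict (Set.Icc (0 : ℝ) 1))
    hm2.aemeasurable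
  have h1' : 0 < 1 - m := by linarith
  have : IsProbabilityMeasure (ENNReal.ofReal m • (volume.restrict (Set.Icc (0 : ℝ) 1)).map
      (fun x => m * x) + ENNReal.ofReal (1 - m) • (volume.restrict (Set.Icc (0 : ℝ) 1)).map
        (fun x => m + (1 - m) * x)) := by
    constructor
    simp only [Measure.add_apply, Measure.smul_apply, measure_univ, smul_eq_mul, mul_one]
    rw [← ENNReal.ofReal_add h0.le h1'.le]
    simp
  refine eq_uniform_of_Iic fun t ht => ?_
  simp only [Measure.add_apply, Measure.smul_apply, smul_eq_mul]
  rw [Measure.map_apply hm1 measurableSet_Iic, Measure.map_apply hm2 measurableSet_Iic]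
  have e1 : (fun x : ℝ => m * x) ⁻¹' Set.Iic t = Set.Iic (t / m) := by
    ext x; simp only [Set.mem_preimage, Set.mem_Iic]
    rw [le_div_iff₀ h0, mul_comm]
  have e2 : (fun x : ℝ => m + (1 - m) * x) ⁻¹' Set.Iic t = Set.Iic ((t - m) / (1 - m)) := by
    ext x; simp only [Set.mem_preimage, Set.mem_Iic]
    rw [le_div_iff₀ h1']
    constructor <;> intro h <;> linarith
  rw [e1, e2, uniform_Iic_eq, uniform_Iic_eq, ← ENNReal.ofReal_mul h0.le,
    ← ENNReal.ofReal_mul h1'.le, ← ENNReal.ofReal_add (by positivity)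
    (mul_nonneg h1'.le (le_max_left _ _))]
  congr 1
  have ht' : 0 ≤ t / m := div_nonneg ht.1 h0.le
  rcases le_total t m with h | h
  · have a1 : t / m ≤ 1 := (div_le_one h0).2 h
    have a2 : (t - m) / (1 - m) ≤ 0 := div_nonpos_of_nonpos_of_nonneg (by linarith) h1'.le
    rw [min_eq_right a1, max_eq_right ht', min_eq_right (by linarith), max_eq_left a2]
    field_simp; ring
  · have a1 : 1 ≤ t / m := (one_le_div h0).2 h
    have a2 : 0 ≤ (t - m) / (1 - m) := div_nonneg (by linarith) h1'.le
    have a3 : (t - m) / (1 - m) ≤ 1 := (div_le_one h1').2 (by linarith [ht.2])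
    rw [min_eq_left a1, max_eq_right zero_le_one, min_eq_right a3, max_eq_right a2]
    field_simp; ring

/-- `(d, F)` are the density of concordant pairs, and of triples with at least two concordant
pairs, of some doubly stochastic measure. -/
def Achievable (d F : ℝ) : Prop :=
  ∃ μ : Measure (ℝ × ℝ), IsDoublyStochastic μ ∧ concordance μ = d ∧
    6 * (∫ z, z.1 * z.2 ∂μ) - 1 = F

theorem achievable_one : Achievable 1 1 := by
  have := isProbabilityMeasure_uniform
  have hm : Measurable fun x : ℝ => (x, x) := by fun_prop
  have hds : IsDoublyStochastic ((volume.restrict (Set.Icc (0 : ℝ) 1)).map fun x => (x, x)) := by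
    constructor
    · rw [Measure.map_map measurable_fst hm]; exact Measure.map_id
    · rw [Measure.map_map measurable_snd hm]; exact Measure.map_id
  refine ⟨_, hds, ?_, ?_⟩
  · have h := hds.concordance_add_discordance
    have hd : discordance ((volume.restrict (Set.Icc (0 : ℝ) 1)).map fun x => (x, x)) = 0 := by
      rw [discordance, Measure.map_prod_map _ _ hm hm,
        map_measureReal_apply (hm.prodMap hm) measurableSet_discordant]
      have : Prod.map (fun x : ℝ => (x, x)) (fun x : ℝ => (x, x)) ⁻¹'
          {w | (w.1.1 - w.2.1) * (w.1.2 - w.2.2) < 0} = ∅ := by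
        ext w
        simp only [Set.mem_preimage, Set.mem_ofPred, Prod.map_fst, Prod.map_snd,
          Set.mem_empty_iff_false, iff_false, not_lt]
        exact mul_self_nonneg _
      rw [this, measureReal_empty]
    linarith
  · rw [integral_map hm.aemeasurable (by fun_prop)]
    rw [integral_Icc_eq_integral_Ioc, ← intervalIntegral.integral_of_le zero_le_one]
    have : ∀ x : ℝ, x * x = x ^ 2 := fun x => (sq x).symm
    simp only [this, integral_pow]
    norm_num

/-- Reflecting the second coordinate exchanges concordant and discordant pairs, and at least two of
three pairs are concordant exactly when at most one is discordant. -/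
theorem Achievable.compl {d F : ℝ} (h : Achievable d F) : Achievable (1 - d) (1 - F) := by
  obtain ⟨μ, hμ, rfl, rfl⟩ := h
  have := hμ.isProbabilityMeasure
  have hm : Measurable fun z : ℝ × ℝ => (z.1, 1 - z.2) := by fun_prop
  have hds : IsDoublyStochastic (μ.map fun z => (z.1, 1 - z.2)) := by
    constructor
    · rw [Measure.map_map measurable_fst hm]; exact hμ.fst
    · rw [Measure.map_map measurable_snd hm, ← map_one_sub_uniform, ← hμ.snd,
        Measure.map_map (by fun_prop) measurable_snd]
      rfl
  refine ⟨_, hds, ?_, ?_⟩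
  · have h := hμ.concordance_add_discordance
    rw [concordance, Measure.map_prod_map _ _ hm hm,
        map_measureReal_apply (hm.prodMap hm) measurableSet_concordant]
    have : Prod.map (fun z : ℝ × ℝ => (z.1, 1 - z.2)) (fun z : ℝ × ℝ => (z.1, 1 - z.2)) ⁻¹'
          {w | 0 < (w.1.1 - w.2.1) * (w.1.2 - w.2.2)} =
          {w | (w.1.1 - w.2.1) * (w.1.2 - w.2.2) < 0} := by
      ext w
      simp only [Set.mem_preimage, Set.mem_ofPred, Prod.map_fst, Prod.map_snd]
      constructor <;> intro h <;> linarith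
    rw [this]
    change discordance μ = _
    linarith
  · rw [integral_map hm.aemeasurable (by fun_prop)]
    have e : (fun z : ℝ × ℝ => z.1 * (1 - z.2)) = fun z => z.1 - z.1 * z.2 := by funext z; ring
    simp only [e]
    rw [integral_sub (hμ.integrable_of_continuous (by fun_prop))
      (hμ.integrable_of_continuous (by fun_prop)), hμ.integral_fst]
    ring

theorem realSign_mul_pos {m : ℝ} (hm : 0 < m) (x : ℝ) : Real.sign (m * x) = Real.sign x := by
  rcases lt_trichotomy x 0 with h | h | h
  · rw [Real.sign_of_neg h, Real.sign_of_neg (mul_neg_of_pos_of_neg hm h)]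
  · rw [h, mul_zero]
  · rw [Real.sign_of_pos h, Real.sign_of_pos (mul_pos hm h)]

/-- Excluding the edges of the square makes points in different blocks of a skew sum strictly
ordered in both coordinates. -/
theorem IsDoublyStochastic.ae_mem_Ioo {μ : Measure (ℝ × ℝ)} (h : IsDoublyStochastic μ) :
    ∀ᵐ z ∂μ, z.1 ∈ Set.Ioo (0 : ℝ) 1 ∧ z.2 ∈ Set.Ioo (0 : ℝ) 1 := by
  have hz : volume ((Set.Ioo (0 : ℝ) 1)ᶜ ∩ Set.Icc 0 1) = 0 := by
    refine measure_mono_null (t := {0, 1}) (fun x hx => ?_) (Set.Finite.measure_zero (by simp) _)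
    by_contra hx'
    simp only [Set.mem_insert_iff, Set.mem_singleton_iff, not_or] at hx'
    exact hx.1 ⟨hx.2.1.lt_of_ne (Ne.symm hx'.1), hx.2.2.lt_of_ne hx'.2⟩
  refine Filter.Eventually.and ?_ ?_
  · have := h.fst_preimage (measurableSet_Ioo (a := (0 : ℝ)) (b := 1)).compl
    rw [hz] at this
    exact this
  · have := h.snd_preimage (measurableSet_Ioo (a := (0 : ℝ)) (b := 1)).compl
    rw [hz] at this
    exact this

section SkewSum

variable {m : ℝ} {μ₁ μ₂ : Measure (ℝ × ℝ)}

/-- Affine map onto the upper left block of a skew sum. -/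
def upperBlock (m : ℝ) (z : ℝ × ℝ) : ℝ × ℝ := (m * z.1, (1 - m) + m * z.2)

/-- Affine map onto the lower right block of a skew sum. -/
def lowerBlock (m : ℝ) (z : ℝ × ℝ) : ℝ × ℝ := (m + (1 - m) * z.1, (1 - m) * z.2)

/-- Skew sum of two measures on the unit square. -/
noncomputable def skewSum (m : ℝ) (μ₁ μ₂ : Measure (ℝ × ℝ)) : Measure (ℝ × ℝ) :=
  ENNReal.ofReal m • μ₁.map (upperBlock m) + ENNReal.ofReal (1 - m) • μ₂.map (lowerBlock m)

theorem continuous_upperBlock (m : ℝ) : Continuous (upperBlock m) := by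
  unfold upperBlock; fun_prop

theorem continuous_lowerBlock (m : ℝ) : Continuous (lowerBlock m) := by
  unfold lowerBlock; fun_prop

theorem IsDoublyStochastic.skewSum (h0 : 0 < m) (h1 : m < 1) (hμ₁ : IsDoublyStochastic μ₁)
    (hμ₂ : IsDoublyStochastic μ₂) : IsDoublyStochastic (skewSum m μ₁ μ₂) := by
  have hu := (continuous_upperBlock m).measurable
  have hl := (continuous_lowerBlock m).measurable
  constructor
  · rw [_root_.skewSum, Measure.map_add _ _ measurable_fst, Measure.map_smul, Measure.map_smul,
      Measure.map_map measurable_fst hu, Measure.map_map measurable_fst hl]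
    have e1 : μ₁.map (Prod.fst ∘ upperBlock m) = (volume.restrict (Set.Icc (0 : ℝ) 1)).map
        (fun x => m * x) := by
      rw [← hμ₁.fst, Measure.map_map (by fun_prop) measurable_fst]; rfl
    have e2 : μ₂.map (Prod.fst ∘ lowerBlock m) = (volume.restrict (Set.Icc (0 : ℝ) 1)).map
        (fun x => m + (1 - m) * x) := by
      rw [← hμ₂.fst, Measure.map_map (by fun_prop) measurable_fst]; rfl
    rw [e1, e2, uniform_mixture h0 h1]
  · have hmix := uniform_mixture (m := 1 - m) (by linarith) (by linarith)
    rw [sub_sub_cancel] at hmix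
    rw [_root_.skewSum, Measure.map_add _ _ measurable_snd, Measure.map_smul, Measure.map_smul,
      Measure.map_map measurable_snd hu, Measure.map_map measurable_snd hl]
    rw [add_comm]
    have e1 : μ₁.map (Prod.snd ∘ upperBlock m) = (volume.restrict (Set.Icc (0 : ℝ) 1)).map
        (fun x => 1 - m + m * x) := by
      rw [← hμ₁.snd, Measure.map_map (by fun_prop) measurable_snd]; rfl
    have e2 : μ₂.map (Prod.snd ∘ lowerBlock m) = (volume.restrict (Set.Icc (0 : ℝ) 1)).map
        (fun x => (1 - m) * x) := by
      rw [← hμ₂.snd, Measure.map_map (by fun_prop) measurable_snd]; rfl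
    rw [e1, e2, hmix]

theorem integral_skewSum (h0 : 0 < m) (h1 : m < 1) {f : ℝ × ℝ → ℝ} (hf : Measurable f)
    (hf1 : Integrable (fun z => f (upperBlock m z)) μ₁)
    (hf2 : Integrable (fun z => f (lowerBlock m z)) μ₂) :
    ∫ z, f z ∂(skewSum m μ₁ μ₂) =
      m * ∫ z, f (upperBlock m z) ∂μ₁ + (1 - m) * ∫ z, f (lowerBlock m z) ∂μ₂ := by
  have hu := (continuous_upperBlock m).measurable
  have hl := (continuous_lowerBlock m).measurable
  have i1 : Integrable f (μ₁.map (upperBlock m)) :=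
    (integrable_map_measure hf.aestronglyMeasurable hu.aemeasurable).2 hf1
  have i2 : Integrable f (μ₂.map (lowerBlock m)) :=
    (integrable_map_measure hf.aestronglyMeasurable hl.aemeasurable).2 hf2
  rw [skewSum, integral_add_measure (i1.smul_measure ENNReal.ofReal_ne_top)
    (i2.smul_measure ENNReal.ofReal_ne_top), integral_smul_measure, integral_smul_measure,
    integral_map hu.aemeasurable hf.aestronglyMeasurable,
    integral_map hl.aemeasurable hf.aestronglyMeasurable, ENNReal.toReal_ofReal h0.le,
    ENNReal.toReal_ofReal (by linarith)]
  rfl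

theorem signKernel_upper (h0 : 0 < m) (z z' : ℝ × ℝ) :
    signKernel (upperBlock m z) (upperBlock m z') = signKernel z z' := by
  simp only [signKernel, upperBlock, add_sub_add_left_eq_sub, ← mul_sub, realSign_mul_pos h0]

theorem signKernel_lower (h1 : m < 1) (z z' : ℝ × ℝ) :
    signKernel (lowerBlock m z) (lowerBlock m z') = signKernel z z' := by
  have : 0 < 1 - m := by linarith
  simp only [signKernel, lowerBlock, add_sub_add_left_eq_sub, ← mul_sub, realSign_mul_pos this]

theorem signKernel_symm (z z' : ℝ × ℝ) : signKernel z z' = signKernel z' z := by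
  rw [signKernel, signKernel, realSign_sub_comm z.1, realSign_sub_comm z.2]; ring

theorem signKernel_upper_lower (h0 : 0 < m) (h1 : m < 1) {z z' : ℝ × ℝ}
    (hz : z.1 ∈ Set.Ioo (0 : ℝ) 1 ∧ z.2 ∈ Set.Ioo (0 : ℝ) 1)
    (hz' : z'.1 ∈ Set.Ioo (0 : ℝ) 1 ∧ z'.2 ∈ Set.Ioo (0 : ℝ) 1) :
    signKernel (upperBlock m z) (lowerBlock m z') = -1 := by
  have h1' : 0 < 1 - m := by linarith
  have a1 := mul_lt_mul_of_pos_left hz.1.2 h0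
  have a2 := mul_pos h1' hz'.1.1
  have a3 := mul_pos h0 hz.2.1
  have a4 := mul_lt_mul_of_pos_left hz'.2.2 h1'
  simp only [signKernel, upperBlock, lowerBlock]
  rw [Real.sign_of_neg (by linarith), Real.sign_of_pos (by linarith)]
  norm_num

/-- The sign kernel is invariant within each block and equals -1 across blocks, so its double
integral splits. -/
theorem concordance_skewSum (h0 : 0 < m) (h1 : m < 1) (hμ₁ : IsDoublyStochastic μ₁)
    (hμ₂ : IsDoublyStochastic μ₂) : concordance (skewSum m μ₁ μ₂) =
      m ^ 2 * concordance μ₁ + (1 - m) ^ 2 * concordance μ₂ := by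
  have p1 := hμ₁.isProbabilityMeasure
  have p2 := hμ₂.isProbabilityMeasure
  have hds := hμ₁.skewSum h0 h1 hμ₂
  have p3 := hds.isProbabilityMeasure
  have hu := (continuous_upperBlock m).measurable
  have hl := (continuous_lowerBlock m).measurable
  have hk := hds.integral_signKernel
  have k1 := hμ₁.integral_signKernel
  have k2 := hμ₂.integral_signKernel
  have hin : ∀ z, ∫ z', signKernel z z' ∂(skewSum m μ₁ μ₂) =
      m * ∫ z', signKernel z (upperBlock m z') ∂μ₁ +
        (1 - m) * ∫ z', signKernel z (lowerBlock m z') ∂μ₂ := fun z =>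
    integral_skewSum h0 h1 (measurable_signKernel_right z)
      (integrable_of_abs_le ((measurable_signKernel_right z).comp hu) fun _ => abs_signKernel_le _ _)
      (integrable_of_abs_le ((measurable_signKernel_right z).comp hl) fun _ => abs_signKernel_le _ _)
  have hKm : Measurable fun z => ∫ z', signKernel z z' ∂(skewSum m μ₁ μ₂) :=
    (measurable_signKernel.stronglyMeasurable.integral_prod_right).measurable
  have hKb : ∀ z, |∫ z', signKernel z z' ∂(skewSum m μ₁ μ₂)| ≤ 1 := fun z => by
    have := norm_integral_le_of_norm_le_const (μ := skewSum m μ₁ μ₂) (f := signKernel z) (C := 1)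
      (Filter.Eventually.of_forall fun z' => abs_signKernel_le z z')
    simpa using this
  have eU : (fun z => ∫ z', signKernel (upperBlock m z) z' ∂(skewSum m μ₁ μ₂)) =ᵐ[μ₁]
      fun z => m * ∫ z', signKernel z z' ∂μ₁ + (1 - m) * (-1) := by
    filter_upwards [hμ₁.ae_mem_Ioo] with z hz
    rw [hin]
    simp only [signKernel_upper h0]
    congr 2
    have : (fun z' => signKernel (upperBlock m z) (lowerBlock m z')) =ᵐ[μ₂] fun _ => -1 := by
      filter_upwards [hμ₂.ae_mem_Ioo] with z' hz'
      exact signKernel_upper_lower h0 h1 hz hz'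
    rw [integral_congr_ae this]; simp
  have eL : (fun z => ∫ z', signKernel (lowerBlock m z) z' ∂(skewSum m μ₁ μ₂)) =ᵐ[μ₂]
      fun z => m * (-1) + (1 - m) * ∫ z', signKernel z z' ∂μ₂ := by
    filter_upwards [hμ₂.ae_mem_Ioo] with z hz
    rw [hin]
    simp only [signKernel_lower h1]
    congr 2
    have : (fun z' => signKernel (lowerBlock m z) (upperBlock m z')) =ᵐ[μ₁] fun _ => -1 := by
      filter_upwards [hμ₁.ae_mem_Ioo] with z' hz'
      rw [signKernel_symm]
      exact signKernel_upper_lower h0 h1 hz' hz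
    rw [integral_congr_ae this]; simp
  rw [integral_skewSum h0 h1 hKm (integrable_of_abs_le (hKm.comp hu) fun _ => hKb _)
    (integrable_of_abs_le (hKm.comp hl) fun _ => hKb _), integral_congr_ae eU,
    integral_congr_ae eL] at hk
  have i1 : Integrable (fun z => ∫ z', signKernel z z' ∂μ₁) μ₁ :=
    (integrable_of_abs_le (μ := μ₁.prod μ₁) measurable_signKernel fun _ =>
        abs_signKernel_le _ _).integral_prod_left
  have i2 : Integrable (fun z => ∫ z', signKernel z z' ∂μ₂) μ₂ :=
    (integrable_of_abs_le (μ := μ₂.prod μ₂) measurable_signKernel fun _ =>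
        abs_signKernel_le _ _).integral_prod_left
  rw [integral_add (i1.const_mul m) (integrable_const _),
    integral_add (integrable_const _) (i2.const_mul _),
    integral_const_mul m (fun z => ∫ z', signKernel z z' ∂μ₁),
    integral_const_mul (1 - m) (fun z => ∫ z', signKernel z z' ∂μ₂), k1, k2] at hk
  simp only [integral_const, probReal_univ, smul_eq_mul, one_mul] at hk
  linarith

theorem integral_mul_skewSum (h0 : 0 < m) (h1 : m < 1) (hμ₁ : IsDoublyStochastic μ₁)
    (hμ₂ : IsDoublyStochastic μ₂) : ∫ z, z.1 * z.2 ∂(skewSum m μ₁ μ₂) =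
      m * (1 - m) / 2 + m ^ 3 * (∫ z, z.1 * z.2 ∂μ₁) + (1 - m) ^ 3 * ∫ z, z.1 * z.2 ∂μ₂ := by
  have hu := continuous_upperBlock m
  have hl := continuous_lowerBlock m
  rw [integral_skewSum h0 h1 (f := fun z => z.1 * z.2) (by fun_prop)
    (hμ₁.integrable_of_continuous (by fun_prop)) (hμ₂.integrable_of_continuous (by fun_prop))]
  have e1 : (fun z => (upperBlock m z).1 * (upperBlock m z).2) =
      fun z => m * (1 - m) * z.1 + m ^ 2 * (z.1 * z.2) := by
    funext z; simp only [upperBlock]; ring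
  have e2 : (fun z => (lowerBlock m z).1 * (lowerBlock m z).2) =
      fun z => m * (1 - m) * z.2 + (1 - m) ^ 2 * (z.1 * z.2) := by
    funext z; simp only [lowerBlock]; ring
  simp only [e1, e2]
  rw [integral_add (hμ₁.integrable_of_continuous (by fun_prop))
    (hμ₁.integrable_of_continuous (by fun_prop)),
    integral_add (hμ₂.integrable_of_continuous (by fun_prop))
    (hμ₂.integrable_of_continuous (by fun_prop)), integral_const_mul, integral_const_mul,
    integral_const_mul, integral_const_mul, hμ₁.integral_fst, hμ₂.integral_snd]
  ring

theorem Achievable.skewSum {d₁ F₁ d₂ F₂ : ℝ} (h0 : 0 < m) (h1 : m < 1) (hA₁ : Achievable d₁ F₁)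
    (hA₂ : Achievable d₂ F₂) :
    Achievable (m ^ 2 * d₁ + (1 - m) ^ 2 * d₂) (m ^ 3 * F₁ + (1 - m) ^ 3 * F₂) := by
  obtain ⟨μ₁, hμ₁, rfl, rfl⟩ := hA₁
  obtain ⟨μ₂, hμ₂, rfl, rfl⟩ := hA₂
  refine ⟨_, hμ₁.skewSum h0 h1 hμ₂, concordance_skewSum h0 h1 hμ₁ hμ₂, ?_⟩
  rw [integral_mul_skewSum h0 h1 hμ₁ hμ₂]
  ring

end SkewSum

/-! ### Attainability of the region between the bounds. -/

/-- `Achievable` for measures of total mass `s`, with unnormalised densities. -/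
def ScaledAchievable (s d F : ℝ) : Prop :=
  (s = 0 ∧ d = 0 ∧ F = 0) ∨ (0 < s ∧ Achievable (d / s ^ 2) (F / s ^ 3))

theorem scaledAchievable_one {d F : ℝ} : ScaledAchievable 1 d F ↔ Achievable d F := by
  simp [ScaledAchievable]

theorem ScaledAchievable.add {s₁ d₁ F₁ s₂ d₂ F₂ : ℝ} (h₁ : ScaledAchievable s₁ d₁ F₁)
    (h₂ : ScaledAchievable s₂ d₂ F₂) :
    ScaledAchievable (s₁ + s₂) (d₁ + d₂) (F₁ + F₂) := by
  rcases h₁ with ⟨rfl, rfl, rfl⟩ | ⟨p₁, a₁⟩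
  · simpa using h₂
  rcases h₂ with ⟨rfl, rfl, rfl⟩ | ⟨p₂, a₂⟩
  · rw [add_zero, add_zero, add_zero]
    exact Or.inr ⟨p₁, a₁⟩
  refine Or.inr ⟨by positivity, ?_⟩
  have hs : 0 < s₁ + s₂ := by positivity
  have h := Achievable.skewSum (m := s₁ / (s₁ + s₂)) (by positivity)
    ((div_lt_one hs).2 (by linarith)) a₁ a₂
  have e : 1 - s₁ / (s₁ + s₂) = s₂ / (s₁ + s₂) := by field_simp; ring
  rw [e] at h
  convert h using 1 <;> field_simp

theorem scaledAchievable_clique {u : ℝ} (hu : 0 ≤ u) : ScaledAchievable u (u ^ 2) (u ^ 3) := by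
  rcases hu.eq_or_lt with rfl | h
  · exact Or.inl (by simp)
  · refine Or.inr ⟨h, ?_⟩
    rw [div_self (by positivity), div_self (by positivity)]
    exact achievable_one

theorem scaledAchievable_zero {r : ℝ} (hr : 0 ≤ r) : ScaledAchievable r 0 0 := by
  rcases hr.eq_or_lt with rfl | h
  · exact Or.inl (by simp)
  · refine Or.inr ⟨h, ?_⟩
    simpa using achievable_one.compl

theorem scaledAchievable_cliques (k : ℕ) {u : ℝ} (hu : 0 ≤ u) :
    ScaledAchievable (k * u) (k * u ^ 2) (k * u ^ 3) := by
  induction k with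
  | zero => exact Or.inl (by simp)
  | succ k ih =>
    have h := ih.add (scaledAchievable_clique hu)
    convert h using 1 <;> push_cast <;> ring

theorem Achievable.scaled {d F m : ℝ} (h : Achievable d F) (hm : 0 < m) :
    ScaledAchievable m (m ^ 2 * d) (m ^ 3 * F) := by
  refine Or.inr ⟨hm, ?_⟩
  rwa [mul_div_cancel_left₀ _ (by positivity), mul_div_cancel_left₀ _ (by positivity)]

/-- The missing mass 1 - s is filled by a decreasing block, which contributes to neither density. -/
theorem Achievable.of_scaled {s d F : ℝ} (h : ScaledAchievable s d F) (hs : s ≤ 1) :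
    Achievable d F := by
  have := h.add (scaledAchievable_zero (r := 1 - s) (by linarith))
  rwa [add_sub_cancel, add_zero, add_zero, scaledAchievable_one] at this

/-- One clique of the optimal partition grows while all others shrink, at constant edge density,
until a single clique of mass √d remains. F varies continuously from `cliqueBound` d to √d³. -/
theorem achievable_low {d F : ℝ} (h0 : 0 < d) (h1 : d ≤ 1) (hF : cliqueBound d ≤ F)
    (hF' : F ≤ √d ^ 3) : Achievable d F := by
  obtain ⟨n, a, b, hn, hb, hba, hsum, hd, hc⟩ := exists_clique_partition h0 h1
  obtain ⟨k, rfl⟩ := Nat.exists_eq_add_of_le hn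
  push_cast at hsum hd hc
  have hk : (0 : ℝ) ≤ k := k.cast_nonneg
  have ha : 0 < a := by
    by_contra h
    have : a = 0 := le_antisymm (not_lt.1 h) (hb.trans hba)
    subst this
    linarith
  set S := (k : ℝ) * a ^ 2 + b ^ 2 with hS
  have hS0 : 0 ≤ S := by positivity
  have hdS : a ^ 2 + S = d := by rw [← hd]; ring
  let f : ℝ → ℝ := fun t => √(a ^ 2 + t * S) ^ 3 + (k * (√(1 - t) * a) ^ 3 + (√(1 - t) * b) ^ 3)
  have hf : ContinuousOn f (Set.Icc 0 1) := by
    apply Continuous.continuousOn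
    fun_prop
  have hf0 : f 0 = cliqueBound d := by
    simp only [f, zero_mul, add_zero, sub_zero, Real.sqrt_one, one_mul, Real.sqrt_sq ha.le]
    rw [hc]; ring
  have hf1 : f 1 = √d ^ 3 := by simp [f, hdS]
  obtain ⟨t, ⟨ht0, ht1⟩, rfl⟩ := intermediate_value_Icc zero_le_one hf
    (show F ∈ Set.Icc (f 0) (f 1) from ⟨hf0 ▸ hF, hf1 ▸ hF'⟩)
  have hq : √(1 - t) ^ 2 = 1 - t := Real.sq_sqrt (by linarith)
  have hq0 := Real.sqrt_nonneg (1 - t)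
  have hp : √(a ^ 2 + t * S) ^ 2 = a ^ 2 + t * S := Real.sq_sqrt (by positivity)
  have h := (scaledAchievable_clique (Real.sqrt_nonneg (a ^ 2 + t * S))).add
    ((scaledAchievable_cliques k (mul_nonneg hq0 ha.le)).add
      (scaledAchievable_clique (mul_nonneg hq0 hb)))
  have e : √(a ^ 2 + t * S) ^ 2 + (k * (√(1 - t) * a) ^ 2 + (√(1 - t) * b) ^ 2) = d := by
    rw [hp, mul_pow, mul_pow, hq, ← hdS, hS]; ring
  rw [e] at h
  refine Achievable.of_scaled h ?_
  -- The total mass never exceeds 1: from S ≤ a c the growing clique gains at most t c/2, and √(1-t)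
  -- ≤ 1 - t/2 makes the others lose at least that much.
  set c := (k : ℝ) * a + b with hcdef
  have hc0 : 0 ≤ c := by positivity
  have hSc : S ≤ a * c := by rw [hS, hcdef]; nlinarith
  have hq1 : √(1 - t) ≤ 1 - t / 2 := Real.sqrt_le_iff.2 ⟨by linarith, by nlinarith⟩
  have hp1 : √(a ^ 2 + t * S) ≤ a + t * c / 2 := by
    refine Real.sqrt_le_iff.2 ⟨by positivity, ?_⟩
    nlinarith [mul_le_mul_of_nonneg_left hSc ht0, sq_nonneg (t * c)]
  have e2 : k * (√(1 - t) * a) + √(1 - t) * b = √(1 - t) * c := by rw [hcdef]; ring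
  have e3 : a + c = 1 := by rw [← hsum, hcdef]; ring
  rw [e2]
  nlinarith [mul_le_mul_of_nonneg_right hq1 hc0]

/-- A block of mass m carries the reflection of a clique of mass √(m²-d), and everything else is
decreasing. The edge density is m² - (m² - d) = d throughout. At m = √d the block is a clique of
mass √d; at m = 1 the configuration is the reflection of a clique of mass √(1-d). -/
theorem achievable_mid {d F : ℝ} (h0 : 0 < d) (h1 : d ≤ 1) (hF : √d ^ 3 ≤ F)
    (hF' : F ≤ 1 - √(1 - d) ^ 3) : Achievable d F := by
  have hd : √d ^ 2 = d := Real.sq_sqrt h0.le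
  have hd1 : √d ≤ 1 := Real.sqrt_le_one.2 h1
  let f : ℝ → ℝ := fun m => m ^ 3 - √(m ^ 2 - d) ^ 3
  have hf : ContinuousOn f (Set.Icc (√d) 1) := by
    apply Continuous.continuousOn
    fun_prop
  obtain ⟨m, ⟨hm0, hm1⟩, rfl⟩ := intermediate_value_Icc hd1 hf
    (show F ∈ Set.Icc (f √d) (f 1) from ⟨by simpa [f, hd] using hF, by simpa [f] using hF'⟩)
  have hm : 0 < m := (Real.sqrt_pos.2 h0).trans_le hm0
  have hmd : d ≤ m ^ 2 := by nlinarith [Real.sqrt_nonneg d]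
  have hq : √(m ^ 2 - d) ^ 2 = m ^ 2 - d := Real.sq_sqrt (by linarith)
  have hk0 : 0 ≤ √(m ^ 2 - d) / m := by positivity
  have hk1 : √(m ^ 2 - d) / m ≤ 1 :=
    (div_le_one hm).2 (Real.sqrt_le_iff.2 ⟨hm.le, by linarith⟩)
  have h := ((Achievable.of_scaled (scaledAchievable_clique hk0) hk1).compl).scaled hm
  have e1 : m ^ 2 * (1 - (√(m ^ 2 - d) / m) ^ 2) = d := by
    rw [div_pow, hq]; field_simp; ring
  have e2 : m ^ 3 * (1 - (√(m ^ 2 - d) / m) ^ 3) = m ^ 3 - √(m ^ 2 - d) ^ 3 := by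
    field_simp
  rw [e1, e2] at h
  exact Achievable.of_scaled h hm1

/-- The attainable pairs of densities. -/
theorem achievable_of_bounds {d F : ℝ} (h0 : 0 ≤ d) (h1 : d ≤ 1) (hF : cliqueBound d ≤ F)
    (hF' : F ≤ 1 - cliqueBound (1 - d)) : Achievable d F := by
  rcases h0.eq_or_lt with rfl | h0
  · rw [cliqueBound_zero] at hF
    rw [sub_zero, cliqueBound_one] at hF'
    obtain rfl : F = 0 := by linarith
    simpa using achievable_one.compl
  by_cases c1 : F ≤ √d ^ 3
  · exact achievable_low h0 h1 hF c1
  by_cases c2 : F ≤ 1 - √(1 - d) ^ 3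
  · exact achievable_mid h0 h1 (not_le.1 c1).le c2
  have hd : d < 1 := by
    refine h1.lt_of_ne ?_
    rintro rfl
    rw [sub_self, cliqueBound_zero] at hF'
    simp at c1
    linarith
  -- Above the middle range the reflected pair lies in the low range.
  have h := (achievable_low (d := 1 - d) (F := 1 - F) (by linarith) (by linarith) (by linarith)
    (by linarith)).compl
  simpa using h

/-- The densities of a doubly stochastic measure satisfy both bounds. -/
theorem achievable_iff {d F : ℝ} : Achievable d F ↔
    0 ≤ d ∧ d ≤ 1 ∧ cliqueBound d ≤ F ∧ F ≤ 1 - cliqueBound (1 - d) := by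
  refine ⟨fun h => ?_, fun h => achievable_of_bounds h.1 h.2.1 h.2.2.1 h.2.2.2⟩
  have key : ∀ {d F}, Achievable d F → 0 ≤ d ∧ cliqueBound d ≤ F := by
    rintro d F ⟨μ, hμ, rfl, rfl⟩
    exact ⟨measureReal_nonneg, hμ.cliqueBound_le⟩
  have a := key h
  have b := key h.compl
  exact ⟨a.1, by linarith [b.1], a.2, by linarith [b.2]⟩

/-! ### The region in the coordinates τ and ρ. -/

theorem mem_exactRegion_iff {p : ℝ × ℝ} :
    p ∈ exactRegion ↔ Achievable ((1 + p.1) / 2) ((1 + p.2) / 2) := by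
  rw [exactRegion_eq_dsRegion]
  constructor
  · rintro ⟨μ, hμ, rfl⟩
    exact ⟨μ, hμ, by ring, by ring⟩
  · rintro ⟨μ, hμ, h1, h2⟩
    exact ⟨μ, hμ, Prod.ext (by rw [h1]; ring) (by linarith)⟩

theorem cliqueBound_half (x : ℝ) : cliqueBound ((1 + x) / 2) = (Phi x + 1) / 2 := by
  rw [cliqueBound]
  congr 3
  ring

theorem mem_exactRegion {p : ℝ × ℝ} : p ∈ exactRegion ↔
    p.1 ∈ Set.Icc (-1 : ℝ) 1 ∧ Phi p.1 ≤ p.2 ∧ p.2 ≤ -Phi (-p.1) := by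
  rw [mem_exactRegion_iff, achievable_iff, cliqueBound_half,
    show 1 - (1 + p.1) / 2 = (1 + -p.1) / 2 by ring, cliqueBound_half]
  constructor
  · rintro ⟨h1, h2, h3, h4⟩
    exact ⟨⟨by linarith, by linarith⟩, by linarith, by linarith⟩
  · rintro ⟨⟨h1, h2⟩, h3, h4⟩
    exact ⟨by linarith, by linarith, by linarith, by linarith⟩

theorem parabola_le_Phi {x : ℝ} (hx : x ∈ Set.Icc (-1 : ℝ) 1) : (1 + x) ^ 2 / 2 - 1 ≤ Phi x := by
  have := sq_le_cliqueBound (d := (1 + x) / 2) (by linarith [hx.1]) (by linarith [hx.2])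
  rw [cliqueBound_half] at this
  linarith

theorem Phi_le_self {x : ℝ} (hx : x ∈ Set.Icc (-1 : ℝ) 1) : Phi x ≤ x := by
  have := cliqueBound_le_self (d := (1 + x) / 2) (by linarith [hx.1]) (by linarith [hx.2])
  rw [cliqueBound_half] at this
  linarith

theorem neg_mem_Icc_one {x : ℝ} (hx : x ∈ Set.Icc (-1 : ℝ) 1) : -x ∈ Set.Icc (-1 : ℝ) 1 :=
  ⟨by linarith [hx.2], by linarith [hx.1]⟩

theorem durbin_stuart {p : ℝ × ℝ} (hp : p ∈ exactRegion) :
    (1 + p.1) ^ 2 / 2 - 1 ≤ p.2 ∧ p.2 ≤ 1 - (1 - p.1) ^ 2 / 2 := by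
  obtain ⟨h1, h2, h3⟩ := mem_exactRegion.1 hp
  have a := parabola_le_Phi h1
  have b := parabola_le_Phi (neg_mem_Icc_one h1)
  rw [← sub_eq_add_neg] at b
  exact ⟨by linarith, by linarith⟩

theorem exactRegion_eq_regionPhi : exactRegion = regionPhi := by
  ext p
  rw [mem_exactRegion]
  constructor
  · rintro ⟨h1, h2, h3⟩
    have := durbin_stuart (mem_exactRegion.2 ⟨h1, h2, h3⟩)
    exact ⟨h1, ⟨by nlinarith [sq_nonneg (1 + p.1)], by nlinarith [sq_nonneg (1 - p.1)]⟩, h2, h3⟩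
  · rintro ⟨h1, -, h2, h3⟩
    exact ⟨h1, h2, h3⟩

theorem neg_mem_exactRegion {p : ℝ × ℝ} (hp : p ∈ exactRegion) : -p ∈ exactRegion := by
  rw [mem_exactRegion_iff] at hp ⊢
  convert hp.compl using 1 <;> simp only [Prod.fst_neg, Prod.snd_neg] <;> ring

theorem diag_mem_exactRegion {x : ℝ} (hx : x ∈ Set.Icc (-1 : ℝ) 1) : (x, x) ∈ exactRegion :=
  mem_exactRegion.2 ⟨hx, Phi_le_self hx, by linarith [Phi_le_self (neg_mem_Icc_one hx)]⟩

theorem dsPoint_mem_exactRegion {n : ℕ} (hn : 1 ≤ n) : dsPoint n ∈ exactRegion := by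
  have h0 : (1 : ℝ) ≤ n := by exact_mod_cast hn
  have h1 : (1 : ℝ) / n ≤ 1 := (div_le_one (by linarith)).2 h0
  have h2 : (0 : ℝ) < 1 / n := by positivity
  rw [mem_exactRegion_iff, achievable_iff]
  have e1 : (1 + (dsPoint n).1) / 2 = 1 / n := by simp only [dsPoint]; ring
  have e2 : (1 + (dsPoint n).2) / 2 = (1 / n) ^ 2 := by simp only [dsPoint]; ring
  -- For the upper boundary, 1 - `cliqueBound` (1 - 1/n) ≥ 1/n ≥ 1/n².
  have h3 := cliqueBound_le_self (d := 1 - 1 / (n : ℝ)) (by linarith) (by linarith)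
  rw [e1, e2]
  exact ⟨h2.le, h1, ((cliqueBound_eq_sq_iff h2 h1).2 ⟨n, hn, rfl⟩).le, by nlinarith⟩

theorem durbin_stuart_eq_iff {p : ℝ × ℝ} :
    (p ∈ exactRegion ∧ p.2 = (1 + p.1) ^ 2 / 2 - 1) ↔
      (p = (-1, -1) ∨ ∃ n : ℕ, 1 ≤ n ∧ p = dsPoint n) := by
  constructor
  · rintro ⟨hp, he⟩
    rw [mem_exactRegion_iff, achievable_iff] at hp
    obtain ⟨h0, h1, h2, -⟩ := hp
    rcases h0.eq_or_lt with h0 | h0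
    · have e : p.1 = -1 := by linarith
      refine Or.inl (Prod.ext e ?_)
      rw [he, e]; norm_num
    · have h3 := sq_le_cliqueBound h0.le h1
      obtain ⟨k, hk, hd⟩ := (cliqueBound_eq_sq_iff h0 h1).1 (le_antisymm (by nlinarith) h3)
      have e : 1 + p.1 = 2 / k := by
        rw [show (2 : ℝ) / k = 2 * (1 / k) by ring, ← hd]; ring
      refine Or.inr ⟨k, hk, Prod.ext ?_ ?_⟩
      · simp only [dsPoint]; linarith
      · simp only [dsPoint]; rw [he, e]; ring
  · rintro (rfl | ⟨n, hn, rfl⟩)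
    · exact ⟨diag_mem_exactRegion (by norm_num), by norm_num⟩
    · exact ⟨dsPoint_mem_exactRegion hn, by simp only [dsPoint]; ring⟩

theorem durbin_stuart_upper_eq_iff {p : ℝ × ℝ} :
    (p ∈ exactRegion ∧ p.2 = 1 - (1 - p.1) ^ 2 / 2) ↔
      (p = (1, 1) ∨ ∃ n : ℕ, 1 ≤ n ∧ p = -dsPoint n) := by
  have h := durbin_stuart_eq_iff (p := -p)
  have e1 : -p ∈ exactRegion ↔ p ∈ exactRegion :=
    ⟨fun h => neg_neg p ▸ neg_mem_exactRegion h, neg_mem_exactRegion⟩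
  have e2 : (-p).2 = (1 + (-p).1) ^ 2 / 2 - 1 ↔ p.2 = 1 - (1 - p.1) ^ 2 / 2 := by
    simp only [Prod.fst_neg, Prod.snd_neg, ← sub_eq_add_neg]
    constructor <;> intro h <;> linarith
  have e3 : -p = (-1, -1) ↔ p = (1, 1) := by
    rw [show ((-1, -1) : ℝ × ℝ) = -(1, 1) from rfl, neg_inj]
  rw [e1, e2, e3] at h
  simpa only [neg_eq_iff_eq_neg] using h

/-- Between consecutive touching points the lower boundary bulges above the chord: the midpoint of
p₂ and p₃ has d = 5/12 and F = 13/72, below `cliqueBound` (5/12). -/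
theorem not_convex_exactRegion : ¬ Convex ℝ exactRegion := by
  intro hc
  have h := hc (dsPoint_mem_exactRegion (n := 2) (by norm_num))
    (dsPoint_mem_exactRegion (n := 3) (by norm_num)) (a := 1 / 2) (b := 1 / 2) (by norm_num)
    (by norm_num) (by norm_num)
  rw [mem_exactRegion_iff, achievable_iff] at h
  have h1 := h.2.2.1
  simp only [dsPoint, Prod.smul_mk, Prod.mk_add_mk, smul_eq_mul] at h1
  have h2 : √2 ^ 2 = (2 : ℝ) := Real.sq_sqrt (by norm_num)
  have h3 : √2 ≤ (3 / 2 : ℝ) := Real.sqrt_le_iff.2 (by norm_num)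
  have h4 := Real.sqrt_nonneg 2
  -- For n = 3 and d = 5/12 the gap is a - b = √(1/8) = √2/4, which gives these clique sizes.
  have key := cliqueBound_param (n := 3) (a := (4 + √2) / 12) (b := (4 - 2 * √2) / 12)
    (by norm_num) (by linarith) (by linarith) (by push_cast; ring)
  have e : ((3 : ℕ) - 1 : ℝ) * ((4 + √2) / 12) ^ 2 + ((4 - 2 * √2) / 12) ^ 2 = 5 / 12 := by
    push_cast; nlinarith
  rw [e] at key
  have e' : ((3 : ℕ) - 1 : ℝ) * ((4 + √2) / 12) ^ 3 + ((4 - 2 * √2) / 12) ^ 3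
      = (336 - 12 * √2) / 1728 := by
    push_cast
    linear_combination ((72 - 6 * √2) / 1728) * h2
  rw [e'] at key
  norm_num at h1
  rw [key] at h1
  linarith

theorem continuousOn_Phi : ContinuousOn Phi (Set.Icc (-1) 1) := by
  have h : ContinuousOn (fun x : ℝ => 2 * cliqueBound ((1 + x) / 2) - 1) (Set.Icc (-1) 1) := by
    refine ContinuousOn.sub (continuousOn_const.mul (continuousOn_cliqueBound.comp
      (by fun_prop) fun x hx => ?_)) continuousOn_const
    exact ⟨by linarith [hx.1], by linarith [hx.2]⟩
  exact h.congr fun x _ => by simp only [cliqueBound_half]; ring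

theorem isCompact_exactRegion : IsCompact exactRegion := by
  have hK : IsCompact (Set.Icc (-1 : ℝ) 1 ×ˢ Set.Icc (-1 : ℝ) 1) := isCompact_Icc.prod isCompact_Icc
  have h1 : ContinuousOn (fun p : ℝ × ℝ => p.2 - Phi p.1)
      (Set.Icc (-1 : ℝ) 1 ×ˢ Set.Icc (-1 : ℝ) 1) :=
    continuousOn_snd.sub (continuousOn_Phi.comp continuousOn_fst fun p hp => hp.1)
  have h2 : ContinuousOn (fun p : ℝ × ℝ => -Phi (-p.1) - p.2)
      (Set.Icc (-1 : ℝ) 1 ×ˢ Set.Icc (-1 : ℝ) 1) :=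
    ((continuousOn_Phi.comp (continuousOn_fst.neg) fun p hp => neg_mem_Icc_one hp.1).neg).sub
      continuousOn_snd
  have c1 := h1.preimage_isClosed_of_isClosed hK.isClosed (isClosed_Ici (a := 0))
  have c2 := h2.preimage_isClosed_of_isClosed hK.isClosed (isClosed_Ici (a := 0))
  refine hK.of_isClosed_subset ?_ fun p hp => ?_
  · convert c1.inter c2 using 1
    rw [exactRegion_eq_regionPhi]
    ext p
    constructor
    · rintro ⟨a1, a2, a3, a4⟩
      exact ⟨⟨⟨a1, a2⟩, sub_nonneg.2 a3⟩, ⟨a1, a2⟩, sub_nonneg.2 a4⟩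
    · rintro ⟨⟨⟨a1, a2⟩, a3⟩, -, a4⟩
      exact ⟨a1, a2, sub_nonneg.1 a3, sub_nonneg.1 a4⟩
  · rw [exactRegion_eq_regionPhi] at hp
    exact ⟨hp.1, hp.2.1⟩

/-- Vertical sections are intervals that contain the diagonal point, so the region slides vertically
onto the diagonal, which then shrinks to the origin. -/
theorem contractibleSpace_exactRegion : ContractibleSpace exactRegion := by
  rw [contractible_iff_id_nullhomotopic]
  have hI : ∀ p : exactRegion, p.1.1 ∈ Set.Icc (-1 : ℝ) 1 := fun p => (mem_exactRegion.1 p.2).1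
  let D : C(exactRegion, exactRegion) :=
    ⟨fun p => ⟨(p.1.1, p.1.1), diag_mem_exactRegion (hI p)⟩, by fun_prop⟩
  have vert : ∀ (t : unitInterval) (p : exactRegion),
      (p.1.1, (1 - t.1) * p.1.2 + t.1 * p.1.1) ∈ exactRegion := fun t p => by
    obtain ⟨h1, h2, h3⟩ := mem_exactRegion.1 p.2
    obtain ⟨-, g2, g3⟩ := mem_exactRegion.1 (diag_mem_exactRegion (hI p))
    have t0 := t.2.1
    have t1 := t.2.2
    refine mem_exactRegion.2 ⟨h1, ?_, ?_⟩
    · dsimp only at g2 ⊢; nlinarith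
    · dsimp only at g3 ⊢; nlinarith
  have diag : ∀ (t : unitInterval) (p : exactRegion),
      ((1 - t.1) * p.1.1, (1 - t.1) * p.1.1) ∈ exactRegion := fun t p => by
    have t0 := t.2.1
    have t1 := t.2.2
    obtain ⟨a, b⟩ := hI p
    exact diag_mem_exactRegion ⟨by nlinarith, by nlinarith⟩
  have hD : (ContinuousMap.id exactRegion).Homotopic D :=
    ⟨{ toFun := fun q => ⟨_, vert q.1 q.2⟩
       continuous_toFun := by fun_prop
       map_zero_left := fun p => by simp
       map_one_left := fun p => by simp [D] }⟩
  have h0 : D.Homotopic (ContinuousMap.const exactRegion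
      ⟨((0 : ℝ), (0 : ℝ)), diag_mem_exactRegion (by norm_num)⟩) :=
    ⟨{ toFun := fun q => ⟨_, diag q.1 q.2⟩
       continuous_toFun := by fun_prop
       map_zero_left := fun p => by simp [D]
       map_one_left := fun p => by simp }⟩
  exact ⟨_, hD.trans h0⟩

theorem isSimplyConnected_exactRegion : IsSimplyConnected exactRegion :=
  have := contractibleSpace_exactRegion
  (inferInstance : SimplyConnectedSpace exactRegion)

theorem theorem5p1 :
    exactRegion = regionPhi ∧
    copulaRegion = exactRegion ∧
    ¬ Convex ℝ exactRegion ∧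
    IsCompact exactRegion ∧
    IsSimplyConnected exactRegion ∧
    (∀ p ∈ exactRegion,
      (1 + p.1) ^ 2 / 2 - 1 ≤ p.2 ∧ p.2 ≤ 1 - (1 - p.1) ^ 2 / 2) ∧
    {p ∈ exactRegion | p.2 = (1 + p.1) ^ 2 / 2 - 1} =
      {p | p = (-1, -1) ∨ ∃ n : ℕ, 1 ≤ n ∧ p = dsPoint n} ∧
    {p ∈ exactRegion | p.2 = 1 - (1 - p.1) ^ 2 / 2} =
      {p | p = (1, 1) ∨ ∃ n : ℕ, 1 ≤ n ∧ p = -dsPoint n} :=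
  ⟨exactRegion_eq_regionPhi, copulaRegion_eq_exactRegion, not_convex_exactRegion,
    isCompact_exactRegion, isSimplyConnected_exactRegion, fun _ hp => durbin_stuart hp,
    Set.ext fun _ => durbin_stuart_eq_iff, Set.ext fun _ => durbin_stuart_upper_eq_iff⟩
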